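/- \textbf{Theorem (Talagrand's positivity principle).} For $N\ge 1$ let $S=\{z\in\mathbb{R}^N:|z|=1\}$ be the Euclidean unit sphere and, for $v\ge 0$ and $z\in S$, let $$g(z)=v\sum_{p\ge 1}2^{-p}x_p\,g_p(z),\qquad g_p(z)=\sum_{1\le i_1,\dots,i_p\le N}g_{i_1,\dots,i_p}\,z_{i_1}\cdots z_{i_p},$$ where the $x_p$ are uniform on $[0,1]$, the $g_{i_1,\dots,i_p}$ ($p\ge1$, $1\le i_1,\dots,i_p\le N$) are standard Gaussian, and all these random variables are jointly independent. For a probability measure $\nu$ on $S$ let $\nu_g$ be the random probability measure on $S$ given by $$\frac{d\nu_g}{d\nu}(z)=\frac{e^{g(z)}}{\int e^{g}\,d\nu}.$$ This is well defined: almost surely the series for $g(z)$ converges absolutely for $\nu$-almost every $z$ and $e^{g}$ is $\nu$-integrable. For every $\varepsilon>0$ there is $v_0\ge 1$, depending only on $\varepsilon$ (not on $N$ or $\nu$), such that for every $v\ge v_0$, every $N\ge 1$ and every probability measure $\nu$ on $S$, $$\mathbb{E}\,\nu_g^{\otimes 2}\bigl\{(z^1,z^2): z^1\cdot z^2\le-\varepsilon\bigr\}\le\varepsilon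 ,$$ where $\mathbb{E}$ is the expectation over all the $x_p$ and $g_{i_1,\dots,i_p}$. -/

import Mathlib

open MeasureTheory ProbabilityTheory

/-- The unit sphere `S = {z ∈ ℝ^N : |z| = 1}` of Euclidean space, as a type. -/
abbrev UnitSphere (N : ℕ) : Type :=
  Metric.sphere (0 : EuclideanSpace ℝ (Fin N)) 1

/-- The index set of the Gaussian coefficients `g_{i_1, …, i_p}`: an order `p ≥ 1` together with a
multi-index `(i_1, …, i_p) ∈ {1, …, N}^p`. -/
abbrev CoeffIndex (N : ℕ) : Type :=
  Σ p : ℕ+, (Fin (p : ℕ) → Fin N)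

/-- The `p`-spin form `g_p(z) = ∑_{i_1, …, i_p} g_{i_1, …, i_p} z_{i_1} ⋯ z_{i_p}`. -/
noncomputable def pSpin {N : ℕ} (G : CoeffIndex N → ℝ) (p : ℕ+) (z : UnitSphere N) : ℝ :=
  ∑ i : Fin (p : ℕ) → Fin N, G ⟨p, i⟩ * ∏ k, (z : EuclideanSpace ℝ (Fin N)) (i k)

/-- The `p`-th term `2^{-p} x_p g_p(z)` of the mixed field. -/
noncomputable def mixedTerm {N : ℕ} (x : ℕ+ → ℝ) (G : CoeffIndex N → ℝ) (z : UnitSphere N)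
    (p : ℕ+) : ℝ :=
  (2 : ℝ)⁻¹ ^ (p : ℕ) * x p * pSpin G p z

/-- The mixed field `g(z) = v ∑_{p ≥ 1} 2^{-p} x_p g_p(z)`. -/
noncomputable def mixedField {N : ℕ} (v : ℝ) (x : ℕ+ → ℝ) (G : CoeffIndex N → ℝ)
    (z : UnitSphere N) : ℝ :=
  v * ∑' p : ℕ+, mixedTerm x G z p

/-- The perturbation `ν_g` of `ν` by the mixed field: `dν_g / dν = e^{g(z)} / ∫ e^{g} dν`. -/
noncomputable def perturbed {N : ℕ} (ν : Measure (UnitSphere N)) (v : ℝ) (x : ℕ+ → ℝ)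
    (G : CoeffIndex N → ℝ) : Measure (UnitSphere N) :=
  ν.tilted (mixedField v x G)

/-- `ν_g^{⊗2}{(z¹, z²) : z¹ · z² ≤ -ε}`. -/
noncomputable def negOverlapProb {N : ℕ} (ε : ℝ) (ν : Measure (UnitSphere N)) (v : ℝ)
    (x : ℕ+ → ℝ) (G : CoeffIndex N → ℝ) : ENNReal :=
  ((perturbed ν v x G).prod (perturbed ν v x G))
    {q : UnitSphere N × UnitSphere N |
      inner ℝ (q.1 : EuclideanSpace ℝ (Fin N)) (q.2 : EuclideanSpace ℝ (Fin N)) ≤ -ε}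

/-!
The idea is that a small smooth perturbation of the Hamiltonian forces the Ghirlanda–Guerra
identities, and these forbid negative overlaps. Write `⟨·⟩` for averages over replicas
`z¹, z², …`, which are independent samples of `ν_g`, write `R_{l,l'} = z^l · z^{l'}`, and let `E`
be the expectation over the Gaussian disorder for fixed `x`.

*Concentration.* The free energy `log ∫ e^g dν` is convex in each `x_p`, and its derivative is
`⟨v 2^{-p} g_p⟩`. Interpolating between two independent copies of the disorder by a rotation shows
that it fluctuates by `o(v²)`, uniformly in `N` and `ν` (`exists_integral_abs_logZ_sub_le`). By
convexity its derivative in `x_p` has small fluctuations for most `x_p`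
(`lintegral_subgradient_sub_le`); the thermal fluctuations are controlled because the Gibbs variance
is the second derivative (`lintegral_thermal_le`). Hence `v 2^{-p} g_p` differs from its mean by
`o(v²)` on average (`exists_lintegral_pSpin_sub_le`).

*Identities.* For `|f| ≤ 1` depending on `n` replicas, Gaussian integration by parts
(`integral_replicas_pSpin`) computes the correlation of `f` with `v 2^{-p} g_p(z^l)`, whose
covariance is of order `v²`. Together with the concentration this gives
`n E⟨f h(R_{l,n+1})⟩ ≈ E⟨f⟩ E⟨h(R_{1,2})⟩ + ∑_{l' ≠ l} E⟨f h(R_{l,l'})⟩` in `L¹(dx)` as `v → ∞`,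
for `h(r) = r^p` and, by Weierstrass approximation, for every continuous `h`
(`asymptoticIdentity_of_continuous`).

*Positivity.* Let `a = E⟨1(R_{1,2} ≤ -ε)⟩`. Applying the identities with `f` supported on the
`n`-tuples whose overlaps are all negative, and with a cutoff `h` equal to `1` on those overlaps, one
finds that the probability that all overlaps of `n + 1` replicas are negative is at least `a` times
that for `n` replicas, up to a small error (`avg_weight_succ_ge`). Thus this probability is at least
about `a^{n-1}`. On the other hand it vanishes for large `n`, since `|z¹ + ⋯ + zⁿ|² ≥ 0`
(`weight_eq_zero`). So `a` is small on average over `x` (`exists_lintegral_negProb_le`).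

Continuity of the cutoffs is the reason for the sequence of thresholds, all below `-ε / 2`, in place
of the single threshold `-ε`.
-/

namespace Positivity

open scoped ENNReal

/-! ### Infinite product measures -/

section InfiniteProducts

variable {ι : Type*}

lemma measurable_update_prod [DecidableEq ι] (i : ι) :
    Measurable (fun q : (ι → ℝ) × ℝ => Function.update q.1 i q.2) := by
  refine measurable_pi_iff.2 fun j => ?_
  by_cases h : j = i
  · subst h; simpa using measurable_snd
  · simp only [Function.update_of_ne h]
    fun_prop

lemma measurable_sumElim_prod {κ : Type*} :
    Measurable (fun q : (ι → ℝ) × (κ → ℝ) => Sum.elim q.1 q.2) := by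
  refine measurable_pi_iff.2 ?_
  rintro (i | i)
  · simp only [Sum.elim_inl]; fun_prop
  · simp only [Sum.elim_inr]; fun_prop

/-- Resampling one coordinate of a product measure does not change its law. -/
lemma map_update_infinitePi [DecidableEq ι] (μ : ι → Measure ℝ) [∀ i, IsProbabilityMeasure (μ i)]
    (i : ι) :
    ((Measure.infinitePi μ).prod (μ i)).map (fun q => Function.update q.1 i q.2)
      = Measure.infinitePi μ := by
  refine Measure.eq_infinitePi μ fun s t ht => ?_
  rw [Measure.map_apply (measurable_update_prod i) (.pi s.countable_toSet fun _ _ => ht _)]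
  by_cases hi : i ∈ s
  · have : (fun q : (ι → ℝ) × ℝ => Function.update q.1 i q.2) ⁻¹' (Set.pi s t)
        = (Set.pi (s.erase i : Finset ι) t) ×ˢ t i := by
      ext ⟨x, y⟩
      simp only [Set.mem_preimage, Set.mem_pi, Set.mem_prod, Finset.mem_coe, Finset.mem_erase]
      constructor
      · intro h
        refine ⟨fun j hj => ?_, ?_⟩
        · simpa [Function.update_of_ne hj.1] using h j hj.2
        · simpa using h i hi
      · rintro ⟨h1, h2⟩ j hj
        by_cases hji : j = i
        · subst hji; simpa using h2
        · simpa [Function.update_of_ne hji] using h1 j ⟨hji, hj⟩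
    rw [this, Measure.prod_prod, Measure.infinitePi_pi μ (fun j _ => ht j),
      Finset.prod_erase_mul _ _ hi]
  · have : (fun q : (ι → ℝ) × ℝ => Function.update q.1 i q.2) ⁻¹' (Set.pi s t)
        = (Set.pi s t) ×ˢ Set.univ := by
      ext ⟨x, y⟩
      simp only [Set.mem_preimage, Set.mem_pi, Set.mem_prod, Finset.mem_coe, Set.mem_univ, and_true]
      refine forall₂_congr fun j hj => ?_
      rw [Function.update_of_ne (by rintro rfl; exact hi hj)]
    rw [this, Measure.prod_prod, Measure.infinitePi_pi μ (fun j _ => ht j)]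
    simp

/-- Two independent families of independent variables form one independent family. -/
lemma map_sumElim_infinitePi {κ : Type*} (μ : ι → Measure ℝ) (μ' : κ → Measure ℝ)
    [∀ i, IsProbabilityMeasure (μ i)] [∀ i, IsProbabilityMeasure (μ' i)]
    [∀ i, IsProbabilityMeasure (Sum.elim μ μ' i)] :
    ((Measure.infinitePi μ).prod (Measure.infinitePi μ')).map (fun q => Sum.elim q.1 q.2)
      = Measure.infinitePi (Sum.elim μ μ') := by
  classical
  refine Measure.eq_infinitePi _ fun s t ht => ?_
  rw [Measure.map_apply measurable_sumElim_prod (.pi s.countable_toSet fun _ _ => ht _)]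
  have : (fun q : (ι → ℝ) × (κ → ℝ) => Sum.elim q.1 q.2) ⁻¹' (Set.pi s t)
      = (Set.pi (s.toLeft : Finset ι) fun i => t (.inl i)) ×ˢ
        (Set.pi (s.toRight : Finset κ) fun i => t (.inr i)) := by
    ext ⟨x, y⟩
    simp [Set.mem_pi]
  rw [this, Measure.prod_prod, Measure.infinitePi_pi μ (fun j _ => ht _),
    Measure.infinitePi_pi μ' (fun j _ => ht _)]
  conv_rhs => rw [← Finset.toLeft_disjSum_toRight (u := s), Finset.prod_disjSum]
  simp

/-- A sequence of independent pairs of independent variables is a pair of independent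
sequences. -/
lemma map_unzip_infinitePi (μ μ' : ι → Measure ℝ) [∀ i, IsProbabilityMeasure (μ i)]
    [∀ i, IsProbabilityMeasure (μ' i)] :
    (Measure.infinitePi fun i => (μ i).prod (μ' i)).map
        (fun q => (⟨fun i => (q i).1, fun i => (q i).2⟩ : (ι → ℝ) × (ι → ℝ)))
      = (Measure.infinitePi μ).prod (Measure.infinitePi μ') := by
  classical
  have hinst : ∀ i, IsProbabilityMeasure (Sum.elim μ μ' i) := by
    rintro (i | i) <;> simp <;> infer_instance
  -- Both sides are compared after gluing the two sequences into one indexed by `ι ⊕ ι`.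
  have hglue : ((Measure.infinitePi fun i => (μ i).prod (μ' i)).map
      (fun q => (⟨fun i => (q i).1, fun i => (q i).2⟩ : (ι → ℝ) × (ι → ℝ)))).map
        (fun q => Sum.elim q.1 q.2) = Measure.infinitePi (Sum.elim μ μ') := by
    rw [Measure.map_map measurable_sumElim_prod (by fun_prop)]
    refine Measure.eq_infinitePi _ fun s t ht => ?_
    rw [Measure.map_apply (measurable_sumElim_prod.comp (by fun_prop))
      (.pi s.countable_toSet fun _ _ => ht _)]
    have : ((fun q : (ι → ℝ) × (ι → ℝ) => Sum.elim q.1 q.2) ∘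
        fun q : ι → ℝ × ℝ => (⟨fun i => (q i).1, fun i => (q i).2⟩ : (ι → ℝ) × (ι → ℝ))) ⁻¹'
          (Set.pi s t)
        = Set.pi (s.toLeft ∪ s.toRight : Finset ι) fun i =>
          (if i ∈ s.toLeft then t (.inl i) else Set.univ) ×ˢ
          (if i ∈ s.toRight then t (.inr i) else Set.univ) := by
      ext q
      simp only [Set.mem_preimage, Set.mem_pi, Function.comp, Finset.mem_coe, Finset.mem_union,
        Finset.mem_toLeft, Finset.mem_toRight, Set.mem_prod]
      constructor
      · intro h i _
        constructor
        · split_ifs with h1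
          · exact h _ h1
          · trivial
        · split_ifs with h1
          · exact h _ h1
          · trivial
      · rintro h (i | i) hi
        · simpa [hi] using (h i (Or.inl hi)).1
        · simpa [hi] using (h i (Or.inr hi)).2
    rw [this, Measure.infinitePi_pi]
    · conv_rhs => rw [← Finset.toLeft_disjSum_toRight (u := s), Finset.prod_disjSum]
      simp only [Measure.prod_prod, Finset.prod_mul_distrib, Sum.elim_inl, Sum.elim_inr]
      congr 1
      · rw [← Finset.prod_subset (Finset.subset_union_left (s₂ := s.toRight))]
        · exact Finset.prod_congr rfl fun i hi => by simp only [hi, if_true]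
        · intro i _ hi
          simp only [hi, if_false, measure_univ]
      · rw [← Finset.prod_subset (Finset.subset_union_right (s₁ := s.toLeft))]
        · exact Finset.prod_congr rfl fun i hi => by simp only [hi, if_true]
        · intro i _ hi
          simp only [hi, if_false, measure_univ]
    · intro i _
      refine MeasurableSet.prod ?_ ?_
      · split_ifs; exacts [ht _, .univ]
      · split_ifs; exacts [ht _, .univ]
  have h2 := map_sumElim_infinitePi μ μ'
  rw [← hglue] at h2
  have h3 := congrArg (Measure.map fun r : ι ⊕ ι → ℝ =>
    (⟨fun i => r (.inl i), fun i => r (.inr i)⟩ : (ι → ℝ) × (ι → ℝ))) h2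
  rw [Measure.map_map (by fun_prop) measurable_sumElim_prod,
    Measure.map_map (by fun_prop) measurable_sumElim_prod] at h3
  exact (Measure.map_id.symm.trans (h3.trans Measure.map_id)).symm

/-- The product of two copies of an i.i.d. centred Gaussian sequence is rotation invariant. -/
lemma map_rotation_infinitePi (θ : ℝ) :
    ((Measure.infinitePi fun _ : ι => gaussianReal 0 1).prod
        (Measure.infinitePi fun _ : ι => gaussianReal 0 1)).map
      (fun q => ((fun i => Real.cos θ * q.1 i + Real.sin θ * q.2 i),
        (fun i => -Real.sin θ * q.1 i + Real.cos θ * q.2 i)))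
      = (Measure.infinitePi fun _ : ι => gaussianReal 0 1).prod
        (Measure.infinitePi fun _ : ι => gaussianReal 0 1) := by
  have h1 : ((gaussianReal 0 1).prod (gaussianReal 0 1)).map (ContinuousLinearMap.rotation θ)
      = (gaussianReal 0 1).prod (gaussianReal 0 1) :=
    IsGaussian.map_rotation_eq_self (by simp) θ
  have h2 := Measure.infinitePi_map_pi (ι := ι)
    (μ := fun _ => (gaussianReal 0 1).prod (gaussianReal 0 1))
    (f := fun _ => (ContinuousLinearMap.rotation θ : ℝ × ℝ →L[ℝ] ℝ × ℝ)) (fun _ => by fun_prop)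
  simp only [h1] at h2
  conv_lhs => rw [← map_unzip_infinitePi]
  conv_rhs => rw [← map_unzip_infinitePi, ← h2]
  rw [Measure.map_map (by fun_prop) (by fun_prop), Measure.map_map (by fun_prop) (by fun_prop)]
  rfl

end InfiniteProducts

/-! ### Calculus of exponentially tilted measures -/

section Tilted

variable {S : Type*} [MeasurableSpace S] {ν : Measure S} {h c f : S → ℝ} {B C : ℝ}

lemma integrable_bdd_mul_exp (hh : Integrable (fun z => Real.exp (h z)) ν) (hf : Measurable f)
    (hfB : ∀ z, |f z| ≤ B) : Integrable (fun z => f z * Real.exp (h z)) ν :=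
  hh.bdd_mul (c := B) hf.aestronglyMeasurable (ae_of_all _ hfB)

lemma integrable_exp_add_bdd (hh : Integrable (fun z => Real.exp (h z)) ν) (hc : Measurable c)
    (hcC : ∀ z, |c z| ≤ C) : Integrable (fun z => Real.exp (h z + c z)) ν := by
  have := integrable_bdd_mul_exp (B := Real.exp C) hh (Real.measurable_exp.comp hc) (fun z => by
    simpa [abs_of_pos (Real.exp_pos _)] using (abs_le.1 (hcC z)).2)
  refine this.congr (ae_of_all _ fun z => ?_)
  simp [Real.exp_add, mul_comm]

lemma hasDerivAt_integral_mul_exp (hh : Integrable (fun z => Real.exp (h z)) ν)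
    (hc : Measurable c) (hcC : ∀ z, |c z| ≤ C) (hf : Measurable f) (hfB : ∀ z, |f z| ≤ B) (t : ℝ) :
    HasDerivAt (fun t => ∫ z, f z * Real.exp (h z + t * c z) ∂ν)
      (∫ z, f z * c z * Real.exp (h z + t * c z) ∂ν) t := by
  have hint : ∀ s, Integrable (fun z => Real.exp (h z + s * c z)) ν := fun s =>
    integrable_exp_add_bdd hh (hc.const_mul s) (C := |s| * C) (fun z => by
      rw [abs_mul]; exact mul_le_mul_of_nonneg_left (hcC z) (abs_nonneg _))
  have hdom : Integrable (fun z => B * C * Real.exp ((|t| + 1) * C) * Real.exp (h z)) ν :=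
    hh.const_mul _
  refine (hasDerivAt_integral_of_dominated_loc_of_deriv_le (F := fun t z =>
    f z * Real.exp (h z + t * c z)) (F' := fun t z => f z * c z * Real.exp (h z + t * c z))
    (Metric.ball_mem_nhds t one_pos) ?_ ?_ ?_ ?_ hdom ?_).2
  · exact Filter.Eventually.of_forall fun s =>
      (integrable_bdd_mul_exp (hint s) hf hfB).aestronglyMeasurable
  · exact integrable_bdd_mul_exp (hint t) hf hfB
  · exact (hf.mul hc).aestronglyMeasurable.mul (hint t).aestronglyMeasurable
  · refine ae_of_all _ fun z s hs => ?_
    have hB : 0 ≤ B := (abs_nonneg _).trans (hfB z)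
    have hC : 0 ≤ C := (abs_nonneg _).trans (hcC z)
    have hs' : |s| ≤ |t| + 1 := by
      have h1 : |s - t| < 1 := by simpa [Real.dist_eq] using hs
      have h2 := abs_sub_abs_le_abs_sub s t
      linarith
    have h3 : s * c z ≤ (|t| + 1) * C := (le_abs_self _).trans (by
      rw [abs_mul]; gcongr; exact hcC z)
    rw [norm_mul, norm_mul, Real.norm_eq_abs, Real.norm_eq_abs, Real.norm_eq_abs,
      abs_of_pos (Real.exp_pos _), add_comm, Real.exp_add, ← mul_assoc]
    gcongr
    · exact hfB z
    · exact hcC z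
  · refine ae_of_all _ fun z s _ => ?_
    have h1 : HasDerivAt (fun t => h z + t * c z) (c z) s := by
      simpa using ((hasDerivAt_id s).mul_const (c z)).const_add (h z)
    exact (h1.exp.const_mul (f z)).congr_deriv (by ring)

lemma integral_tilted_eq_div (h f : S → ℝ) :
    ∫ z, f z ∂(ν.tilted h) = (∫ z, f z * Real.exp (h z) ∂ν) / ∫ z, Real.exp (h z) ∂ν := by
  rw [integral_tilted, ← integral_div]
  refine integral_congr_ae (ae_of_all _ fun z => ?_)
  simp only [smul_eq_mul]
  ring

variable [IsProbabilityMeasure ν]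

/-- The derivative of a Gibbs average in the direction `c` is a covariance. -/
lemma hasDerivAt_integral_tilted (hh : Integrable (fun z => Real.exp (h z)) ν)
    (hc : Measurable c) (hcC : ∀ z, |c z| ≤ C) (hf : Measurable f) (hfB : ∀ z, |f z| ≤ B) (t : ℝ) :
    HasDerivAt (fun t => ∫ z, f z ∂(ν.tilted fun z => h z + t * c z))
      (∫ z, f z * c z ∂(ν.tilted fun z => h z + t * c z) -
        (∫ z, f z ∂(ν.tilted fun z => h z + t * c z)) *
          ∫ z, c z ∂(ν.tilted fun z => h z + t * c z)) t := by
  have hint : Integrable (fun z => Real.exp (h z + t * c z)) ν :=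
    integrable_exp_add_bdd hh (hc.const_mul t) (C := |t| * C) (fun z => by
      rw [abs_mul]; exact mul_le_mul_of_nonneg_left (hcC z) (abs_nonneg _))
  have hpos : 0 < ∫ z, Real.exp (h z + t * c z) ∂ν := integral_exp_pos hint
  simp only [integral_tilted_eq_div]
  have h1 := hasDerivAt_integral_mul_exp hh hc hcC hf hfB t
  have h2 := hasDerivAt_integral_mul_exp (f := fun _ => 1) (B := 1) hh hc hcC measurable_const
    (by simp) t
  simp only [one_mul] at h2
  have halg : ∀ {p q r d : ℝ}, d ≠ 0 → (p * d - q * r) / d ^ 2 = p / d - q / d * (r / d) := by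
    intro p q r d hd
    field_simp
  exact (h1.div h2 hpos.ne').congr_deriv (halg hpos.ne')

/-- Convexity of the log-partition function: the tangent at `X` lies below the graph. -/
lemma log_integral_exp_sub_le {X Y : S → ℝ} (hX : Integrable (fun z => Real.exp (X z)) ν)
    (hY : Integrable (fun z => Real.exp (Y z)) ν)
    (hXY : Integrable (fun z => X z - Y z) (ν.tilted X)) :
    Real.log (∫ z, Real.exp (X z) ∂ν) - Real.log (∫ z, Real.exp (Y z) ∂ν)
      ≤ ∫ z, (X z - Y z) ∂(ν.tilted X) := by
  have := isProbabilityMeasure_tilted hX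
  have hXpos := integral_exp_pos hX
  have hYpos := integral_exp_pos hY
  have hmul : (fun z => Real.exp (X z) • Real.exp (-(X z - Y z))) = fun z => Real.exp (Y z) := by
    ext z
    rw [smul_eq_mul, ← Real.exp_add]
    ring_nf
  have hexp : Integrable (fun z => Real.exp (-(X z - Y z))) (ν.tilted X) := by
    rw [integrable_tilted_iff hX, hmul]
    exact hY
  have hjensen := convexOn_exp.map_integral_le Real.continuous_exp.continuousOn isClosed_univ
    (by simp) hXY.neg hexp
  have hval : ∫ z, Real.exp (-(X z - Y z)) ∂(ν.tilted X)
      = (∫ z, Real.exp (Y z) ∂ν) / ∫ z, Real.exp (X z) ∂ν := by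
    rw [integral_tilted_eq_div]
    congr 1
    refine integral_congr_ae (ae_of_all _ fun z => ?_)
    have := congrFun hmul z
    simp only [smul_eq_mul] at this
    simp only [← this, mul_comm]
  have h2 : Real.exp (-∫ z, (X z - Y z) ∂(ν.tilted X))
      ≤ (∫ z, Real.exp (Y z) ∂ν) / ∫ z, Real.exp (X z) ∂ν := by
    rw [← hval, ← integral_neg]
    exact hjensen
  have h3 := (Real.le_log_iff_exp_le (div_pos hYpos hXpos)).2 h2
  rw [Real.log_div hYpos.ne' hXpos.ne'] at h3
  linarith

/-- Independent copies of a tilted measure form a tilted product measure. -/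
lemma pi_tilted (n : ℕ) (hh : Integrable (fun z => Real.exp (h z)) ν) :
    (Measure.pi fun _ : Fin n => ν.tilted h)
      = (Measure.pi fun _ : Fin n => ν).tilted fun z => ∑ i, h (z i) := by
  have := isProbabilityMeasure_tilted hh
  refine Measure.pi_eq fun s hs => ?_
  have hprod : ∀ z : Fin n → S, Real.exp (∑ i, h (z i)) = ∏ i, Real.exp (h (z i)) := fun z =>
    Real.exp_sum _ _
  have hind : ∀ z : Fin n → S, (Set.pi Set.univ s).indicator
      (fun z => Real.exp (∑ i, h (z i)) / ∫ z, Real.exp (∑ i, h (z i))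
        ∂(Measure.pi fun _ : Fin n => ν)) z
      = ∏ i, (s i).indicator (fun z => Real.exp (h z) / ∫ z, Real.exp (h z) ∂ν) (z i) := by
    intro z
    simp only [hprod]
    rw [integral_fintype_prod_eq_pow (fun z => Real.exp (h z))]
    by_cases hz : z ∈ Set.pi Set.univ s
    · rw [Set.indicator_of_mem hz]
      rw [Finset.prod_congr rfl fun i _ => Set.indicator_of_mem (hz i trivial) _,
        Finset.prod_div_distrib]
      simp
    · rw [Set.indicator_of_notMem hz]
      obtain ⟨i, hi⟩ : ∃ i, z i ∉ s i := by simpa [Set.mem_pi] using hz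
      exact (Finset.prod_eq_zero (Finset.mem_univ i) (Set.indicator_of_notMem hi _)).symm
  rw [tilted_apply_eq_ofReal_integral' _ (.univ_pi hs), ← integral_indicator (.univ_pi hs)]
  simp only [hind]
  rw [integral_fintype_prod_eq_prod (fun i z =>
    (s i).indicator (fun z => Real.exp (h z) / ∫ z, Real.exp (h z) ∂ν) z),
    ENNReal.ofReal_prod_of_nonneg]
  · refine Finset.prod_congr rfl fun i _ => ?_
    rw [tilted_apply_eq_ofReal_integral' _ (hs i), integral_indicator (hs i)]
  · intro i _
    exact integral_nonneg fun z => Set.indicator_nonneg (fun z _ => by positivity) z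

end Tilted

/-! ### The Gaussian field -/

section Field

variable {N : ℕ}

/-- The law of the Gaussian coefficients `g_{i_1, …, i_p}`. -/
noncomputable abbrev gaussianLaw (N : ℕ) : Measure (CoeffIndex N → ℝ) :=
  Measure.infinitePi fun _ => gaussianReal 0 1

/-- The overlap `z · w` of two points of the sphere. -/
noncomputable def overlap (z w : UnitSphere N) : ℝ :=
  inner ℝ (z : EuclideanSpace ℝ (Fin N)) (w : EuclideanSpace ℝ (Fin N))

/-- The monomial `z_{i_1} ⋯ z_{i_p}`. -/
noncomputable def monomial {p : ℕ} (i : Fin p → Fin N) (z : UnitSphere N) : ℝ :=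
  ∏ k, (z : EuclideanSpace ℝ (Fin N)) (i k)

lemma pSpin_eq (G : CoeffIndex N → ℝ) (p : ℕ+) (z : UnitSphere N) :
    pSpin G p z = ∑ i : Fin (p : ℕ) → Fin N, G ⟨p, i⟩ * monomial i z := rfl

lemma measurable_overlap : Measurable fun q : UnitSphere N × UnitSphere N => overlap q.1 q.2 := by
  unfold overlap; fun_prop

lemma overlap_eq_sum (z w : UnitSphere N) :
    overlap z w = ∑ j, (z : EuclideanSpace ℝ (Fin N)) j * (w : EuclideanSpace ℝ (Fin N)) j := by
  simp [overlap, PiLp.inner_apply, mul_comm]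

lemma overlap_self (z : UnitSphere N) : overlap z z = 1 := by
  simp [overlap]

lemma abs_overlap_le_one (z w : UnitSphere N) : |overlap z w| ≤ 1 := by
  simpa [overlap] using
    abs_real_inner_le_norm (z : EuclideanSpace ℝ (Fin N)) (w : EuclideanSpace ℝ (Fin N))

lemma abs_coord_le_one (z : UnitSphere N) (j : Fin N) :
    |(z : EuclideanSpace ℝ (Fin N)) j| ≤ 1 := by
  simpa using PiLp.norm_apply_le (z : EuclideanSpace ℝ (Fin N)) j

lemma abs_monomial_le_one {p : ℕ} (i : Fin p → Fin N) (z : UnitSphere N) :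
    |monomial i z| ≤ 1 := by
  rw [monomial, Finset.abs_prod]
  exact Finset.prod_le_one (fun _ _ => abs_nonneg _) fun k _ => abs_coord_le_one z _

@[fun_prop]
lemma measurable_monomial {p : ℕ} (i : Fin p → Fin N) :
    Measurable (monomial i : UnitSphere N → ℝ) := by
  unfold monomial; fun_prop

/-- The covariance of the `p`-spin form is the `p`-th power of the overlap. -/
lemma sum_monomial_mul_monomial (p : ℕ) (z w : UnitSphere N) :
    ∑ i : Fin p → Fin N, monomial i z * monomial i w = overlap z w ^ p := by
  rw [overlap_eq_sum, Fintype.sum_pow]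
  simp [monomial, Finset.prod_mul_distrib]

lemma measurable_pSpin (p : ℕ+) :
    Measurable fun q : (CoeffIndex N → ℝ) × UnitSphere N => pSpin q.1 p q.2 := by
  simp only [pSpin_eq]; fun_prop

lemma measurable_mixedTerm (p : ℕ+) : Measurable
    fun q : ((ℕ+ → ℝ) × (CoeffIndex N → ℝ)) × UnitSphere N => mixedTerm q.1.1 q.1.2 q.2 p := by
  simp only [mixedTerm, pSpin_eq]; fun_prop

lemma measurable_mixedField (v : ℝ) : Measurable
    fun q : ((ℕ+ → ℝ) × (CoeffIndex N → ℝ)) × UnitSphere N => mixedField v q.1.1 q.1.2 q.2 := by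
  unfold mixedField
  exact (Measurable.tsum measurable_mixedTerm).const_mul v

/-- `∑_{i_1, …, i_p} |g_{i_1, …, i_p}|`, which bounds the `p`-spin form uniformly. -/
noncomputable def coeffSum (G : CoeffIndex N → ℝ) (p : ℕ+) : ℝ :=
  ∑ i : Fin (p : ℕ) → Fin N, |G ⟨p, i⟩|

lemma abs_pSpin_le (G : CoeffIndex N → ℝ) (p : ℕ+) (z : UnitSphere N) :
    |pSpin G p z| ≤ coeffSum G p := by
  rw [pSpin_eq]
  refine (Finset.abs_sum_le_sum_abs _ _).trans (Finset.sum_le_sum fun i _ => ?_)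
  rw [abs_mul]
  exact mul_le_of_le_one_right (abs_nonneg _) (abs_monomial_le_one i z)

lemma mgf_pSpin (p : ℕ+) (z : UnitSphere N) (t : ℝ) :
    mgf (fun G => pSpin G p z) (gaussianLaw N) t = Real.exp (t ^ 2 / 2) := by
  have hind : iIndepFun (fun (i : Fin (p : ℕ) → Fin N) (G : CoeffIndex N → ℝ) =>
      monomial i z * G ⟨p, i⟩) (gaussianLaw N) := by
    have h := iIndepFun_infinitePi (P := fun _ : CoeffIndex N => gaussianReal 0 1)
      (X := fun j y => monomial j.2 z * y) (fun _ => by fun_prop)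
    exact h.precomp (g := fun i : Fin (p : ℕ) → Fin N => (⟨p, i⟩ : CoeffIndex N))
      (fun _ _ h => by simpa using h)
  have hsum : (fun G : CoeffIndex N → ℝ => pSpin G p z)
      = ∑ i : Fin (p : ℕ) → Fin N, fun G : CoeffIndex N → ℝ => monomial i z * G ⟨p, i⟩ := by
    ext G
    simp [pSpin_eq, mul_comm]
  rw [hsum, hind.mgf_sum (fun _ => by fun_prop)]
  have hterm : ∀ i : Fin (p : ℕ) → Fin N,
      mgf (fun G : CoeffIndex N → ℝ => monomial i z * G ⟨p, i⟩) (gaussianLaw N) t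
        = Real.exp (monomial i z * monomial i z * (t ^ 2 / 2)) := by
    intro i
    rw [mgf_const_mul, mgf_gaussianReal (Measure.infinitePi_map_eval _ _)]
    simp
    ring
  simp only [hterm]
  rw [← Real.exp_sum, ← Finset.sum_mul, sum_monomial_mul_monomial, overlap_self]
  simp

lemma lintegral_exp_pSpin (p : ℕ+) (z : UnitSphere N) (t : ℝ) :
    ∫⁻ G, ENNReal.ofReal (Real.exp (t * pSpin G p z)) ∂(gaussianLaw N)
      = ENNReal.ofReal (Real.exp (t ^ 2 / 2)) := by
  rw [← mgf_pSpin p z t, mgf, ofReal_integral_eq_lintegral_ofReal]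
  · -- A non-integrable function would have integral `0`, but the integral is positive.
    by_contra h
    have := mgf_pSpin p z t
    rw [mgf, integral_undef h] at this
    exact (Real.exp_pos _).ne this
  · exact ae_of_all _ fun _ => (Real.exp_pos _).le

lemma abs_le_exp_add_exp_neg (y : ℝ) : |y| ≤ Real.exp y + Real.exp (-y) := by
  rcases abs_cases y with ⟨h, _⟩ | ⟨h, _⟩ <;> rw [h]
  · linarith [Real.add_one_le_exp y, Real.exp_pos (-y)]
  · linarith [Real.add_one_le_exp (-y), Real.exp_pos y]

lemma lintegral_enorm_pSpin_le (p : ℕ+) (z : UnitSphere N) :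
    ∫⁻ G, ‖pSpin G p z‖ₑ ∂(gaussianLaw N) ≤ 4 := by
  calc ∫⁻ G, ‖pSpin G p z‖ₑ ∂(gaussianLaw N)
      ≤ ∫⁻ G, (ENNReal.ofReal (Real.exp (1 * pSpin G p z))
          + ENNReal.ofReal (Real.exp (-1 * pSpin G p z))) ∂(gaussianLaw N) := by
        refine lintegral_mono fun G => ?_
        rw [Real.enorm_eq_ofReal_abs, ← ENNReal.ofReal_add (Real.exp_pos _).le (Real.exp_pos _).le]
        refine ENNReal.ofReal_le_ofReal ?_
        simpa using abs_le_exp_add_exp_neg (pSpin G p z)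
    _ = ENNReal.ofReal (Real.exp (1 / 2) + Real.exp (1 / 2)) := by
        have hm : Measurable fun G : CoeffIndex N → ℝ => pSpin G p z :=
          (measurable_pSpin p).comp (measurable_id.prodMk measurable_const)
        rw [lintegral_add_left (by fun_prop), lintegral_exp_pSpin, lintegral_exp_pSpin,
          ENNReal.ofReal_add (Real.exp_pos _).le (Real.exp_pos _).le]
        norm_num
    _ ≤ 4 := by
        rw [show (4 : ℝ≥0∞) = ENNReal.ofReal 4 by simp]
        refine ENNReal.ofReal_le_ofReal ?_
        have : Real.exp (1 / 2) ≤ 2 := by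
          have h1 := Real.exp_one_lt_d9
          have h2 : Real.exp (1 / 2) * Real.exp (1 / 2) = Real.exp 1 := by
            rw [← Real.exp_add]; norm_num
          nlinarith [Real.exp_pos (1 / 2)]
        linarith

lemma hasSum_two_inv_pow_pnat : HasSum (fun p : ℕ+ => (2 : ℝ)⁻¹ ^ (p : ℕ)) 1 := by
  rw [← Equiv.pnatEquivNat.symm.hasSum_iff]
  convert hasSum_geometric_two' 1 using 2 with n
  simp [Equiv.pnatEquivNat, pow_succ]
  ring

lemma tsum_enorm_lt_top_iff {ι : Type*} {f : ι → ℝ} : ∑' i, ‖f i‖ₑ < ∞ ↔ Summable f := by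
  rw [lt_top_iff_ne_top, ← summable_abs_iff]
  exact ENNReal.tsum_coe_ne_top_iff_summable_coe (f := fun i => ‖f i‖₊)

lemma lintegral_tsum_enorm_mixedTerm_le {x : ℕ+ → ℝ} (hx : ∀ p, |x p| ≤ 2) (z : UnitSphere N) :
    ∫⁻ G, ∑' p, ‖mixedTerm x G z p‖ₑ ∂(gaussianLaw N) ≤ 8 := by
  have hm : ∀ p, Measurable fun G : CoeffIndex N → ℝ => pSpin G p z := fun p =>
    (measurable_pSpin p).comp (measurable_id.prodMk measurable_const)
  have hterm : ∀ p, ∫⁻ G, ‖mixedTerm x G z p‖ₑ ∂(gaussianLaw N)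
      ≤ ENNReal.ofReal ((2 : ℝ)⁻¹ ^ (p : ℕ)) * 8 := by
    intro p
    simp only [mixedTerm, enorm_mul, enorm_pow]
    rw [lintegral_const_mul _ (hm p).enorm, ENNReal.ofReal_pow (by norm_num), mul_assoc,
      Real.enorm_of_nonneg (by norm_num : (0 : ℝ) ≤ 2⁻¹)]
    gcongr
    calc ‖x p‖ₑ * ∫⁻ G, ‖pSpin G p z‖ₑ ∂(gaussianLaw N) ≤ 2 * 4 := by
          gcongr
          · rw [Real.enorm_eq_ofReal_abs]
            simpa using ENNReal.ofReal_le_ofReal (hx p)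
          · exact lintegral_enorm_pSpin_le p z
      _ = 8 := by norm_num
  rw [lintegral_tsum fun p => by
    refine Measurable.aemeasurable ?_
    simp only [mixedTerm]
    have := hm p
    fun_prop]
  calc ∑' p, ∫⁻ G, ‖mixedTerm x G z p‖ₑ ∂(gaussianLaw N)
      ≤ ∑' p : ℕ+, ENNReal.ofReal ((2 : ℝ)⁻¹ ^ (p : ℕ)) * 8 := ENNReal.tsum_le_tsum hterm
    _ = 8 := by
        rw [ENNReal.tsum_mul_right, ← ENNReal.ofReal_tsum_of_nonneg (fun _ => by positivity)
          hasSum_two_inv_pow_pnat.summable, hasSum_two_inv_pow_pnat.tsum_eq]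
        simp

lemma measurableSet_summable_mixedTerm : MeasurableSet
    {q : ((ℕ+ → ℝ) × (CoeffIndex N → ℝ)) × UnitSphere N |
      Summable (mixedTerm q.1.1 q.1.2 q.2)} := by
  have : {q : ((ℕ+ → ℝ) × (CoeffIndex N → ℝ)) × UnitSphere N |
      Summable (mixedTerm q.1.1 q.1.2 q.2)}
      = {q | ∑' p, ‖mixedTerm q.1.1 q.1.2 q.2 p‖ₑ < ∞} := by
    ext q
    exact tsum_enorm_lt_top_iff.symm
  rw [this]
  exact measurableSet_lt (Measurable.tsum fun p => (measurable_mixedTerm p).enorm)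
    measurable_const

/-- Jensen's inequality for the exponential and the weights `2^{-p}`. -/
lemma ofReal_exp_tsum_le {y : ℕ+ → ℝ} (hy : Summable fun p : ℕ+ => (2 : ℝ)⁻¹ ^ (p : ℕ) * y p) :
    ENNReal.ofReal (Real.exp (∑' p : ℕ+, (2 : ℝ)⁻¹ ^ (p : ℕ) * y p))
      ≤ ∑' p : ℕ+, ENNReal.ofReal ((2 : ℝ)⁻¹ ^ (p : ℕ)) * ENNReal.ofReal (Real.exp (y p)) := by
  set m := ∑' p : ℕ+, (2 : ℝ)⁻¹ ^ (p : ℕ) * y p with hm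
  have hnn : ∀ p : ℕ+, (0 : ℝ) ≤ (2 : ℝ)⁻¹ ^ (p : ℕ) * Real.exp (y p) := fun p => by positivity
  have hrw : ∀ p : ℕ+, ENNReal.ofReal ((2 : ℝ)⁻¹ ^ (p : ℕ)) * ENNReal.ofReal (Real.exp (y p))
      = ENNReal.ofReal ((2 : ℝ)⁻¹ ^ (p : ℕ) * Real.exp (y p)) := fun p =>
    (ENNReal.ofReal_mul (by positivity)).symm
  simp only [hrw]
  by_cases hs : Summable fun p : ℕ+ => (2 : ℝ)⁻¹ ^ (p : ℕ) * Real.exp (y p)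
  · rw [← ENNReal.ofReal_tsum_of_nonneg hnn hs]
    refine ENNReal.ofReal_le_ofReal ?_
    -- The tangent line of `exp` at `m` lies below the graph.
    have htan : ∀ p : ℕ+, (2 : ℝ)⁻¹ ^ (p : ℕ) * (Real.exp m * (1 - m))
        + Real.exp m * ((2 : ℝ)⁻¹ ^ (p : ℕ) * y p) ≤ (2 : ℝ)⁻¹ ^ (p : ℕ) * Real.exp (y p) := by
      intro p
      have h1 : Real.exp m * (1 + (y p - m)) ≤ Real.exp (y p) := by
        have := Real.add_one_le_exp (y p - m)
        calc Real.exp m * (1 + (y p - m)) ≤ Real.exp m * Real.exp (y p - m) := by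
              gcongr; linarith
          _ = Real.exp (y p) := by rw [← Real.exp_add]; ring_nf
      have h2 : (0 : ℝ) ≤ (2 : ℝ)⁻¹ ^ (p : ℕ) := by positivity
      nlinarith
    have hL := (hasSum_two_inv_pow_pnat.mul_right (Real.exp m * (1 - m))).add
      (hy.hasSum.mul_left (Real.exp m))
    have := hasSum_le htan hL hs.hasSum
    rw [← hm] at this
    linarith
  · have htop : ∑' p : ℕ+, ENNReal.ofReal ((2 : ℝ)⁻¹ ^ (p : ℕ) * Real.exp (y p)) = ∞ := by
      by_contra h
      refine hs (tsum_enorm_lt_top_iff.1 (lt_top_iff_ne_top.2 ?_))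
      simpa only [Real.enorm_of_nonneg (hnn _)] using h
    rw [htop]
    exact le_top

lemma ae_summable_mixedTerm {x : ℕ+ → ℝ} (hx : ∀ p, |x p| ≤ 2) (z : UnitSphere N) :
    ∀ᵐ G ∂(gaussianLaw N), Summable (mixedTerm x G z) := by
  have hm : AEMeasurable (fun G => ∑' p, ‖mixedTerm x G z p‖ₑ) (gaussianLaw N) :=
    ((Measurable.tsum fun p => (measurable_mixedTerm p).enorm).comp
      ((measurable_const.prodMk measurable_id).prodMk measurable_const)).aemeasurable
  have h := ae_lt_top' hm
    ((lintegral_tsum_enorm_mixedTerm_le hx z).trans_lt (by simp)).ne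
  filter_upwards [h] with G hG
  exact tsum_enorm_lt_top_iff.1 hG

lemma lintegral_enorm_mixedField_le {v : ℝ} (hv : 0 ≤ v) {x : ℕ+ → ℝ} (hx : ∀ p, |x p| ≤ 2)
    (z : UnitSphere N) :
    ∫⁻ G, ‖mixedField v x G z‖ₑ ∂(gaussianLaw N) ≤ ENNReal.ofReal (8 * v) := by
  calc ∫⁻ G, ‖mixedField v x G z‖ₑ ∂(gaussianLaw N)
      ≤ ∫⁻ G, ENNReal.ofReal v * ∑' p, ‖mixedTerm x G z p‖ₑ ∂(gaussianLaw N) := by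
        refine lintegral_mono fun G => ?_
        rw [mixedField, enorm_mul, Real.enorm_of_nonneg hv]
        gcongr
        exact enorm_tsum_le_tsum_enorm
    _ = ENNReal.ofReal v * ∫⁻ G, ∑' p, ‖mixedTerm x G z p‖ₑ ∂(gaussianLaw N) :=
        lintegral_const_mul' _ _ (by simp)
    _ ≤ ENNReal.ofReal v * 8 := by
        gcongr
        exact lintegral_tsum_enorm_mixedTerm_le hx z
    _ = ENNReal.ofReal (8 * v) := by
        rw [mul_comm 8 v, ENNReal.ofReal_mul hv]; simp

lemma lintegral_exp_mixedField_le (v : ℝ) {x : ℕ+ → ℝ} (hx : ∀ p, |x p| ≤ 2)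
    (z : UnitSphere N) (s : ℝ) :
    ∫⁻ G, ENNReal.ofReal (Real.exp (s * mixedField v x G z)) ∂(gaussianLaw N)
      ≤ ENNReal.ofReal (Real.exp (2 * (s * v) ^ 2)) := by
  have hm : ∀ p, Measurable fun G : CoeffIndex N → ℝ => pSpin G p z := fun p =>
    (measurable_pSpin p).comp (measurable_id.prodMk measurable_const)
  calc ∫⁻ G, ENNReal.ofReal (Real.exp (s * mixedField v x G z)) ∂(gaussianLaw N)
      ≤ ∫⁻ G, ∑' p : ℕ+, ENNReal.ofReal ((2 : ℝ)⁻¹ ^ (p : ℕ)) *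
          ENNReal.ofReal (Real.exp (s * v * x p * pSpin G p z)) ∂(gaussianLaw N) := by
        refine lintegral_mono_ae ?_
        filter_upwards [ae_summable_mixedTerm hx z] with G hG
        have hrw : ∀ p : ℕ+, (2 : ℝ)⁻¹ ^ (p : ℕ) * (s * v * x p * pSpin G p z)
            = s * v * mixedTerm x G z p := fun p => by rw [mixedTerm]; ring
        have hsum : Summable fun p : ℕ+ =>
            (2 : ℝ)⁻¹ ^ (p : ℕ) * (s * v * x p * pSpin G p z) := by
          simp only [hrw]; exact hG.mul_left _
        have h := ofReal_exp_tsum_le hsum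
        simp only [hrw] at h
        rwa [tsum_mul_left, mul_assoc] at h
    _ = ∑' p : ℕ+, ENNReal.ofReal ((2 : ℝ)⁻¹ ^ (p : ℕ)) *
          ENNReal.ofReal (Real.exp ((s * v * x p) ^ 2 / 2)) := by
        rw [lintegral_tsum fun p => by have := hm p; fun_prop]
        refine tsum_congr fun p => ?_
        rw [lintegral_const_mul' _ _ (by simp), lintegral_exp_pSpin]
    _ ≤ ∑' p : ℕ+, ENNReal.ofReal ((2 : ℝ)⁻¹ ^ (p : ℕ)) *
          ENNReal.ofReal (Real.exp (2 * (s * v) ^ 2)) := by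
        refine ENNReal.tsum_le_tsum fun p => ?_
        gcongr
        have h1 : x p ^ 2 ≤ 4 := by
          have := sq_le_sq' (by linarith [(abs_le.1 (hx p)).1]) (abs_le.1 (hx p)).2
          linarith
        nlinarith [sq_nonneg (s * v)]
    _ = ENNReal.ofReal (Real.exp (2 * (s * v) ^ 2)) := by
        rw [ENNReal.tsum_mul_right, ← ENNReal.ofReal_tsum_of_nonneg (fun _ => by positivity)
          hasSum_two_inv_pow_pnat.summable, hasSum_two_inv_pow_pnat.tsum_eq]
        simp

end Field

/-! ### Gibbs measures and replicas -/

section Gibbs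

variable {N : ℕ}

/-- The configurations of the disorder for which the field is given by a convergent series and has
a finite partition function. -/
def Good (ν : Measure (UnitSphere N)) (v : ℝ) (x : ℕ+ → ℝ) (G : CoeffIndex N → ℝ) : Prop :=
  (∀ᵐ z ∂ν, Summable (mixedTerm x G z)) ∧
    Integrable (fun z => Real.exp (mixedField v x G z)) ν

open Classical in
/-- The mixed field, replaced by `0` for the configurations of the disorder that are not `Good`.
This makes the Gibbs measure a probability measure for every value of the disorder. -/
noncomputable def regField (ν : Measure (UnitSphere N)) (v : ℝ) (x : ℕ+ → ℝ)
    (G : CoeffIndex N → ℝ) (z : UnitSphere N) : ℝ :=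
  if Good ν v x G then mixedField v x G z else 0

/-- The Gibbs measure of the regularized field. -/
noncomputable def gibbs (ν : Measure (UnitSphere N)) (v : ℝ) (x : ℕ+ → ℝ)
    (G : CoeffIndex N → ℝ) : Measure (UnitSphere N) :=
  ν.tilted (regField ν v x G)

/-- The law of `n` independent replicas from the Gibbs measure. -/
noncomputable def replicas (ν : Measure (UnitSphere N)) (v : ℝ) (x : ℕ+ → ℝ)
    (G : CoeffIndex N → ℝ) (n : ℕ) : Measure (Fin n → UnitSphere N) :=
  Measure.pi fun _ => gibbs ν v x G

/-- The logarithm of the partition function. -/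
noncomputable def logZ (ν : Measure (UnitSphere N)) (v : ℝ) (x : ℕ+ → ℝ)
    (G : CoeffIndex N → ℝ) : ℝ :=
  Real.log (∫ z, Real.exp (regField ν v x G z) ∂ν)

variable {ν : Measure (UnitSphere N)} {v : ℝ} {x : ℕ+ → ℝ} {G : CoeffIndex N → ℝ}

lemma regField_of_good (h : Good ν v x G) : regField ν v x G = mixedField v x G := by
  ext z; simp [regField, h]

lemma gibbs_eq_perturbed (h : Good ν v x G) : gibbs ν v x G = perturbed ν v x G := by
  rw [gibbs, perturbed, regField_of_good h]

section Update

lemma hasSum_of_single_change {ι : Type*} [DecidableEq ι] {f g : ι → ℝ} (hf : Summable f) (i : ι)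
    (hfg : ∀ j, j ≠ i → g j = f j) : HasSum g (∑' j, f j + (g i - f i)) := by
  convert hf.hasSum.add (hasSum_ite_eq i (g i - f i)) using 1
  ext j
  by_cases h : j = i
  · subst h; simp
  · simp [h, hfg j h]

lemma mixedField_update_left (v : ℝ) (p : ℕ+) (t : ℝ) {z : UnitSphere N}
    (h : Summable (mixedTerm x G z)) :
    Summable (mixedTerm (Function.update x p t) G z) ∧
      mixedField v (Function.update x p t) G z
        = mixedField v x G z + (t - x p) * (v * (2 : ℝ)⁻¹ ^ (p : ℕ) * pSpin G p z) := by
  have hs := hasSum_of_single_change (g := mixedTerm (Function.update x p t) G z) h p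
    (fun q hq => by simp [mixedTerm, Function.update_of_ne hq])
  refine ⟨hs.summable, ?_⟩
  rw [mixedField, hs.tsum_eq, mixedField]
  simp only [mixedTerm, Function.update_self]
  ring

lemma pSpin_update (p : ℕ+) (i : Fin (p : ℕ) → Fin N) (t : ℝ) (z : UnitSphere N) :
    pSpin (Function.update G ⟨p, i⟩ t) p z = pSpin G p z + (t - G ⟨p, i⟩) * monomial i z := by
  classical
  simp only [pSpin_eq]
  rw [← Finset.add_sum_erase _ _ (Finset.mem_univ i),
    ← Finset.add_sum_erase (a := i) (f := fun i => G ⟨p, i⟩ * monomial i z) _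
      (Finset.mem_univ i), Finset.sum_congr rfl fun j hj => by
      rw [Function.update_of_ne (by simpa using Finset.ne_of_mem_erase hj)]]
  simp only [Function.update_self]
  ring

lemma mixedField_update_right (v : ℝ) (p : ℕ+) (i : Fin (p : ℕ) → Fin N) (t : ℝ)
    {z : UnitSphere N} (h : Summable (mixedTerm x G z)) :
    Summable (mixedTerm x (Function.update G ⟨p, i⟩ t) z) ∧
      mixedField v x (Function.update G ⟨p, i⟩ t) z
        = mixedField v x G z
          + (t - G ⟨p, i⟩) * (v * (2 : ℝ)⁻¹ ^ (p : ℕ) * x p * monomial i z) := by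
  have hs := hasSum_of_single_change (g := mixedTerm x (Function.update G ⟨p, i⟩ t) z) h p
    (fun q hq => by
      simp only [mixedTerm, pSpin_eq]
      congr 1
      refine Finset.sum_congr rfl fun j _ => ?_
      rw [Function.update_of_ne]
      rintro h
      exact hq (congrArg Sigma.fst h))
  refine ⟨hs.summable, ?_⟩
  rw [mixedField, hs.tsum_eq, mixedField]
  simp only [mixedTerm, pSpin_update]
  ring

/-- A bounded change of the field preserves good configurations and changes the regularized field
by the same amount. -/
lemma good_of_bounded_change {x' : ℕ+ → ℝ} {G' : CoeffIndex N → ℝ} {c : UnitSphere N → ℝ} {C : ℝ}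
    (hG : Good ν v x G) (hc : Measurable c) (hcC : ∀ z, |c z| ≤ C)
    (h : ∀ z, Summable (mixedTerm x G z) → Summable (mixedTerm x' G' z) ∧
      mixedField v x' G' z = mixedField v x G z + c z) :
    Good ν v x' G' ∧ regField ν v x' G' =ᵐ[ν] fun z => regField ν v x G z + c z := by
  have hfield : mixedField v x' G' =ᵐ[ν] fun z => mixedField v x G z + c z := by
    filter_upwards [hG.1] with z hz using (h z hz).2
  have hgood : Good ν v x' G' := by
    refine ⟨by filter_upwards [hG.1] with z hz using (h z hz).1, ?_⟩
    refine (integrable_exp_add_bdd hG.2 hc hcC).congr ?_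
    filter_upwards [hfield] with z hz
    rw [hz]
  refine ⟨hgood, ?_⟩
  rw [regField_of_good hgood, regField_of_good hG]
  exact hfield

end Update

variable [IsProbabilityMeasure ν]

lemma integrable_exp_regField (v : ℝ) (x : ℕ+ → ℝ) (G : CoeffIndex N → ℝ) :
    Integrable (fun z => Real.exp (regField ν v x G z)) ν := by
  by_cases h : Good ν v x G
  · simpa [regField, h] using h.2
  · simp [regField, h]

instance : IsProbabilityMeasure (gibbs ν v x G) :=
  isProbabilityMeasure_tilted (integrable_exp_regField v x G)

instance (n : ℕ) : IsProbabilityMeasure (replicas ν v x G n) := by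
  unfold replicas; infer_instance

lemma measurableSet_good (v : ℝ) :
    MeasurableSet {q : (ℕ+ → ℝ) × (CoeffIndex N → ℝ) | Good ν v q.1 q.2} := by
  refine MeasurableSet.inter (s₁ := {q : (ℕ+ → ℝ) × (CoeffIndex N → ℝ) |
    ∀ᵐ z ∂ν, Summable (mixedTerm q.1 q.2 z)}) ?_ ?_
  · have h := measurable_measure_prodMk_left (ν := ν)
      (measurableSet_summable_mixedTerm (N := N)).compl
    exact h (measurableSet_singleton 0)
  · exact measurableSet_integrable (μ := ν) (f := fun q : (ℕ+ → ℝ) × (CoeffIndex N → ℝ) =>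
      fun z => Real.exp (mixedField v q.1 q.2 z))
      (measurable_mixedField v).exp.stronglyMeasurable

lemma measurable_regField (v : ℝ) : Measurable
    fun q : ((ℕ+ → ℝ) × (CoeffIndex N → ℝ)) × UnitSphere N => regField ν v q.1.1 q.1.2 q.2 := by
  classical
  unfold regField
  exact Measurable.ite (measurable_fst (measurableSet_good v)) (measurable_mixedField v)
    measurable_const

lemma measurable_regField_right (v : ℝ) (x : ℕ+ → ℝ) (G : CoeffIndex N → ℝ) :
    Measurable (regField ν v x G) := by
  have h := (measurable_regField (ν := ν) v).comp (measurable_prodMk_left (x := (x, G)))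
  exact h

lemma measurable_partition (v : ℝ) : Measurable fun q : (ℕ+ → ℝ) × (CoeffIndex N → ℝ) =>
    ∫ z, Real.exp (regField ν v q.1 q.2 z) ∂ν :=
  ((measurable_regField v).exp.stronglyMeasurable.integral_prod_right
    (f := fun (q : (ℕ+ → ℝ) × (CoeffIndex N → ℝ)) z => Real.exp (regField ν v q.1 q.2 z))
    (ν := ν)).measurable

lemma measurable_logZ (v : ℝ) : Measurable fun q : (ℕ+ → ℝ) × (CoeffIndex N → ℝ) =>
    logZ ν v q.1 q.2 :=
  (measurable_partition v).log

lemma measurable_gibbs (v : ℝ) : Measurable fun q : (ℕ+ → ℝ) × (CoeffIndex N → ℝ) =>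
    gibbs ν v q.1 q.2 := by
  refine Measure.measurable_of_measurable_coe _ fun s hs => ?_
  simp only [gibbs, tilted_apply' _ _ hs]
  refine Measurable.lintegral_prod_right' (ν := ν.restrict s)
    (f := fun q : ((ℕ+ → ℝ) × (CoeffIndex N → ℝ)) × UnitSphere N =>
      ENNReal.ofReal (Real.exp (regField ν v q.1.1 q.1.2 q.2) /
        ∫ z, Real.exp (regField ν v q.1.1 q.1.2 z) ∂ν)) ?_
  exact ((measurable_regField v).exp.div
    ((measurable_partition v).comp measurable_fst)).ennreal_ofReal

/-- The Gibbs measure as a Markov kernel from the disorder to the sphere. -/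
noncomputable def gibbsKernel (ν : Measure (UnitSphere N)) [IsProbabilityMeasure ν] (v : ℝ) :
    Kernel ((ℕ+ → ℝ) × (CoeffIndex N → ℝ)) (UnitSphere N) :=
  ⟨fun q => gibbs ν v q.1 q.2, measurable_gibbs v⟩

instance : IsMarkovKernel (gibbsKernel ν v) :=
  ⟨fun q => inferInstanceAs (IsProbabilityMeasure (gibbs ν v q.1 q.2))⟩

lemma measurable_replicas (v : ℝ) (n : ℕ) :
    Measurable fun q : (ℕ+ → ℝ) × (CoeffIndex N → ℝ) => replicas ν v q.1 q.2 n := by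
  refine Measurable.measure_of_isPiSystem_of_isProbabilityMeasure generateFrom_pi.symm
    isPiSystem_pi ?_
  rintro _ ⟨s, hs, rfl⟩
  simp only [replicas, Measure.pi_pi]
  exact Finset.measurable_prod _ fun i _ =>
    (Measure.measurable_coe (show MeasurableSet (s i) from hs i trivial)).comp (measurable_gibbs v)

/-- The law of `n` replicas as a Markov kernel. -/
noncomputable def replicaKernel (ν : Measure (UnitSphere N)) [IsProbabilityMeasure ν] (v : ℝ)
    (n : ℕ) : Kernel ((ℕ+ → ℝ) × (CoeffIndex N → ℝ)) (Fin n → UnitSphere N) :=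
  ⟨fun q => replicas ν v q.1 q.2 n, measurable_replicas v n⟩

instance (n : ℕ) : IsMarkovKernel (replicaKernel ν v n) :=
  ⟨fun q => inferInstanceAs (IsProbabilityMeasure (replicas ν v q.1 q.2 n))⟩

lemma measurable_integral_gibbs
    {f : ((ℕ+ → ℝ) × (CoeffIndex N → ℝ)) × UnitSphere N → ℝ} (hf : Measurable f) :
    Measurable fun q => ∫ z, f (q, z) ∂(gibbs ν v q.1 q.2) :=
  (hf.stronglyMeasurable.integral_kernel_prod_right' (κ := gibbsKernel ν v)).measurable

lemma measurable_integral_replicas {n : ℕ}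
    {f : ((ℕ+ → ℝ) × (CoeffIndex N → ℝ)) × (Fin n → UnitSphere N) → ℝ} (hf : Measurable f) :
    Measurable fun q => ∫ z, f (q, z) ∂(replicas ν v q.1 q.2 n) :=
  (hf.stronglyMeasurable.integral_kernel_prod_right' (κ := replicaKernel ν v n)).measurable

lemma measurable_lintegral_gibbs
    {f : ((ℕ+ → ℝ) × (CoeffIndex N → ℝ)) × UnitSphere N → ℝ≥0∞} (hf : Measurable f) :
    Measurable fun q => ∫⁻ z, f (q, z) ∂(gibbs ν v q.1 q.2) :=
  hf.lintegral_kernel_prod_right' (κ := gibbsKernel ν v)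

lemma integral_replicas_apply {n : ℕ} (l : Fin n) {f : UnitSphere N → ℝ} (hf : Measurable f) :
    ∫ z, f (z l) ∂(replicas ν v x G n) = ∫ z, f z ∂(gibbs ν v x G) := by
  have h := measurePreserving_eval (fun _ : Fin n => gibbs ν v x G) l
  rw [← h.map_eq, integral_map h.measurable.aemeasurable hf.aestronglyMeasurable]
  rfl

section AlmostSure

lemma measurable_mixedField_right (v : ℝ) (x : ℕ+ → ℝ) (G : CoeffIndex N → ℝ) :
    Measurable (mixedField v x G) := by
  have h := (measurable_mixedField (N := N) v).comp (measurable_prodMk_left (x := (x, G)))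
  exact h

lemma measurable_mixedField_prod (v : ℝ) (x : ℕ+ → ℝ) : Measurable
    fun q : (CoeffIndex N → ℝ) × UnitSphere N => mixedField v x q.1 q.2 := by
  have h := (measurable_mixedField (N := N) v).comp
    (measurable_prodMk_left (x := x) |>.prodMap measurable_id)
  exact h

lemma lintegral_lintegral_exp_mixedField_le (v : ℝ) {x : ℕ+ → ℝ} (hx : ∀ p, |x p| ≤ 2) (s : ℝ) :
    ∫⁻ G, ∫⁻ z, ENNReal.ofReal (Real.exp (s * mixedField v x G z)) ∂ν ∂(gaussianLaw N)
      ≤ ENNReal.ofReal (Real.exp (2 * (s * v) ^ 2)) := by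
  rw [lintegral_lintegral_swap]
  · calc ∫⁻ z, ∫⁻ G, ENNReal.ofReal (Real.exp (s * mixedField v x G z)) ∂(gaussianLaw N) ∂ν
        ≤ ∫⁻ _, ENNReal.ofReal (Real.exp (2 * (s * v) ^ 2)) ∂ν :=
          lintegral_mono fun z => lintegral_exp_mixedField_le v hx z s
      _ = _ := by simp
  · exact ((measurable_mixedField_prod v x).const_mul s).exp.ennreal_ofReal.aemeasurable

lemma ae_integrable_exp_mixedField (v : ℝ) {x : ℕ+ → ℝ} (hx : ∀ p, |x p| ≤ 2) (s : ℝ) :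
    ∀ᵐ G ∂(gaussianLaw N), Integrable (fun z => Real.exp (s * mixedField v x G z)) ν := by
  have hm : Measurable fun q : (CoeffIndex N → ℝ) × UnitSphere N =>
      ENNReal.ofReal (Real.exp (s * mixedField v x q.1 q.2)) :=
    ((measurable_mixedField_prod v x).const_mul s).exp.ennreal_ofReal
  have h := ae_lt_top (Measurable.lintegral_prod_right' (ν := ν) hm)
    ((lintegral_lintegral_exp_mixedField_le v hx s).trans_lt ENNReal.ofReal_lt_top).ne
  filter_upwards [h] with G hG
  refine ⟨((measurable_mixedField_right v x G).const_mul s).exp.aestronglyMeasurable, ?_⟩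
  rw [hasFiniteIntegral_iff_ofReal (ae_of_all _ fun _ => (Real.exp_pos _).le)]
  exact hG

lemma ae_good (v : ℝ) {x : ℕ+ → ℝ} (hx : ∀ p, |x p| ≤ 2) :
    ∀ᵐ G ∂(gaussianLaw N), Good ν v x G := by
  have h1 : ∀ᵐ G ∂(gaussianLaw N), ∀ᵐ z ∂ν, Summable (mixedTerm x G z) := by
    refine (Measure.ae_ae_comm (p := fun z G => Summable (mixedTerm x G z)) ?_).1
      (ae_of_all _ fun z => ae_summable_mixedTerm hx z)
    have h := measurableSet_summable_mixedTerm (N := N) |>.preimage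
      ((measurable_prodMk_left (x := x) |>.prodMap measurable_id).comp measurable_swap)
    exact h
  filter_upwards [h1, ae_integrable_exp_mixedField (ν := ν) v hx 1] with G hG1 hG2
  exact ⟨hG1, by simpa using hG2⟩

end AlmostSure

end Gibbs

/-! ### Fluctuations of the log-partition function -/

section Fluctuation

variable {N : ℕ} {ν : Measure (UnitSphere N)} [IsProbabilityMeasure ν]

/-- `1 / E[e^g] ≤ E[e^{-g}]`. -/
lemma inv_integral_exp_le {S : Type*} [MeasurableSpace S] {μ : Measure S} [IsProbabilityMeasure μ]
    {g : S → ℝ} (h1 : Integrable (fun z => Real.exp (g z)) μ)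
    (h2 : Integrable (fun z => Real.exp (-g z)) μ) :
    (∫ z, Real.exp (g z) ∂μ)⁻¹ ≤ ∫ z, Real.exp (-g z) ∂μ := by
  set Z := ∫ z, Real.exp (g z) ∂μ with hZ
  have hZpos : 0 < Z := integral_exp_pos h1
  -- The tangent of `y ↦ 1 / y` at `Z` lies below the graph.
  have hpt : ∀ z, 2 * Z⁻¹ - (Z⁻¹ * Z⁻¹) * Real.exp (g z) ≤ Real.exp (-g z) := by
    intro z
    rw [Real.exp_neg]
    have he := Real.exp_pos (g z)
    have : 0 ≤ Real.exp (g z) * ((Real.exp (g z))⁻¹ - Z⁻¹) ^ 2 := by positivity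
    have h3 : Real.exp (g z) * (Real.exp (g z))⁻¹ = 1 := mul_inv_cancel₀ he.ne'
    have h4 : Real.exp (g z) * ((Real.exp (g z))⁻¹ - Z⁻¹) ^ 2
        = (Real.exp (g z) * (Real.exp (g z))⁻¹) * (Real.exp (g z))⁻¹
          - 2 * (Real.exp (g z) * (Real.exp (g z))⁻¹) * Z⁻¹
          + (Z⁻¹ * Z⁻¹) * Real.exp (g z) := by ring
    rw [h4, h3] at this
    linarith
  have h := integral_mono ((integrable_const (2 * Z⁻¹)).sub (h1.const_mul (Z⁻¹ * Z⁻¹))) h2 hpt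
  have h4 : ∫ z, (2 * Z⁻¹ - (Z⁻¹ * Z⁻¹) * Real.exp (g z)) ∂μ = Z⁻¹ := by
    rw [integral_sub (integrable_const _) (h1.const_mul _),
      integral_const_mul (Z⁻¹ * Z⁻¹), ← hZ]
    simp only [integral_const, probReal_univ, one_smul]
    field_simp
    ring
  rw [← h4]
  exact h

/-- The Gibbs average of the modulus of the field is at most the logarithm of an exponential
moment. -/
lemma integral_abs_tilted_le {S : Type*} [MeasurableSpace S] {μ : Measure S}
    [IsProbabilityMeasure μ] {g : S → ℝ} (hg : Measurable g)
    (h1 : Integrable (fun z => Real.exp (g z)) μ)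
    (h2 : Integrable (fun z => Real.exp (2 * g z)) μ)
    (h3 : Integrable (fun z => Real.exp (-g z)) μ) :
    Integrable g (μ.tilted g) ∧ ∫ z, |g z| ∂(μ.tilted g)
      ≤ Real.log (1 + ∫ z, Real.exp (2 * g z) ∂μ) + Real.log (∫ z, Real.exp (-g z) ∂μ) := by
  have := isProbabilityMeasure_tilted h1
  have hZpos : 0 < ∫ z, Real.exp (g z) ∂μ := integral_exp_pos h1
  have hApos : 0 < ∫ z, Real.exp (2 * g z) ∂μ := integral_exp_pos h2
  have hBpos : 0 < ∫ z, Real.exp (-g z) ∂μ := integral_exp_pos h3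
  have hpt : ∀ z, Real.exp (g z) * Real.exp |g z| ≤ 1 + Real.exp (2 * g z) := by
    intro z
    rw [← Real.exp_add]
    rcases abs_cases (g z) with ⟨h, _⟩ | ⟨h, _⟩ <;> rw [h]
    · rw [← two_mul]; linarith [Real.exp_pos (2 * g z)]
    · simp [(Real.exp_pos (2 * g z)).le]
  have hdom : Integrable (fun z => 1 + Real.exp (2 * g z)) μ := (integrable_const 1).add h2
  have hexp' : Integrable (fun z => Real.exp (g z) * Real.exp |g z|) μ :=
    hdom.mono' (by fun_prop) (ae_of_all _ fun z => by
      rw [Real.norm_of_nonneg (by positivity)]; exact hpt z)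
  have hexp : Integrable (fun z => Real.exp |g z|) (μ.tilted g) := by
    rw [integrable_tilted_iff h1]; exact hexp'
  have hint : Integrable g (μ.tilted g) := by
    refine hexp.mono' hg.aestronglyMeasurable (ae_of_all _ fun z => ?_)
    rw [Real.norm_eq_abs]
    linarith [Real.add_one_le_exp |g z|]
  refine ⟨hint, ?_⟩
  have hjensen := convexOn_exp.map_integral_le Real.continuous_exp.continuousOn isClosed_univ
    (by simp) hint.abs hexp
  have hval : ∫ z, Real.exp |g z| ∂(μ.tilted g)
      ≤ (1 + ∫ z, Real.exp (2 * g z) ∂μ) * ∫ z, Real.exp (-g z) ∂μ := by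
    rw [integral_tilted_eq_div, div_eq_mul_inv]
    have h5 : ∫ z, Real.exp |g z| * Real.exp (g z) ∂μ ≤ 1 + ∫ z, Real.exp (2 * g z) ∂μ := by
      have := integral_mono hexp' hdom hpt
      rw [integral_add (integrable_const _) h2] at this
      simpa [mul_comm] using this
    exact mul_le_mul h5 (inv_integral_exp_le h1 h3) (by positivity) (by positivity)
  rw [← Real.log_mul (by positivity) hBpos.ne']
  exact (Real.le_log_iff_exp_le (by positivity)).2 (hjensen.trans hval)

lemma log_le_div_add {T K : ℝ} (hT : 0 < T) (hK : 0 < K) :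
    Real.log T ≤ T / K + Real.log K - 1 := by
  have := Real.log_le_sub_one_of_pos (div_pos hT hK)
  rw [Real.log_div hT.ne' hK.ne'] at this
  linarith

/-- Under its own Gibbs measure the field is of order `v ^ 2`. -/
lemma lintegral_gibbs_field_le {v : ℝ} (hv : 1 ≤ v) {x : ℕ+ → ℝ} (hx : ∀ p, |x p| ≤ 2) :
    ∫⁻ G, ∫⁻ z, ‖regField ν v x G z‖ₑ ∂(gibbs ν v x G) ∂(gaussianLaw N)
      ≤ ENNReal.ofReal (10 * v ^ 2 + 1) := by
  set K₁ : ℝ := 1 + Real.exp (8 * v ^ 2) with hK₁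
  set K₂ : ℝ := Real.exp (2 * v ^ 2) with hK₂
  have hK₁pos : 0 < K₁ := by positivity
  have hK₂pos : 0 < K₂ := by positivity
  have hlogK₁ : 8 * v ^ 2 ≤ Real.log K₁ := by
    rw [Real.le_log_iff_exp_le hK₁pos]; linarith
  have hlogK₁' : Real.log K₁ ≤ 8 * v ^ 2 + 1 := by
    rw [Real.log_le_iff_le_exp hK₁pos, Real.exp_add]
    have h1 : (2 : ℝ) ≤ Real.exp 1 := by linarith [Real.add_one_le_exp (1 : ℝ)]
    have h2 : 1 ≤ Real.exp (8 * v ^ 2) := Real.one_le_exp (by positivity)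
    nlinarith
  have hlogK₂ : Real.log K₂ = 2 * v ^ 2 := Real.log_exp _
  set L : ℝ := 1 / K₁ + Real.log K₁ - 1 + (Real.log K₂ - 1) with hL
  have hLnn : 0 ≤ L := by
    have : 0 < 1 / K₁ := by positivity
    nlinarith
  have hpt : ∀ᵐ G ∂(gaussianLaw N), ∫⁻ z, ‖regField ν v x G z‖ₑ ∂(gibbs ν v x G)
      ≤ ENNReal.ofReal (1 / K₁) * (∫⁻ z, ENNReal.ofReal (Real.exp (2 * mixedField v x G z)) ∂ν)
        + ENNReal.ofReal (1 / K₂) *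
          (∫⁻ z, ENNReal.ofReal (Real.exp (-1 * mixedField v x G z)) ∂ν)
        + ENNReal.ofReal L := by
    filter_upwards [ae_good (ν := ν) v hx, ae_integrable_exp_mixedField (ν := ν) v hx 2,
      ae_integrable_exp_mixedField (ν := ν) v hx (-1)] with G hG h2 h3
    simp only [neg_one_mul] at h3 ⊢
    obtain ⟨hint, hle⟩ := integral_abs_tilted_le (measurable_mixedField_right v x G) hG.2 h2 h3
    rw [gibbs, regField_of_good hG]
    rw [← ofReal_integral_norm_eq_lintegral_enorm hint]
    rw [← ofReal_integral_eq_lintegral_ofReal h2 (ae_of_all _ fun _ => (Real.exp_pos _).le),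
      ← ofReal_integral_eq_lintegral_ofReal h3 (ae_of_all _ fun _ => (Real.exp_pos _).le)]
    have hA : 0 < ∫ z, Real.exp (2 * mixedField v x G z) ∂ν := integral_exp_pos h2
    have hB : 0 < ∫ z, Real.exp (-mixedField v x G z) ∂ν := integral_exp_pos h3
    rw [← ENNReal.ofReal_mul (by positivity), ← ENNReal.ofReal_mul (by positivity),
      ← ENNReal.ofReal_add (by positivity) (by positivity),
      ← ENNReal.ofReal_add (by positivity) hLnn]
    refine ENNReal.ofReal_le_ofReal (hle.trans ?_)
    have hl1 := log_le_div_add (by linarith : 0 < 1 + ∫ z, Real.exp (2 * mixedField v x G z) ∂ν)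
      hK₁pos
    have hl2 := log_le_div_add hB hK₂pos
    rw [add_div] at hl1
    rw [hL, one_div_mul_eq_div, one_div_mul_eq_div]
    linarith
  have hm : ∀ s : ℝ, Measurable fun G : CoeffIndex N → ℝ =>
      ∫⁻ z, ENNReal.ofReal (Real.exp (s * mixedField v x G z)) ∂ν := fun s =>
    Measurable.lintegral_prod_right' (ν := ν)
      ((measurable_mixedField_prod v x).const_mul s).exp.ennreal_ofReal
  refine (lintegral_mono_ae hpt).trans ?_
  rw [lintegral_add_right _ measurable_const, lintegral_add_right _ ((hm (-1)).const_mul _),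
    lintegral_const_mul _ (hm 2), lintegral_const_mul _ (hm (-1)), lintegral_const, measure_univ,
    mul_one]
  calc ENNReal.ofReal (1 / K₁) * (∫⁻ G, ∫⁻ z,
          ENNReal.ofReal (Real.exp (2 * mixedField v x G z)) ∂ν ∂(gaussianLaw N))
        + ENNReal.ofReal (1 / K₂) * (∫⁻ G, ∫⁻ z,
          ENNReal.ofReal (Real.exp (-1 * mixedField v x G z)) ∂ν ∂(gaussianLaw N))
        + ENNReal.ofReal L
      ≤ ENNReal.ofReal (1 / K₁) * ENNReal.ofReal (Real.exp (2 * (2 * v) ^ 2))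
        + ENNReal.ofReal (1 / K₂) * ENNReal.ofReal (Real.exp (2 * (-1 * v) ^ 2))
        + ENNReal.ofReal L := by
        gcongr <;> exact lintegral_lintegral_exp_mixedField_le v hx _
    _ = ENNReal.ofReal (1 / K₁ * Real.exp (8 * v ^ 2) + 1 / K₂ * K₂ + L) := by
        rw [← ENNReal.ofReal_mul (by positivity), ← ENNReal.ofReal_mul (by positivity),
          ← ENNReal.ofReal_add (by positivity) (by positivity),
          ← ENNReal.ofReal_add (by positivity) hLnn, hK₂]
        ring_nf
    _ ≤ ENNReal.ofReal (10 * v ^ 2 + 1) := by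
        refine ENNReal.ofReal_le_ofReal ?_
        have e1 : 1 / K₂ * K₂ = 1 := by field_simp
        have e2 : 1 / K₁ * Real.exp (8 * v ^ 2) + 1 / K₁ = 1 := by
          rw [hK₁]; field_simp; ring
        rw [e1, hL]
        linarith

/-- An independent copy of the field is of order `v` under the Gibbs measure. -/
lemma lintegral_gibbs_indep_field_le {v : ℝ} (hv : 0 ≤ v) {x : ℕ+ → ℝ} (hx : ∀ p, |x p| ≤ 2) :
    ∫⁻ G, ∫⁻ G', ∫⁻ z, ‖mixedField v x G' z‖ₑ ∂(gibbs ν v x G) ∂(gaussianLaw N) ∂(gaussianLaw N)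
      ≤ ENNReal.ofReal (8 * v) := by
  calc ∫⁻ G, ∫⁻ G', ∫⁻ z, ‖mixedField v x G' z‖ₑ ∂(gibbs ν v x G) ∂(gaussianLaw N) ∂(gaussianLaw N)
      ≤ ∫⁻ _, ENNReal.ofReal (8 * v) ∂(gaussianLaw N) := by
        refine lintegral_mono fun G => ?_
        rw [lintegral_lintegral_swap]
        · calc ∫⁻ z, ∫⁻ G', ‖mixedField v x G' z‖ₑ ∂(gaussianLaw N) ∂(gibbs ν v x G)
              ≤ ∫⁻ _, ENNReal.ofReal (8 * v) ∂(gibbs ν v x G) :=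
                lintegral_mono fun z => lintegral_enorm_mixedField_le hv hx z
            _ = _ := by simp
        · exact (measurable_mixedField_prod v x).enorm.aemeasurable
    _ = _ := by simp

/-- The average increase of the log-partition function under a rotation of the Gaussian
coefficients by an angle `δ`. -/
lemma lintegral_logZ_rotate_le {v : ℝ} (hv : 1 ≤ v) {x : ℕ+ → ℝ} (hx : ∀ p, |x p| ≤ 2) {δ : ℝ}
    (hδ0 : 0 ≤ Real.sin δ) :
    ∫⁻ q, ENNReal.ofReal (logZ ν v x q.1
        - logZ ν v x fun i => Real.cos δ * q.1 i - Real.sin δ * q.2 i)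
        ∂((gaussianLaw N).prod (gaussianLaw N))
      ≤ ENNReal.ofReal ((1 - Real.cos δ) * (10 * v ^ 2 + 1) + Real.sin δ * (8 * v)) := by
  have hc : 0 ≤ 1 - Real.cos δ := by linarith [Real.cos_le_one δ]
  have hG₁ : ∀ᵐ q ∂((gaussianLaw N).prod (gaussianLaw N)), Good ν v x q.1 :=
    Measure.quasiMeasurePreserving_fst.ae (ae_good v hx)
  have hG₂ : ∀ᵐ q ∂((gaussianLaw N).prod (gaussianLaw N)), Good ν v x q.2 :=
    Measure.quasiMeasurePreserving_snd.ae (ae_good v hx)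
  have hrot : Measurable fun q : (CoeffIndex N → ℝ) × (CoeffIndex N → ℝ) =>
      ((fun i => Real.cos (-δ) * q.1 i + Real.sin (-δ) * q.2 i),
        (fun i => -Real.sin (-δ) * q.1 i + Real.cos (-δ) * q.2 i)) := by fun_prop
  have hG₃ : ∀ᵐ q ∂((gaussianLaw N).prod (gaussianLaw N)),
      Good ν v x fun i => Real.cos δ * q.1 i - Real.sin δ * q.2 i := by
    have h := hG₁
    rw [← map_rotation_infinitePi (-δ)] at h
    filter_upwards [ae_of_ae_map hrot.aemeasurable h] with q hq
    simpa [sub_eq_add_neg] using hq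
  set I₁ : (CoeffIndex N → ℝ) → ℝ≥0∞ := fun G =>
    ∫⁻ z, ‖regField ν v x G z‖ₑ ∂(gibbs ν v x G) with hI₁
  set I₂ : (CoeffIndex N → ℝ) × (CoeffIndex N → ℝ) → ℝ≥0∞ := fun q =>
    ∫⁻ z, ‖mixedField v x q.2 z‖ₑ ∂(gibbs ν v x q.1) with hI₂
  have hI₁m : Measurable I₁ := by
    have h := (measurable_lintegral_gibbs (ν := ν) (v := v)
      (measurable_regField (ν := ν) v).enorm).comp (measurable_prodMk_left (x := x))
    exact h
  have hI₂m : Measurable I₂ := by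
    let κ : Kernel ((CoeffIndex N → ℝ) × (CoeffIndex N → ℝ)) (UnitSphere N) :=
      (gibbsKernel ν v).comap (fun q => (x, q.1)) (by fun_prop)
    have hf : Measurable fun q : ((CoeffIndex N → ℝ) × (CoeffIndex N → ℝ)) × UnitSphere N =>
        ‖mixedField v x q.1.2 q.2‖ₑ := by
      have hs : Measurable fun q : ((CoeffIndex N → ℝ) × (CoeffIndex N → ℝ)) × UnitSphere N =>
          (q.1.2, q.2) := by fun_prop
      have h := (measurable_mixedField_prod (N := N) v x).comp hs
      exact h.enorm
    exact hf.lintegral_kernel_prod_right' (κ := κ)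
  have hE₁ : ∫⁻ G, I₁ G ∂(gaussianLaw N) ≤ ENNReal.ofReal (10 * v ^ 2 + 1) :=
    lintegral_gibbs_field_le hv hx
  have hE₁' : ∫⁻ q, I₁ q.1 ∂((gaussianLaw N).prod (gaussianLaw N))
      ≤ ENNReal.ofReal (10 * v ^ 2 + 1) := by
    rw [lintegral_prod (fun q => I₁ q.1) (hI₁m.comp measurable_fst).aemeasurable]
    simpa using hE₁
  have hE₂ : ∫⁻ q, I₂ q ∂((gaussianLaw N).prod (gaussianLaw N)) ≤ ENNReal.ofReal (8 * v) := by
    rw [lintegral_prod _ hI₂m.aemeasurable]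
    exact lintegral_gibbs_indep_field_le (by linarith) hx
  have hfin₁ : ∀ᵐ q ∂((gaussianLaw N).prod (gaussianLaw N)), I₁ q.1 < ∞ :=
    ae_lt_top (hI₁m.comp measurable_fst) (hE₁'.trans_lt ENNReal.ofReal_lt_top).ne
  have hfin₂ : ∀ᵐ q ∂((gaussianLaw N).prod (gaussianLaw N)), I₂ q < ∞ :=
    ae_lt_top hI₂m (hE₂.trans_lt ENNReal.ofReal_lt_top).ne
  have hpt : ∀ᵐ q ∂((gaussianLaw N).prod (gaussianLaw N)),
      ENNReal.ofReal (logZ ν v x q.1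
        - logZ ν v x fun i => Real.cos δ * q.1 i - Real.sin δ * q.2 i)
      ≤ ENNReal.ofReal (1 - Real.cos δ) * I₁ q.1 + ENNReal.ofReal (Real.sin δ) * I₂ q := by
    filter_upwards [hG₁, hG₂, hG₃, hfin₁, hfin₂] with q h1 h2 h3 h4 h5
    set Y : CoeffIndex N → ℝ := fun i => Real.cos δ * q.1 i - Real.sin δ * q.2 i with hY
    have hac : gibbs ν v x q.1 ≪ ν := tilted_absolutelyContinuous _ _
    have hYeq : ∀ᵐ z ∂(gibbs ν v x q.1), regField ν v x q.1 z - regField ν v x Y z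
        = (1 - Real.cos δ) * regField ν v x q.1 z + Real.sin δ * mixedField v x q.2 z := by
      filter_upwards [hac.ae_le h1.1, hac.ae_le h2.1] with z hz1 hz2
      rw [regField_of_good h1, regField_of_good h3]
      have hterm : mixedTerm x Y z = fun p => Real.cos δ * mixedTerm x q.1 z p
          - Real.sin δ * mixedTerm x q.2 z p := by
        ext p
        simp only [mixedTerm, pSpin_eq, hY, sub_mul, Finset.sum_sub_distrib, mul_assoc,
          ← Finset.mul_sum]
        ring
      simp only [mixedField]
      rw [hterm, (hz1.mul_left _).tsum_sub (hz2.mul_left _), tsum_mul_left, tsum_mul_left]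
      ring
    have hint₁ : Integrable (regField ν v x q.1) (gibbs ν v x q.1) :=
      ⟨(measurable_regField_right v x q.1).aestronglyMeasurable, h4⟩
    have hint₂ : Integrable (mixedField v x q.2) (gibbs ν v x q.1) :=
      ⟨(measurable_mixedField_right v x q.2).aestronglyMeasurable, h5⟩
    have hint : Integrable (fun z => (1 - Real.cos δ) * regField ν v x q.1 z
        + Real.sin δ * mixedField v x q.2 z) (gibbs ν v x q.1) :=
      (hint₁.const_mul _).add (hint₂.const_mul _)
    have hle := log_integral_exp_sub_le (integrable_exp_regField (ν := ν) v x q.1)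
      (integrable_exp_regField (ν := ν) v x Y) (hint.congr (hYeq.mono fun _ h => h.symm))
    calc ENNReal.ofReal (logZ ν v x q.1 - logZ ν v x Y)
        ≤ ENNReal.ofReal (∫ z, ((1 - Real.cos δ) * regField ν v x q.1 z
          + Real.sin δ * mixedField v x q.2 z) ∂(gibbs ν v x q.1)) := by
          refine ENNReal.ofReal_le_ofReal (hle.trans_eq (integral_congr_ae hYeq))
      _ ≤ ‖∫ z, ((1 - Real.cos δ) * regField ν v x q.1 z
          + Real.sin δ * mixedField v x q.2 z) ∂(gibbs ν v x q.1)‖ₑ := by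
          rw [Real.enorm_eq_ofReal_abs]
          exact ENNReal.ofReal_le_ofReal (le_abs_self _)
      _ ≤ ∫⁻ z, ‖(1 - Real.cos δ) * regField ν v x q.1 z
          + Real.sin δ * mixedField v x q.2 z‖ₑ ∂(gibbs ν v x q.1) := enorm_integral_le_lintegral_enorm _
      _ ≤ ∫⁻ z, (ENNReal.ofReal (1 - Real.cos δ) * ‖regField ν v x q.1 z‖ₑ
          + ENNReal.ofReal (Real.sin δ) * ‖mixedField v x q.2 z‖ₑ) ∂(gibbs ν v x q.1) := by
          refine lintegral_mono fun z => (enorm_add_le _ _).trans_eq ?_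
          rw [enorm_mul, enorm_mul, Real.enorm_of_nonneg hc, Real.enorm_of_nonneg hδ0]
      _ = _ := by
          rw [lintegral_add_left ((measurable_regField_right v x q.1).enorm.const_mul _),
            lintegral_const_mul' _ _ (by simp), lintegral_const_mul' _ _ (by simp)]
  refine (lintegral_mono_ae hpt).trans ?_
  rw [lintegral_add_right _ (hI₂m.const_mul _), lintegral_const_mul' _ _ (by simp),
    lintegral_const_mul' _ _ (by simp), ENNReal.ofReal_add (by positivity) (by positivity),
    ENNReal.ofReal_mul hc, ENNReal.ofReal_mul hδ0]
  gcongr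

lemma measurable_logZ_right (v : ℝ) (x : ℕ+ → ℝ) : Measurable (logZ ν v x) := by
  have h := (measurable_logZ (ν := ν) v).comp (measurable_prodMk_left (x := x))
  exact h

/-- Two independent copies of the log-partition function are compared along a path of `K`
rotations of angle `π / (2 K)`. -/
lemma lintegral_logZ_sub_le {v : ℝ} (hv : 1 ≤ v) {x : ℕ+ → ℝ} (hx : ∀ p, |x p| ≤ 2) {K : ℕ}
    (hK : 1 ≤ K) :
    ∫⁻ q, ‖logZ ν v x q.1 - logZ ν v x q.2‖ₑ ∂((gaussianLaw N).prod (gaussianLaw N))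
      ≤ ENNReal.ofReal (44 * v ^ 2 / K + 32 * v) := by
  set Γ := (gaussianLaw N).prod (gaussianLaw N) with hΓ
  have hKpos : (0 : ℝ) < K := by exact_mod_cast hK
  set δ : ℝ := Real.pi / (2 * K) with hδ
  have hδ0 : 0 ≤ δ := by positivity
  have hδle : δ ≤ 2 / K := by
    rw [hδ, div_le_div_iff₀ (by positivity) hKpos]
    nlinarith [Real.pi_le_four]
  have hKδ : (K : ℝ) * δ = Real.pi / 2 := by rw [hδ]; field_simp
  have hδpi : δ ≤ Real.pi := by
    rw [hδ]
    refine div_le_self Real.pi_pos.le ?_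
    have : (1 : ℝ) ≤ K := by exact_mod_cast hK
    linarith
  have hsin0 : 0 ≤ Real.sin δ := Real.sin_nonneg_of_nonneg_of_le_pi hδ0 hδpi
  have hstep_le : (1 - Real.cos δ) * (10 * v ^ 2 + 1) + Real.sin δ * (8 * v)
      ≤ (22 * v ^ 2 / K + 16 * v) / K := by
    have h1 : 1 - Real.cos δ ≤ 2 / K ^ 2 := by
      have := Real.one_sub_sq_div_two_le_cos (x := δ)
      have h2 : δ ^ 2 ≤ (2 / K) ^ 2 := pow_le_pow_left₀ hδ0 hδle 2
      have h3 : ((2 : ℝ) / K) ^ 2 = 2 * (2 / K ^ 2) := by field_simp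
      linarith
    have h2 : Real.sin δ ≤ 2 / K := (Real.sin_le hδ0).trans hδle
    have h3 : 10 * v ^ 2 + 1 ≤ 11 * v ^ 2 := by nlinarith
    calc (1 - Real.cos δ) * (10 * v ^ 2 + 1) + Real.sin δ * (8 * v)
        ≤ 2 / K ^ 2 * (11 * v ^ 2) + 2 / K * (8 * v) := by
          gcongr
      _ = (22 * v ^ 2 / K + 16 * v) / K := by field_simp; ring
  set R : ℕ → (CoeffIndex N → ℝ) × (CoeffIndex N → ℝ) → CoeffIndex N → ℝ := fun k q i =>
    Real.cos (k * δ) * q.1 i + Real.sin (k * δ) * q.2 i with hR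
  have hRm : ∀ k, Measurable (R k) := fun k => by simp only [hR]; fun_prop
  have hstep : ∀ k, ∫⁻ q, ENNReal.ofReal (logZ ν v x (R (k + 1) q) - logZ ν v x (R k q)) ∂Γ
      ≤ ENNReal.ofReal ((22 * v ^ 2 / K + 16 * v) / K) := by
    intro k
    refine le_trans (le_of_eq ?_) ((lintegral_logZ_rotate_le (ν := ν) hv hx hsin0).trans
      (ENNReal.ofReal_le_ofReal hstep_le))
    conv_rhs => rw [← map_rotation_infinitePi (((k + 1 : ℕ) : ℝ) * δ)]
    rw [lintegral_map]
    · refine lintegral_congr fun q => ?_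
      have harg : (fun i => Real.cos δ * (Real.cos (((k + 1 : ℕ) : ℝ) * δ) * q.1 i
          + Real.sin (((k + 1 : ℕ) : ℝ) * δ) * q.2 i) - Real.sin δ *
          (-Real.sin (((k + 1 : ℕ) : ℝ) * δ) * q.1 i
          + Real.cos (((k + 1 : ℕ) : ℝ) * δ) * q.2 i)) = R k q := by
        ext i
        have hk : (k : ℝ) * δ = ((k + 1 : ℕ) : ℝ) * δ - δ := by push_cast; ring
        simp only [hR]
        rw [hk, Real.cos_sub, Real.sin_sub]
        ring
      simp only [harg]
      rfl
    · have h := measurable_logZ_right (ν := ν) v x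
      exact ((h.comp measurable_fst).sub (h.comp (by fun_prop))).ennreal_ofReal
    · fun_prop
  have hone : ∫⁻ q, ENNReal.ofReal (logZ ν v x q.2 - logZ ν v x q.1) ∂Γ
      ≤ ENNReal.ofReal (22 * v ^ 2 / K + 16 * v) := by
    have h0 : ∀ q, R 0 q = q.1 := fun q => by ext i; simp [hR]
    have hKend : ∀ q, R K q = q.2 := fun q => by ext i; simp [hR, hKδ]
    calc ∫⁻ q, ENNReal.ofReal (logZ ν v x q.2 - logZ ν v x q.1) ∂Γ
        ≤ ∫⁻ q, ∑ k ∈ Finset.range K,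
            ENNReal.ofReal (logZ ν v x (R (k + 1) q) - logZ ν v x (R k q)) ∂Γ := by
          refine lintegral_mono fun q => ?_
          have htel := Finset.sum_range_sub (fun k => logZ ν v x (R k q)) K
          simp only [h0, hKend] at htel
          rw [← htel]
          exact Finset.le_sum_of_subadditive ENNReal.ofReal ENNReal.ofReal_zero.le
            (fun _ _ => ENNReal.ofReal_add_le) _ _
      _ = ∑ k ∈ Finset.range K, ∫⁻ q,
            ENNReal.ofReal (logZ ν v x (R (k + 1) q) - logZ ν v x (R k q)) ∂Γ := by
          refine lintegral_finsetSum _ fun k _ => ?_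
          have h := measurable_logZ_right (ν := ν) v x
          exact ((h.comp (hRm _)).sub (h.comp (hRm _))).ennreal_ofReal
      _ ≤ ∑ k ∈ Finset.range K, ENNReal.ofReal ((22 * v ^ 2 / K + 16 * v) / K) :=
          Finset.sum_le_sum fun k _ => hstep k
      _ = ENNReal.ofReal (22 * v ^ 2 / K + 16 * v) := by
          rw [Finset.sum_const, Finset.card_range, nsmul_eq_mul, ← ENNReal.ofReal_natCast,
            ← ENNReal.ofReal_mul hKpos.le]
          congr 1
          field_simp
  have hm : Measurable fun q : (CoeffIndex N → ℝ) × (CoeffIndex N → ℝ) =>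
      ENNReal.ofReal (logZ ν v x q.2 - logZ ν v x q.1) := by
    have h := measurable_logZ_right (ν := ν) v x
    exact ((h.comp measurable_snd).sub (h.comp measurable_fst)).ennreal_ofReal
  have htwo : ∫⁻ q, ENNReal.ofReal (logZ ν v x q.1 - logZ ν v x q.2) ∂Γ
      ≤ ENNReal.ofReal (22 * v ^ 2 / K + 16 * v) := by
    rw [← lintegral_prod_swap]
    exact hone
  calc ∫⁻ q, ‖logZ ν v x q.1 - logZ ν v x q.2‖ₑ ∂Γ
      ≤ ∫⁻ q, (ENNReal.ofReal (logZ ν v x q.1 - logZ ν v x q.2)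
          + ENNReal.ofReal (logZ ν v x q.2 - logZ ν v x q.1)) ∂Γ := by
        refine lintegral_mono fun q => ?_
        rw [Real.enorm_eq_ofReal_abs]
        rcases abs_cases (logZ ν v x q.1 - logZ ν v x q.2) with ⟨h, _⟩ | ⟨h, _⟩ <;> rw [h]
        · exact le_self_add
        · rw [neg_sub]; exact le_add_self
    _ = ∫⁻ q, ENNReal.ofReal (logZ ν v x q.1 - logZ ν v x q.2) ∂Γ
          + ∫⁻ q, ENNReal.ofReal (logZ ν v x q.2 - logZ ν v x q.1) ∂Γ :=
        lintegral_add_right _ hm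
    _ ≤ ENNReal.ofReal (22 * v ^ 2 / K + 16 * v) + ENNReal.ofReal (22 * v ^ 2 / K + 16 * v) := by
        gcongr
    _ = ENNReal.ofReal (44 * v ^ 2 / K + 32 * v) := by
        rw [← ENNReal.ofReal_add (by positivity) (by positivity)]
        ring_nf

lemma integrable_logZ {v : ℝ} {x : ℕ+ → ℝ} (hx : ∀ p, |x p| ≤ 2) :
    Integrable (logZ ν v x) (gaussianLaw N) := by
  refine ⟨(measurable_logZ_right v x).aestronglyMeasurable, ?_⟩
  have hm : ∀ s : ℝ, Measurable fun G : CoeffIndex N → ℝ =>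
      ∫⁻ z, ENNReal.ofReal (Real.exp (s * mixedField v x G z)) ∂ν := fun s =>
    Measurable.lintegral_prod_right' (ν := ν)
      ((measurable_mixedField_prod v x).const_mul s).exp.ennreal_ofReal
  calc ∫⁻ G, ‖logZ ν v x G‖ₑ ∂(gaussianLaw N)
      ≤ ∫⁻ G, ((∫⁻ z, ENNReal.ofReal (Real.exp (1 * mixedField v x G z)) ∂ν)
        + ∫⁻ z, ENNReal.ofReal (Real.exp (-1 * mixedField v x G z)) ∂ν) ∂(gaussianLaw N) := by
        refine lintegral_mono_ae ?_
        filter_upwards [ae_good (ν := ν) v hx,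
          ae_integrable_exp_mixedField (ν := ν) v hx (-1)] with G hG h3
        simp only [neg_one_mul, one_mul] at h3 ⊢
        have hA := integral_exp_pos hG.2
        rw [← ofReal_integral_eq_lintegral_ofReal hG.2 (ae_of_all _ fun _ => (Real.exp_pos _).le),
          ← ofReal_integral_eq_lintegral_ofReal h3 (ae_of_all _ fun _ => (Real.exp_pos _).le),
          ← ENNReal.ofReal_add hA.le (integral_exp_pos h3).le, Real.enorm_eq_ofReal_abs]
        refine ENNReal.ofReal_le_ofReal ?_
        rw [logZ, regField_of_good hG]
        have h4 := inv_integral_exp_le hG.2 h3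
        have h5 := Real.log_le_sub_one_of_pos hA
        have h6 := Real.log_le_sub_one_of_pos (inv_pos.2 hA)
        have h7 := inv_pos.2 hA
        rw [Real.log_inv] at h6
        rw [abs_le]
        constructor <;> linarith
    _ = (∫⁻ G, ∫⁻ z, ENNReal.ofReal (Real.exp (1 * mixedField v x G z)) ∂ν ∂(gaussianLaw N))
        + ∫⁻ G, ∫⁻ z, ENNReal.ofReal (Real.exp (-1 * mixedField v x G z)) ∂ν ∂(gaussianLaw N) :=
        lintegral_add_left (hm 1) _
    _ < ∞ := ENNReal.add_lt_top.2
        ⟨(lintegral_lintegral_exp_mixedField_le v hx 1).trans_lt ENNReal.ofReal_lt_top,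
          (lintegral_lintegral_exp_mixedField_le v hx (-1)).trans_lt ENNReal.ofReal_lt_top⟩

/-- The log-partition function has fluctuations of smaller order than `v ^ 2`, uniformly in the
dimension and in the reference measure. -/
lemma exists_integral_abs_logZ_sub_le {η : ℝ} (hη : 0 < η) :
    ∃ v₁ : ℝ, 1 ≤ v₁ ∧ ∀ v, v₁ ≤ v → ∀ (N : ℕ) (ν : Measure (UnitSphere N))
      [IsProbabilityMeasure ν] (x : ℕ+ → ℝ), (∀ p, |x p| ≤ 2) →
      ∫ G, |logZ ν v x G - ∫ G', logZ ν v x G' ∂(gaussianLaw N)| ∂(gaussianLaw N)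
        ≤ η * v ^ 2 := by
  obtain ⟨K, hK⟩ := exists_nat_ge (max 1 (88 / η))
  have hK1 : (1 : ℝ) ≤ K := (le_max_left _ _).trans hK
  have hK2 : 88 / η ≤ K := (le_max_right _ _).trans hK
  refine ⟨max 1 (64 / η), le_max_left _ _, fun v hv N ν _ x hx => ?_⟩
  have hv1 : 1 ≤ v := (le_max_left _ _).trans hv
  have hv2 : 64 / η ≤ v := (le_max_right _ _).trans hv
  have hint := integrable_logZ (ν := ν) (v := v) hx
  have hbound : 44 * v ^ 2 / K + 32 * v ≤ η * v ^ 2 := by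
    rw [div_le_iff₀ hη] at hK2 hv2
    have h1 : 44 * v ^ 2 / K ≤ η / 2 * v ^ 2 := by
      rw [div_le_iff₀ (by linarith)]
      nlinarith [sq_nonneg v]
    nlinarith
  have hdiff : Integrable (fun G => logZ ν v x G - ∫ G', logZ ν v x G' ∂(gaussianLaw N))
      (gaussianLaw N) := hint.sub (integrable_const _)
  have hm : Measurable fun q : (CoeffIndex N → ℝ) × (CoeffIndex N → ℝ) =>
      ‖logZ ν v x q.1 - logZ ν v x q.2‖ₑ := by
    have h := measurable_logZ_right (ν := ν) v x
    exact ((h.comp measurable_fst).sub (h.comp measurable_snd)).enorm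
  refine (ENNReal.ofReal_le_ofReal_iff (by positivity)).1 ?_
  calc ENNReal.ofReal
        (∫ G, |logZ ν v x G - ∫ G', logZ ν v x G' ∂(gaussianLaw N)| ∂(gaussianLaw N))
      = ∫⁻ G, ‖logZ ν v x G - ∫ G', logZ ν v x G' ∂(gaussianLaw N)‖ₑ ∂(gaussianLaw N) :=
        ofReal_integral_norm_eq_lintegral_enorm hdiff
    _ ≤ ∫⁻ G, ∫⁻ G', ‖logZ ν v x G - logZ ν v x G'‖ₑ ∂(gaussianLaw N) ∂(gaussianLaw N) := by
        refine lintegral_mono fun G => ?_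
        have : logZ ν v x G - ∫ G', logZ ν v x G' ∂(gaussianLaw N)
            = ∫ G', (logZ ν v x G - logZ ν v x G') ∂(gaussianLaw N) := by
          rw [integral_sub (integrable_const _) hint]; simp
        rw [this]
        exact enorm_integral_le_lintegral_enorm _
    _ = ∫⁻ q, ‖logZ ν v x q.1 - logZ ν v x q.2‖ₑ ∂((gaussianLaw N).prod (gaussianLaw N)) :=
        (lintegral_prod _ hm.aemeasurable).symm
    _ ≤ ENNReal.ofReal (44 * v ^ 2 / K + 32 * v) :=
        lintegral_logZ_sub_le hv1 hx (by exact_mod_cast hK1)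
    _ ≤ ENNReal.ofReal (η * v ^ 2) := ENNReal.ofReal_le_ofReal hbound

end Fluctuation

/-! ### Gaussian integration by parts -/

section IntegrationByParts

/-- Stein's identity for the standard Gaussian measure. -/
lemma integral_mul_gaussianReal_eq {F F' : ℝ → ℝ} {B B' : ℝ} (hF : ∀ t, HasDerivAt F (F' t) t)
    (hB : ∀ t, |F t| ≤ B) (hB' : ∀ t, |F' t| ≤ B') :
    ∫ t, t * F t ∂(gaussianReal 0 1) = ∫ t, F' t ∂(gaussianReal 0 1) := by
  have hFm : Measurable F :=
    (continuous_iff_continuousAt.2 fun t => (hF t).continuousAt).measurable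
  have hF'm : Measurable F' := by
    have : F' = deriv F := funext fun t => (hF t).deriv.symm
    rw [this]; exact measurable_deriv F
  set ρ : ℝ → ℝ := gaussianPDFReal 0 1 with hρ
  have hρeq : ∀ t, ρ t = (√(2 * Real.pi))⁻¹ * Real.exp (-(1 / 2) * t ^ 2) := by
    intro t
    simp only [hρ, gaussianPDFReal, NNReal.coe_one, mul_one, sub_zero]
    ring_nf
  have hρd : ∀ t, HasDerivAt ρ (-(t * ρ t)) t := by
    intro t
    have h1 : HasDerivAt (fun t : ℝ => -(1 / 2) * t ^ 2) (-t) t :=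
      ((hasDerivAt_pow 2 t).const_mul (-(1 / 2) : ℝ)).congr_deriv (by norm_num; ring)
    have h2 := (h1.exp.const_mul (√(2 * Real.pi))⁻¹)
    rw [funext hρeq]
    exact h2.congr_deriv (by ring)
  have hρi : Integrable ρ := integrable_gaussianPDFReal 0 1
  have hρti : Integrable fun t => t * ρ t := by
    have h := (integrable_mul_exp_neg_mul_sq (b := 1 / 2) (by norm_num)).const_mul
      (√(2 * Real.pi))⁻¹
    refine h.congr (ae_of_all _ fun t => ?_)
    simp only [hρeq]; ring
  have hparts := integral_mul_deriv_eq_deriv_mul_of_integrable (u := F) (v := ρ) (u' := F')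
    (v' := fun t => -(t * ρ t)) (fun t _ => hF t) (fun t _ => hρd t)
    (hρti.neg.bdd_mul hFm.aestronglyMeasurable (ae_of_all _ hB))
    (hρi.bdd_mul hF'm.aestronglyMeasurable (ae_of_all _ hB'))
    (hρi.bdd_mul hFm.aestronglyMeasurable (ae_of_all _ hB))
  rw [integral_gaussianReal_eq_integral_smul one_ne_zero,
    integral_gaussianReal_eq_integral_smul one_ne_zero]
  calc ∫ t, gaussianPDFReal 0 1 t • (t * F t) = -∫ t, F t * -(t * ρ t) := by
        rw [← integral_neg]
        refine integral_congr_ae (ae_of_all _ fun t => ?_)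
        simp only [smul_eq_mul, hρ]; ring
    _ = ∫ t, F' t * ρ t := by rw [hparts, neg_neg]
    _ = ∫ t, gaussianPDFReal 0 1 t • F' t :=
        integral_congr_ae (ae_of_all _ fun t => by simp only [smul_eq_mul, hρ]; ring)

lemma integral_infinitePi_update {ι : Type*} [DecidableEq ι] (μ : ι → Measure ℝ)
    [∀ i, IsProbabilityMeasure (μ i)] (i : ι) {f : (ι → ℝ) → ℝ} (hfm : Measurable f)
    (hf : Integrable f (Measure.infinitePi μ)) :
    ∫ G, f G ∂(Measure.infinitePi μ)
      = ∫ G, ∫ t, f (Function.update G i t) ∂(μ i) ∂(Measure.infinitePi μ) := by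
  have hmap := map_update_infinitePi μ i
  have h1 : Integrable (fun q : (ι → ℝ) × ℝ => f (Function.update q.1 i q.2))
      ((Measure.infinitePi μ).prod (μ i)) := by
    rw [← hmap] at hf
    exact (integrable_map_measure hfm.aestronglyMeasurable
      (measurable_update_prod i).aemeasurable).1 hf
  conv_lhs => rw [← hmap]
  rw [integral_map (measurable_update_prod i).aemeasurable hfm.aestronglyMeasurable,
    integral_prod _ h1]

/-- Integration by parts with respect to one coordinate of an i.i.d. Gaussian family. -/
lemma integral_coord_mul_eq {ι : Type*} [DecidableEq ι] (i : ι) {Φ Φ' : (ι → ℝ) → ℝ} {B B' : ℝ}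
    (hΦm : Measurable Φ) (hΦ'm : Measurable Φ') (hB : ∀ G, |Φ G| ≤ B) (hB' : ∀ G, |Φ' G| ≤ B')
    (hd : ∀ᵐ G ∂(Measure.infinitePi fun _ : ι => gaussianReal 0 1), ∀ t,
      HasDerivAt (fun t => Φ (Function.update G i t)) (Φ' (Function.update G i t)) t) :
    Integrable (fun G => G i * Φ G) (Measure.infinitePi fun _ : ι => gaussianReal 0 1) ∧
    ∫ G, G i * Φ G ∂(Measure.infinitePi fun _ : ι => gaussianReal 0 1)
      = ∫ G, Φ' G ∂(Measure.infinitePi fun _ : ι => gaussianReal 0 1) := by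
  have hcoord : Integrable (fun G : ι → ℝ => G i)
      (Measure.infinitePi fun _ : ι => gaussianReal 0 1) := by
    have h1 : Integrable (fun t : ℝ => t) (gaussianReal 0 1) :=
      (memLp_id_gaussianReal 1).integrable (by simp)
    exact (measurePreserving_eval_infinitePi
      (fun _ : ι => gaussianReal 0 1) i).integrable_comp_of_integrable h1
  have hint : Integrable (fun G => G i * Φ G)
      (Measure.infinitePi fun _ : ι => gaussianReal 0 1) :=
    hcoord.mul_bdd (c := B) hΦm.aestronglyMeasurable (ae_of_all _ hB)
  have hint' : Integrable Φ' (Measure.infinitePi fun _ : ι => gaussianReal 0 1) :=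
    Integrable.of_bound hΦ'm.aestronglyMeasurable B' (ae_of_all _ hB')
  refine ⟨hint, ?_⟩
  rw [integral_infinitePi_update _ i (by fun_prop) hint,
    integral_infinitePi_update _ i hΦ'm hint']
  refine integral_congr_ae ?_
  filter_upwards [hd] with G hG
  simp only [Function.update_self]
  exact integral_mul_gaussianReal_eq hG (fun t => hB _) fun t => hB' _

variable {N : ℕ} {ν : Measure (UnitSphere N)} [IsProbabilityMeasure ν] {v : ℝ} {x : ℕ+ → ℝ}
  {G : CoeffIndex N → ℝ}

lemma replicas_update (hG : Good ν v x G) (p : ℕ+) (i : Fin (p : ℕ) → Fin N) (n : ℕ) (t : ℝ) :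
    replicas ν v x (Function.update G ⟨p, i⟩ t) n
      = (Measure.pi fun _ : Fin n => ν).tilted fun z =>
        (∑ l, (regField ν v x G (z l)
          - G ⟨p, i⟩ * (v * (2 : ℝ)⁻¹ ^ (p : ℕ) * x p * monomial i (z l))))
        + t * ∑ l, v * (2 : ℝ)⁻¹ ^ (p : ℕ) * x p * monomial i (z l) := by
  set b := v * (2 : ℝ)⁻¹ ^ (p : ℕ) * x p with hb
  have hcm : Measurable fun z : UnitSphere N => (t - G ⟨p, i⟩) * (b * monomial i z) := by fun_prop
  have hcb : ∀ z : UnitSphere N, |(t - G ⟨p, i⟩) * (b * monomial i z)| ≤ |t - G ⟨p, i⟩| * |b| := by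
    intro z
    rw [abs_mul, abs_mul]
    have := abs_monomial_le_one i z
    have : |b| * |monomial i z| ≤ |b| := mul_le_of_le_one_right (abs_nonneg _) this
    gcongr
  obtain ⟨-, hchange⟩ := good_of_bounded_change hG hcm hcb
    (fun z hz => mixedField_update_right v p i t hz)
  rw [replicas, gibbs, tilted_congr hchange,
    pi_tilted n (integrable_exp_add_bdd (integrable_exp_regField v x G) hcm hcb)]
  congr 1
  ext z
  rw [Finset.mul_sum, ← Finset.sum_add_distrib]
  exact Finset.sum_congr rfl fun l _ => by ring

lemma measurable_integral_replicas_right {n : ℕ} {f : (Fin n → UnitSphere N) → ℝ}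
    (hf : Measurable f) (v : ℝ) (x : ℕ+ → ℝ) :
    Measurable fun G => ∫ z, f z ∂(replicas ν v x G n) := by
  have h := (measurable_integral_replicas (ν := ν) (v := v) (hf.comp measurable_snd)).comp
    (measurable_prodMk_left (x := x))
  exact h

lemma abs_integral_le_of_bound {S : Type*} [MeasurableSpace S] {μ : Measure S}
    [IsProbabilityMeasure μ] {f : S → ℝ} {B : ℝ} (hB : ∀ z, |f z| ≤ B) : |∫ z, f z ∂μ| ≤ B := by
  simpa using norm_integral_le_of_norm_le_const (μ := μ) (f := f) (ae_of_all _ hB)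

lemma abs_mul_le_of_le_one {a b B : ℝ} (ha : |a| ≤ B) (hb : |b| ≤ 1) : |a * b| ≤ B := by
  rw [abs_mul]
  exact (mul_le_of_le_one_right (abs_nonneg _) hb).trans ha

lemma abs_overlap_pow_le_one (z w : UnitSphere N) (p : ℕ) : |overlap z w ^ p| ≤ 1 := by
  rw [abs_pow]
  exact pow_le_one₀ (abs_nonneg _) (abs_overlap_le_one z w)

/-- Gaussian integration by parts for a Gibbs average of the `p`-spin form. -/
lemma integral_replicas_pSpin (hx : ∀ p, |x p| ≤ 2) (p : ℕ+) {n : ℕ} (l : Fin n)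
    {f : (Fin n → UnitSphere N) → ℝ} (hf : Measurable f) {B : ℝ} (hB : ∀ z, |f z| ≤ B) :
    ∫ G, ∫ z, f z * pSpin G p (z l) ∂(replicas ν v x G n) ∂(gaussianLaw N)
      = v * (2 : ℝ)⁻¹ ^ (p : ℕ) * x p *
        (∑ l', ∫ G, ∫ z, f z * overlap (z l) (z l') ^ (p : ℕ) ∂(replicas ν v x G n) ∂(gaussianLaw N)
          - n * ∫ G, ∫ z, f z * ∫ w, overlap (z l) w ^ (p : ℕ) ∂(gibbs ν v x G)
            ∂(replicas ν v x G n) ∂(gaussianLaw N)) := by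
  classical
  set b := v * (2 : ℝ)⁻¹ ^ (p : ℕ) * x p with hb
  obtain ⟨z₀⟩ : Nonempty (UnitSphere N) := nonempty_of_isProbabilityMeasure ν
  have hB0 : 0 ≤ B := (abs_nonneg _).trans (hB fun _ => z₀)
  set C : (Fin (p : ℕ) → Fin N) → (Fin n → UnitSphere N) → ℝ := fun i z =>
    ∑ l', b * monomial i (z l') with hC
  have hCm : ∀ i, Measurable (C i) := fun i => by simp only [hC]; fun_prop
  have hCb : ∀ i z, |C i z| ≤ n * |b| := by
    intro i z
    refine (Finset.abs_sum_le_sum_abs _ _).trans ?_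
    calc ∑ l', |b * monomial i (z l')| ≤ ∑ _l' : Fin n, |b| := by
          refine Finset.sum_le_sum fun l' _ => ?_
          rw [abs_mul]
          exact mul_le_of_le_one_right (abs_nonneg _) (abs_monomial_le_one i _)
      _ = n * |b| := by simp
  set F : (Fin (p : ℕ) → Fin N) → (Fin n → UnitSphere N) → ℝ := fun i z =>
    f z * monomial i (z l) with hF
  have hFm : ∀ i, Measurable (F i) := fun i => by simp only [hF]; fun_prop
  have hFb : ∀ i z, |F i z| ≤ B := by
    intro i z
    rw [hF, abs_mul]
    exact (mul_le_of_le_one_right (abs_nonneg _) (abs_monomial_le_one i _)).trans (hB z)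
  have hFC : ∀ i z, |F i z * C i z| ≤ B * (n * |b|) := fun i z => by
    rw [abs_mul]; exact mul_le_mul (hFb i z) (hCb i z) (abs_nonneg _) hB0
  set Φ : (Fin (p : ℕ) → Fin N) → (CoeffIndex N → ℝ) → ℝ := fun i G =>
    ∫ z, F i z ∂(replicas ν v x G n) with hΦ
  set Φ' : (Fin (p : ℕ) → Fin N) → (CoeffIndex N → ℝ) → ℝ := fun i G =>
    ∫ z, F i z * C i z ∂(replicas ν v x G n)
      - (∫ z, F i z ∂(replicas ν v x G n)) * ∫ z, C i z ∂(replicas ν v x G n) with hΦ'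
  have hΦm : ∀ i, Measurable (Φ i) := fun i => measurable_integral_replicas_right (hFm i) v x
  have hΦ₁m : ∀ i, Measurable fun G => ∫ z, F i z * C i z ∂(replicas ν v x G n) := fun i =>
    measurable_integral_replicas_right ((hFm i).mul (hCm i)) v x
  have hΦ₂m : ∀ i, Measurable fun G => ∫ z, C i z ∂(replicas ν v x G n) := fun i =>
    measurable_integral_replicas_right (hCm i) v x
  have hΦ'm : ∀ i, Measurable (Φ' i) := fun i => (hΦ₁m i).sub ((hΦm i).mul (hΦ₂m i))
  have hΦb : ∀ i G, |Φ i G| ≤ B := fun i G => abs_integral_le_of_bound (hFb i)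
  have hΦ₂b : ∀ i G, |(∫ z, F i z ∂(replicas ν v x G n)) * ∫ z, C i z ∂(replicas ν v x G n)|
      ≤ B * (n * |b|) := fun i G => by
    rw [abs_mul]
    exact mul_le_mul (hΦb i G) (abs_integral_le_of_bound (hCb i)) (abs_nonneg _) hB0
  have hΦ'b : ∀ i G, |Φ' i G| ≤ B * (n * |b|) + B * (n * |b|) := fun i G =>
    (abs_sub _ _).trans (add_le_add (abs_integral_le_of_bound (hFC i)) (hΦ₂b i G))
  have hd : ∀ i, ∀ᵐ G ∂(gaussianLaw N), ∀ t,
      HasDerivAt (fun t => Φ i (Function.update G ⟨p, i⟩ t))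
        (Φ' i (Function.update G ⟨p, i⟩ t)) t := by
    intro i
    filter_upwards [ae_good (ν := ν) v hx] with G hG t
    simp only [hΦ, hΦ', replicas_update hG p i n]
    refine hasDerivAt_integral_tilted ?_ (hCm i) (hCb i) (hFm i) (hFb i) t
    simp only [Real.exp_sum]
    refine Integrable.fintype_prod (f := fun _ z => Real.exp (regField ν v x G z
      - G ⟨p, i⟩ * (b * monomial i z))) fun _ => ?_
    simp only [sub_eq_add_neg]
    refine integrable_exp_add_bdd (C := |G ⟨p, i⟩| * |b|) (integrable_exp_regField v x G)
      (by fun_prop) fun z => ?_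
    rw [abs_neg, abs_mul, abs_mul]
    have : |b| * |monomial i z| ≤ |b| :=
      mul_le_of_le_one_right (abs_nonneg _) (abs_monomial_le_one i z)
    gcongr
  have hibp := fun i => integral_coord_mul_eq (⟨p, i⟩ : CoeffIndex N) (hΦm i) (hΦ'm i) (hΦb i)
    (hΦ'b i) (hd i)
  have hFint : ∀ i G, Integrable (F i) (replicas ν v x G n) := fun i G =>
    .of_bound (hFm i).aestronglyMeasurable B (ae_of_all _ (hFb i))
  have hovm : ∀ l', Measurable fun z : Fin n → UnitSphere N => overlap (z l) (z l') := fun l' => by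
    have hs : Measurable fun z : Fin n → UnitSphere N => (z l, z l') := by fun_prop
    exact measurable_overlap.comp hs
  have hlhs : ∀ G, ∫ z, f z * pSpin G p (z l) ∂(replicas ν v x G n) = ∑ i, G ⟨p, i⟩ * Φ i G := by
    intro G
    simp only [hΦ, ← integral_const_mul]
    rw [← integral_finsetSum _ fun i _ => (hFint i G).const_mul _]
    refine integral_congr_ae (ae_of_all _ fun z => ?_)
    simp only [pSpin_eq, hF, Finset.mul_sum]
    exact Finset.sum_congr rfl fun i _ => by ring
  have hΦ₁i : ∀ i, Integrable (fun G => ∫ z, F i z * C i z ∂(replicas ν v x G n))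
      (gaussianLaw N) := fun i =>
    .of_bound (hΦ₁m i).aestronglyMeasurable _ (ae_of_all _ fun G =>
      abs_integral_le_of_bound (hFC i))
  have hΦ₂i : ∀ i, Integrable (fun G => (∫ z, F i z ∂(replicas ν v x G n))
      * ∫ z, C i z ∂(replicas ν v x G n)) (gaussianLaw N) := fun i =>
    .of_bound ((hΦm i).mul (hΦ₂m i)).aestronglyMeasurable _ (ae_of_all _ (hΦ₂b i))
  have hfirst : ∀ G, ∑ i, ∫ z, F i z * C i z ∂(replicas ν v x G n)
      = b * ∑ l', ∫ z, f z * overlap (z l) (z l') ^ (p : ℕ) ∂(replicas ν v x G n) := by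
    intro G
    have hi : ∀ l', Integrable (fun z => f z * overlap (z l) (z l') ^ (p : ℕ))
        (replicas ν v x G n) := fun l' =>
      .of_bound (hf.mul ((hovm l').pow_const _)).aestronglyMeasurable B (ae_of_all _ fun z =>
        abs_mul_le_of_le_one (hB z) (abs_overlap_pow_le_one _ _ _))
    have hFCi : ∀ i, Integrable (fun z => F i z * C i z) (replicas ν v x G n) := fun i =>
      .of_bound ((hFm i).mul (hCm i)).aestronglyMeasurable _ (ae_of_all _ (hFC i))
    rw [← integral_finsetSum _ fun i _ => hFCi i, ← integral_finsetSum _ fun l' _ => hi l',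
      ← integral_const_mul]
    refine integral_congr_ae (ae_of_all _ fun z => ?_)
    simp only [hF, hC, ← sum_monomial_mul_monomial, Finset.mul_sum]
    rw [Finset.sum_comm]
    exact Finset.sum_congr rfl fun l' _ => Finset.sum_congr rfl fun i _ => by ring
  have hsecond : ∀ G, ∑ i, (∫ z, F i z ∂(replicas ν v x G n)) * ∫ z, C i z ∂(replicas ν v x G n)
      = b * (n * ∫ z, f z * ∫ w, overlap (z l) w ^ (p : ℕ) ∂(gibbs ν v x G)
          ∂(replicas ν v x G n)) := by
    intro G
    have hmonint : ∀ i : Fin (p : ℕ) → Fin N, Integrable (monomial i) (gibbs ν v x G) := fun i =>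
      .of_bound (measurable_monomial i).aestronglyMeasurable 1 (ae_of_all _ (abs_monomial_le_one i))
    have hCint : ∀ i, ∫ z, C i z ∂(replicas ν v x G n)
        = b * (n * ∫ w, monomial i w ∂(gibbs ν v x G)) := by
      intro i
      simp only [hC]
      rw [integral_finsetSum _ fun l' _ => by
        refine Integrable.const_mul (.of_bound (Measurable.aestronglyMeasurable (by fun_prop)) 1
          (ae_of_all _ fun z => abs_monomial_le_one i _)) _]
      simp only [integral_const_mul, integral_replicas_apply _ (measurable_monomial i)]
      simp
      ring
    have hinner : ∀ z : Fin n → UnitSphere N, f z * ∫ w, overlap (z l) w ^ (p : ℕ) ∂(gibbs ν v x G)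
        = ∑ i : Fin (p : ℕ) → Fin N, F i z * ∫ w, monomial i w ∂(gibbs ν v x G) := by
      intro z
      simp only [← sum_monomial_mul_monomial]
      rw [integral_finsetSum _ fun i _ => (hmonint i).const_mul _, Finset.mul_sum]
      refine Finset.sum_congr rfl fun i _ => ?_
      rw [integral_const_mul, hF]
      ring
    simp only [hinner]
    rw [integral_finsetSum _ fun i _ => (hFint i G).mul_const _]
    simp only [integral_mul_const, hCint, Finset.mul_sum]
    exact Finset.sum_congr rfl fun i _ => by ring
  have hi₁ : ∀ l', Integrable (fun G => ∫ z, f z * overlap (z l) (z l') ^ (p : ℕ)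
      ∂(replicas ν v x G n)) (gaussianLaw N) := fun l' =>
    .of_bound (measurable_integral_replicas_right
      (hf.mul ((hovm l').pow_const _)) v x).aestronglyMeasurable B (ae_of_all _ fun G =>
      abs_integral_le_of_bound fun z =>
        abs_mul_le_of_le_one (hB z) (abs_overlap_pow_le_one _ _ _))
  simp only [hlhs]
  rw [integral_finsetSum _ fun i _ => (hibp i).1, Finset.sum_congr rfl fun i _ => (hibp i).2]
  simp only [hΦ']
  rw [Finset.sum_congr rfl fun i _ => integral_sub (hΦ₁i i) (hΦ₂i i), Finset.sum_sub_distrib,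
    ← integral_finsetSum _ fun i _ => hΦ₁i i, ← integral_finsetSum _ fun i _ => hΦ₂i i]
  simp only [hfirst, hsecond, integral_const_mul]
  rw [integral_finsetSum _ fun l' _ => hi₁ l', mul_sub]

end IntegrationByParts

/-! ### Concentration of the `p`-spin form -/

section Convexity

/-- If a random function `u` is convex with subgradient `u'` and has small fluctuations around its
mean, then `u'` has small fluctuations around its mean for most values of the parameter. -/
lemma lintegral_subgradient_sub_le {Ω : Type*} [MeasurableSpace Ω] {P : Measure Ω}
    [IsProbabilityMeasure P] {u u' : ℝ → Ω → ℝ} {A L δ : ℝ} (hδ0 : 0 < δ) (hδ1 : δ ≤ 1)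
    (hui : ∀ t, |t| ≤ 2 → Integrable (u t) P) (hu'i : ∀ t, |t| ≤ 2 → Integrable (u' t) P)
    (htan : ∀ s t, |s| ≤ 2 → |t| ≤ 2 → ∀ᵐ ω ∂P, u' s ω * (t - s) ≤ u t ω - u s ω)
    (hA : ∀ t, |t| ≤ 2 → ∫ ω, |u t ω - ∫ ω', u t ω' ∂P| ∂P ≤ A)
    (hL : ∀ t, |t| ≤ 2 → |∫ ω, u' t ω ∂P| ≤ L) :
    ∫⁻ t in Set.Icc (0 : ℝ) 1, ∫⁻ ω, ‖u' t ω - ∫ ω', u' t ω' ∂P‖ₑ ∂P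
      ≤ ENNReal.ofReal (3 * A / δ + 4 * δ * L) := by
  set m : ℝ → ℝ := fun t => ∫ ω, u' t ω ∂P with hm
  set U : ℝ → ℝ := fun t => ∫ ω, u t ω ∂P with hU
  have hUtan : ∀ s t, |s| ≤ 2 → |t| ≤ 2 → m s * (t - s) ≤ U t - U s := by
    intro s t hs ht
    have h := integral_mono_ae ((hu'i s hs).mul_const (t - s)) ((hui t ht).sub (hui s hs))
      (htan s t hs ht)
    simp only [Pi.sub_apply] at h
    rwa [integral_mul_const, integral_sub (hui t ht) (hui s hs)] at h
  have hmono : ∀ s t, |s| ≤ 2 → |t| ≤ 2 → s ≤ t → m s ≤ m t := by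
    intro s t hs ht hst
    rcases hst.eq_or_lt with rfl | hlt
    · exact le_rfl
    have h1 := hUtan s t hs ht
    have h2 := hUtan t s ht hs
    by_contra! hcon
    nlinarith [mul_pos (sub_pos.2 hcon) (sub_pos.2 hlt)]
  have hmi : ∀ a b, |a| ≤ 2 → |b| ≤ 2 → IntervalIntegrable m volume a b := by
    intro a b ha hb
    refine MonotoneOn.intervalIntegrable fun s hs t ht hst => hmono s t ?_ ?_ hst
    all_goals
      rw [Set.mem_uIcc] at *
      rw [abs_le] at *
      constructor <;> rcases hs with hs | hs <;> rcases ht with ht | ht <;> linarith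
  have hpt : ∀ t ∈ Set.Icc (0 : ℝ) 1, ∫⁻ ω, ‖u' t ω - m t‖ₑ ∂P
      ≤ ENNReal.ofReal (3 * A / δ + (m (t + δ) - m (t - δ))) := by
    intro t ⟨ht0, ht1⟩
    have b0 : |t| ≤ 2 := abs_le.2 ⟨by linarith, by linarith⟩
    have b1 : |t + δ| ≤ 2 := abs_le.2 ⟨by linarith, by linarith⟩
    have b2 : |t - δ| ≤ 2 := abs_le.2 ⟨by linarith, by linarith⟩
    have i0 : Integrable (fun ω => |u t ω - U t|) P := ((hui t b0).sub (integrable_const _)).abs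
    have i1 : Integrable (fun ω => |u (t + δ) ω - U (t + δ)|) P :=
      ((hui _ b1).sub (integrable_const _)).abs
    have i2 : Integrable (fun ω => |u (t - δ) ω - U (t - δ)|) P :=
      ((hui _ b2).sub (integrable_const _)).abs
    -- Slopes of chords over `[t - δ, t]` and `[t, t + δ]` bracket the subgradients `u' t` and `m t`.
    have hle : ∀ᵐ ω ∂P, |u' t ω - m t| ≤ δ⁻¹ * (|u (t + δ) ω - U (t + δ)| + |u t ω - U t|
        + |u (t - δ) ω - U (t - δ)|) + (m (t + δ) - m (t - δ)) := by
      filter_upwards [htan t (t + δ) b0 b1, htan t (t - δ) b0 b2] with ω h1 h2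
      have h3 := hUtan (t + δ) t b1 b0
      have h4 := hUtan (t - δ) t b2 b0
      have h5 := hmono (t - δ) t b2 b0 (by linarith)
      have h6 := hmono t (t + δ) b0 b1 (by linarith)
      rw [← sub_le_iff_le_add, inv_mul_eq_div, le_div_iff₀ hδ0]
      have a1 := abs_le.1 (le_refl |u (t + δ) ω - U (t + δ)|)
      have a2 := abs_le.1 (le_refl |u t ω - U t|)
      have a3 := abs_le.1 (le_refl |u (t - δ) ω - U (t - δ)|)
      rcases abs_cases (u' t ω - m t) with ⟨h, _⟩ | ⟨h, _⟩ <;> rw [h]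
      · nlinarith
      · nlinarith
    have hint : Integrable (fun ω => u' t ω - m t) P := (hu'i t b0).sub (integrable_const _)
    rw [← ofReal_integral_norm_eq_lintegral_enorm hint]
    refine ENNReal.ofReal_le_ofReal ?_
    calc ∫ ω, |u' t ω - m t| ∂P ≤ ∫ ω, (δ⁻¹ * (|u (t + δ) ω - U (t + δ)| + |u t ω - U t|
        + |u (t - δ) ω - U (t - δ)|) + (m (t + δ) - m (t - δ))) ∂P :=
          integral_mono_ae hint.abs ((((i1.add i0).add i2).const_mul _).add (integrable_const _)) hle
      _ = δ⁻¹ * (∫ ω, |u (t + δ) ω - U (t + δ)| ∂P + ∫ ω, |u t ω - U t| ∂P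
          + ∫ ω, |u (t - δ) ω - U (t - δ)| ∂P) + (m (t + δ) - m (t - δ)) := by
          have i3 : Integrable (fun ω => |u (t + δ) ω - U (t + δ)| + |u t ω - U t|) P := i1.add i0
          have i4 : Integrable (fun ω => |u (t + δ) ω - U (t + δ)| + |u t ω - U t|
            + |u (t - δ) ω - U (t - δ)|) P := i3.add i2
          rw [integral_add (i4.const_mul _) (integrable_const _), integral_const_mul,
            integral_add i3 i2, integral_add i1 i0]
          simp
      _ ≤ δ⁻¹ * (A + A + A) + (m (t + δ) - m (t - δ)) := by
          have := hA _ b0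
          have := hA _ b1
          have := hA _ b2
          gcongr
      _ = 3 * A / δ + (m (t + δ) - m (t - δ)) := by rw [div_eq_inv_mul]; ring
  have hA0 : 0 ≤ A := (integral_nonneg fun _ => abs_nonneg _).trans (hA 0 (by norm_num))
  have hI1 : IntervalIntegrable (fun t => m (t + δ)) volume 0 1 := by
    have h := (hmi (0 + δ) (1 + δ) (abs_le.2 ⟨by linarith, by linarith⟩)
      (abs_le.2 ⟨by linarith, by linarith⟩)).comp_add_right δ
    simpa using h
  have hI2 : IntervalIntegrable (fun t => m (t - δ)) volume 0 1 := by
    have h := (hmi (0 - δ) (1 - δ) (abs_le.2 ⟨by linarith, by linarith⟩)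
      (abs_le.2 ⟨by linarith, by linarith⟩)).comp_sub_right δ
    simpa using h
  have hI : IntervalIntegrable (fun t => 3 * A / δ + (m (t + δ) - m (t - δ))) volume 0 1 :=
    intervalIntegrable_const.add (hI1.sub hI2)
  have hnn : ∀ t ∈ Set.Icc (0 : ℝ) 1, 0 ≤ 3 * A / δ + (m (t + δ) - m (t - δ)) := by
    intro t ⟨ht0, ht1⟩
    have := hmono (t - δ) (t + δ) (abs_le.2 ⟨by linarith, by linarith⟩)
      (abs_le.2 ⟨by linarith, by linarith⟩) (by linarith)
    have : 0 ≤ 3 * A / δ := by positivity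
    linarith
  calc ∫⁻ t in Set.Icc (0 : ℝ) 1, ∫⁻ ω, ‖u' t ω - m t‖ₑ ∂P
      ≤ ∫⁻ t in Set.Icc (0 : ℝ) 1, ENNReal.ofReal (3 * A / δ + (m (t + δ) - m (t - δ))) :=
        setLIntegral_mono' measurableSet_Icc hpt
    _ = ENNReal.ofReal (∫ t in Set.Icc (0 : ℝ) 1, (3 * A / δ + (m (t + δ) - m (t - δ)))) := by
        rw [ofReal_integral_eq_lintegral_ofReal
          ((intervalIntegrable_iff_integrableOn_Icc_of_le zero_le_one).1 hI)
          ((ae_restrict_iff' measurableSet_Icc).2 (ae_of_all _ hnn))]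
    _ ≤ ENNReal.ofReal (3 * A / δ + 4 * δ * L) := by
        refine ENNReal.ofReal_le_ofReal ?_
        rw [integral_Icc_eq_integral_Ioc, ← intervalIntegral.integral_of_le zero_le_one,
          intervalIntegral.integral_add intervalIntegrable_const (hI1.sub hI2),
          intervalIntegral.integral_sub hI1 hI2,
          intervalIntegral.integral_comp_add_right (fun t => m t),
          intervalIntegral.integral_comp_sub_right (fun t => m t)]
        have c1 : |(1 : ℝ) + δ| ≤ 2 := abs_le.2 ⟨by linarith, by linarith⟩
        have c2 : |(1 : ℝ) - δ| ≤ 2 := abs_le.2 ⟨by linarith, by linarith⟩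
        have c3 : |(0 : ℝ) + δ| ≤ 2 := abs_le.2 ⟨by linarith, by linarith⟩
        have c4 : |(0 : ℝ) - δ| ≤ 2 := abs_le.2 ⟨by linarith, by linarith⟩
        rw [intervalIntegral.integral_interval_sub_interval_comm (hmi _ _ c3 c1) (hmi _ _ c4 c2)
          (hmi _ _ c3 c4)]
        have hb : ∀ a b, |a| ≤ 2 → |b| ≤ 2 → a ≤ b → |∫ t in a..b, m t| ≤ L * (b - a) := by
          intro a b ha hb hab
          have := intervalIntegral.norm_integral_le_of_norm_le_const (a := a) (b := b) (f := m)
            (C := L) (fun t ht => by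
              rw [Set.uIoc_of_le hab] at ht
              exact hL t (abs_le.2 ⟨by linarith [ht.1, (abs_le.1 ha).1],
                by linarith [ht.2, (abs_le.1 hb).2]⟩))
          rwa [abs_of_nonneg (sub_nonneg.2 hab)] at this
        have e1 := hb _ _ c4 c3 (by linarith)
        have e2 := hb _ _ c2 c1 (by linarith)
        rw [intervalIntegral.integral_symm (0 - δ) (0 + δ),
          intervalIntegral.integral_symm (1 - δ) (1 + δ)]
        rw [abs_le] at e1 e2
        simp only [intervalIntegral.integral_const, sub_zero, one_smul]
        linarith [e1.1, e1.2, e2.1, e2.2]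

end Convexity

section Concentration

variable {N : ℕ} {ν : Measure (UnitSphere N)} {v : ℝ} {x : ℕ+ → ℝ} {G : CoeffIndex N → ℝ}

/-- The scale `v 2^{-p}` of the `p`-th component of the field. -/
noncomputable def scale (v : ℝ) (p : ℕ+) : ℝ := v * (2 : ℝ)⁻¹ ^ (p : ℕ)

lemma scale_pos (hv : 1 ≤ v) (p : ℕ+) : 0 < scale v p := by
  unfold scale; positivity

lemma four_mul_scale_sq_le (p : ℕ+) : 4 * scale v p ^ 2 ≤ v ^ 2 := by
  have h : (2 : ℝ)⁻¹ ^ (p : ℕ) ≤ 2⁻¹ := by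
    exact pow_le_of_le_one (by norm_num) (by norm_num) p.ne_zero
  have h0 : (0 : ℝ) ≤ (2 : ℝ)⁻¹ ^ (p : ℕ) := by positivity
  rw [scale, mul_pow]
  nlinarith [sq_nonneg v, mul_le_mul h h h0 (by norm_num)]

/-- The mean `E⟨v 2^{-p} g_p⟩` for fixed `x`. -/
noncomputable def meanSpin (ν : Measure (UnitSphere N)) (v : ℝ) (p : ℕ+) (x : ℕ+ → ℝ) : ℝ :=
  ∫ G, ∫ z, scale v p * pSpin G p z ∂(gibbs ν v x G) ∂(gaussianLaw N)

lemma measurable_pSpin_right (G : CoeffIndex N → ℝ) (p : ℕ+) :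
    Measurable fun z : UnitSphere N => pSpin G p z := by
  simp only [pSpin_eq]; fun_prop

lemma abs_scale_pSpin_le (v : ℝ) (G : CoeffIndex N → ℝ) (p : ℕ+) (z : UnitSphere N) :
    |scale v p * pSpin G p z| ≤ |scale v p| * coeffSum G p := by
  rw [abs_mul]
  gcongr
  exact abs_pSpin_le G p z

lemma regField_update_left (hG : Good ν v x G) (p : ℕ+) (t : ℝ) :
    Good ν v (Function.update x p t) G ∧
      regField ν v (Function.update x p t) G =ᵐ[ν] fun z =>
        (regField ν v x G z - x p * (scale v p * pSpin G p z))
          + t * (scale v p * pSpin G p z) := by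
  have h := good_of_bounded_change (x' := Function.update x p t) (G' := G)
    (c := fun z => (t - x p) * (scale v p * pSpin G p z))
    (C := |t - x p| * (|scale v p| * coeffSum G p)) hG
    (((measurable_pSpin_right G p).const_mul _).const_mul _) (fun z => by
      rw [abs_mul]
      exact mul_le_mul_of_nonneg_left (abs_scale_pSpin_le v G p z) (abs_nonneg _))
    (fun z hz => mixedField_update_left v p t hz)
  refine ⟨h.1, h.2.trans (ae_of_all _ fun z => ?_)⟩
  simp only
  ring

lemma gibbs_update_left (hG : Good ν v x G) (p : ℕ+) (t : ℝ) :
    gibbs ν v (Function.update x p t) G = ν.tilted fun z =>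
      (regField ν v x G z - x p * (scale v p * pSpin G p z)) + t * (scale v p * pSpin G p z) :=
  tilted_congr (regField_update_left hG p t).2

variable [IsProbabilityMeasure ν]

lemma integrable_exp_base (p : ℕ+) : Integrable
    (fun z => Real.exp (regField ν v x G z - x p * (scale v p * pSpin G p z))) ν := by
  simp only [sub_eq_add_neg]
  refine integrable_exp_add_bdd (C := |x p| * (|scale v p| * coeffSum G p))
    (integrable_exp_regField v x G)
    ((((measurable_pSpin_right G p).const_mul _).const_mul _).neg) fun z => ?_
  rw [abs_neg, abs_mul]
  exact mul_le_mul_of_nonneg_left (abs_scale_pSpin_le v G p z) (abs_nonneg _)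

lemma measurable_update_left (x : ℕ+ → ℝ) (p : ℕ+) :
    Measurable fun q : ℝ × (CoeffIndex N → ℝ) => (Function.update x p q.1, q.2) := by
  have h := (measurable_update_prod p).comp (measurable_prodMk_left (x := x) (β := ℝ))
  exact (h.comp measurable_fst).prodMk measurable_snd

lemma integrable_coeffSum (p : ℕ+) : Integrable (fun G => coeffSum G p) (gaussianLaw N) := by
  unfold coeffSum
  refine integrable_finsetSum _ fun i _ => ?_
  have h1 : Integrable (fun t : ℝ => t) (gaussianReal 0 1) :=
    (memLp_id_gaussianReal 1).integrable (by simp)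
  exact ((measurePreserving_eval_infinitePi (fun _ : CoeffIndex N => gaussianReal 0 1)
    ⟨p, i⟩).integrable_comp_of_integrable h1).abs

lemma meanSpin_eq (hx : ∀ q, |x q| ≤ 2) (p : ℕ+) :
    meanSpin ν v p x = scale v p ^ 2 * x p *
      (1 - ∫ G, ∫ z, ∫ w, overlap z w ^ (p : ℕ) ∂(gibbs ν v x G) ∂(gibbs ν v x G)
        ∂(gaussianLaw N)) := by
  have h := integral_replicas_pSpin (ν := ν) (v := v) hx p (n := 1) 0 (f := fun _ => 1)
    measurable_const (B := 1) (by simp)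
  have hm : ∀ G, Measurable fun z : UnitSphere N => ∫ w, overlap z w ^ (p : ℕ) ∂(gibbs ν v x G) := by
    intro G
    exact (StronglyMeasurable.integral_prod_right' (ν := gibbs ν v x G)
      (measurable_overlap.pow_const (p : ℕ)).stronglyMeasurable).measurable
  simp only [one_mul, Fin.isValue, Finset.univ_unique, Fin.default_eq_zero, Finset.sum_singleton,
    overlap_self, one_pow, integral_const, probReal_univ, smul_eq_mul, mul_one, Nat.cast_one] at h
  have h1 : ∀ G, ∫ z, pSpin G p (z 0) ∂(replicas ν v x G 1) = ∫ z, pSpin G p z ∂(gibbs ν v x G) :=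
    fun G => integral_replicas_apply 0 (measurable_pSpin_right G p)
  have h2 : ∀ G, ∫ z, ∫ w, overlap (z 0) w ^ (p : ℕ) ∂(gibbs ν v x G) ∂(replicas ν v x G 1)
      = ∫ z, ∫ w, overlap z w ^ (p : ℕ) ∂(gibbs ν v x G) ∂(gibbs ν v x G) :=
    fun G => integral_replicas_apply 0 (hm G)
  simp only [h1, h2] at h
  simp only [meanSpin, integral_const_mul, h]
  rw [scale]
  ring

lemma abs_meanSpin_le (hx : ∀ q, |x q| ≤ 2) (p : ℕ+) : |meanSpin ν v p x| ≤ v ^ 2 := by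
  rw [meanSpin_eq hx, abs_mul, abs_mul, abs_of_nonneg (sq_nonneg _)]
  have h1 : |∫ G, ∫ z, ∫ w, overlap z w ^ (p : ℕ) ∂(gibbs ν v x G) ∂(gibbs ν v x G)
      ∂(gaussianLaw N)| ≤ 1 :=
    abs_integral_le_of_bound fun G => abs_integral_le_of_bound fun z =>
      abs_integral_le_of_bound fun w => abs_overlap_pow_le_one z w _
  have h2 : |1 - ∫ G, ∫ z, ∫ w, overlap z w ^ (p : ℕ) ∂(gibbs ν v x G) ∂(gibbs ν v x G)
      ∂(gaussianLaw N)| ≤ 2 := by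
    rw [abs_le] at h1 ⊢
    constructor <;> linarith
  calc scale v p ^ 2 * |x p| * _ ≤ scale v p ^ 2 * 2 * 2 := by
        gcongr
        exact hx p
    _ ≤ v ^ 2 := by linarith [four_mul_scale_sq_le (v := v) p]

lemma abs_update_le (hx : ∀ q, |x q| ≤ 1) (p : ℕ+) {t : ℝ} (ht : |t| ≤ 2) (q : ℕ+) :
    |Function.update x p t q| ≤ 2 := by
  by_cases h : q = p
  · subst h; simpa using ht
  · rw [Function.update_of_ne h]; linarith [hx q]

/-- The Gibbs average `v 2^{-p} ⟨g_p⟩` as a function of the `p`-th parameter and the disorder. -/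
noncomputable def gibbsSpin (ν : Measure (UnitSphere N)) (v : ℝ) (x : ℕ+ → ℝ) (p : ℕ+) (t : ℝ)
    (G : CoeffIndex N → ℝ) : ℝ :=
  ∫ z, scale v p * pSpin G p z ∂(gibbs ν v (Function.update x p t) G)

/-- The Gibbs variance of `v 2^{-p} g_p`. -/
noncomputable def gibbsVar (ν : Measure (UnitSphere N)) (v : ℝ) (x : ℕ+ → ℝ) (p : ℕ+) (t : ℝ)
    (G : CoeffIndex N → ℝ) : ℝ :=
  ∫ z, (scale v p * pSpin G p z) * (scale v p * pSpin G p z)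
      ∂(gibbs ν v (Function.update x p t) G)
    - gibbsSpin ν v x p t G * gibbsSpin ν v x p t G

lemma measurable_gibbsSpin (x : ℕ+ → ℝ) (p : ℕ+) :
    Measurable fun q : ℝ × (CoeffIndex N → ℝ) => gibbsSpin ν v x p q.1 q.2 := by
  have hf : Measurable fun q : ((ℕ+ → ℝ) × (CoeffIndex N → ℝ)) × UnitSphere N =>
      scale v p * pSpin q.1.2 p q.2 := by
    simp only [pSpin_eq]; fun_prop
  have h := (measurable_integral_gibbs (ν := ν) (v := v) hf).comp (measurable_update_left x p)
  exact h

lemma measurable_gibbsVar (x : ℕ+ → ℝ) (p : ℕ+) :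
    Measurable fun q : ℝ × (CoeffIndex N → ℝ) => gibbsVar ν v x p q.1 q.2 := by
  have hf : Measurable fun q : ((ℕ+ → ℝ) × (CoeffIndex N → ℝ)) × UnitSphere N =>
      (scale v p * pSpin q.1.2 p q.2) * (scale v p * pSpin q.1.2 p q.2) := by
    simp only [pSpin_eq]; fun_prop
  have h := (measurable_integral_gibbs (ν := ν) (v := v) hf).comp (measurable_update_left x p)
  have h1 := measurable_gibbsSpin (ν := ν) (v := v) x p
  exact Measurable.sub h (h1.mul h1)

lemma integrable_gibbsSpin (x : ℕ+ → ℝ) (p : ℕ+) (t : ℝ) :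
    Integrable (gibbsSpin ν v x p t) (gaussianLaw N) := by
  refine ((integrable_coeffSum p).const_mul |scale v p|).mono'
    ((measurable_gibbsSpin x p).comp measurable_prodMk_left).aestronglyMeasurable
    (ae_of_all _ fun G => ?_)
  exact abs_integral_le_of_bound fun z => abs_scale_pSpin_le v G p z

/-- `⟨g_p⟩` is a subgradient of the log-partition function. -/
lemma gibbsSpin_mul_le (hG : Good ν v x G) (p : ℕ+) (s t : ℝ) :
    gibbsSpin ν v x p s G * (t - s)
      ≤ logZ ν v (Function.update x p t) G - logZ ν v (Function.update x p s) G := by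
  have hs := (regField_update_left hG p s).2
  have ht := (regField_update_left hG p t).2
  have hac : gibbs ν v (Function.update x p s) G ≪ ν := tilted_absolutelyContinuous _ _
  have hdiff : ∀ᵐ z ∂(gibbs ν v (Function.update x p s) G),
      regField ν v (Function.update x p s) G z - regField ν v (Function.update x p t) G z
        = (s - t) * (scale v p * pSpin G p z) := by
    filter_upwards [hac.ae_le hs, hac.ae_le ht] with z h1 h2
    rw [h1, h2]; ring
  have hint : Integrable (fun z => (s - t) * (scale v p * pSpin G p z))
      (gibbs ν v (Function.update x p s) G) :=
    Integrable.const_mul (.of_bound ((measurable_pSpin_right G p).const_mul _).aestronglyMeasurable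
      _ (ae_of_all _ (abs_scale_pSpin_le v G p))) _
  have h := log_integral_exp_sub_le
    (integrable_exp_regField (ν := ν) v (Function.update x p s) G)
    (integrable_exp_regField (ν := ν) v (Function.update x p t) G)
    (hint.congr (hdiff.mono fun _ h => h.symm))
  rw [show ν.tilted (fun z => regField ν v (Function.update x p s) G z)
    = gibbs ν v (Function.update x p s) G from rfl] at h
  rw [integral_congr_ae hdiff, integral_const_mul] at h
  rw [gibbsSpin, logZ, logZ]
  linarith

lemma hasDerivAt_gibbsSpin (hG : Good ν v x G) (p : ℕ+) (t : ℝ) :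
    HasDerivAt (fun t => gibbsSpin ν v x p t G) (gibbsVar ν v x p t G) t := by
  simp only [gibbsSpin, gibbsVar, gibbs_update_left hG]
  exact hasDerivAt_integral_tilted (integrable_exp_base p)
    ((measurable_pSpin_right G p).const_mul _) (abs_scale_pSpin_le v G p)
    ((measurable_pSpin_right G p).const_mul _) (abs_scale_pSpin_le v G p) t

lemma continuous_gibbsVar (hG : Good ν v x G) (p : ℕ+) :
    Continuous fun t => gibbsVar ν v x p t G := by
  have h1 : Continuous fun t => gibbsSpin ν v x p t G :=
    continuous_iff_continuousAt.2 fun t => (hasDerivAt_gibbsSpin hG p t).continuousAt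
  have h2 : Continuous fun t => ∫ z, (scale v p * pSpin G p z) * (scale v p * pSpin G p z)
      ∂(gibbs ν v (Function.update x p t) G) := by
    simp only [gibbs_update_left hG]
    refine continuous_iff_continuousAt.2 fun t => (hasDerivAt_integral_tilted
      (B := |scale v p| * coeffSum G p * (|scale v p| * coeffSum G p)) (integrable_exp_base p)
      ((measurable_pSpin_right G p).const_mul _) (abs_scale_pSpin_le v G p)
      (((measurable_pSpin_right G p).const_mul _).mul ((measurable_pSpin_right G p).const_mul _))
      (fun z => ?_) t).continuousAt
    have h := abs_scale_pSpin_le v G p z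
    rw [Pi.mul_apply, abs_mul]
    exact mul_le_mul h h (abs_nonneg _) ((abs_nonneg _).trans h)
  exact h2.sub (h1.mul h1)

lemma gibbsVar_eq (x : ℕ+ → ℝ) (G : CoeffIndex N → ℝ) (p : ℕ+) (t : ℝ) :
    gibbsVar ν v x p t G = ∫ z, (scale v p * pSpin G p z - gibbsSpin ν v x p t G) ^ 2
      ∂(gibbs ν v (Function.update x p t) G) := by
  have hi : Integrable (fun z => scale v p * pSpin G p z)
      (gibbs ν v (Function.update x p t) G) :=
    .of_bound ((measurable_pSpin_right G p).const_mul _).aestronglyMeasurable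
      _ (ae_of_all _ (abs_scale_pSpin_le v G p))
  have hi2 : Integrable (fun z => (scale v p * pSpin G p z) * (scale v p * pSpin G p z))
      (gibbs ν v (Function.update x p t) G) :=
    hi.mul_bdd (c := |scale v p| * coeffSum G p) hi.aestronglyMeasurable
      (ae_of_all _ (abs_scale_pSpin_le v G p))
  have hexp : ∀ z, (scale v p * pSpin G p z - gibbsSpin ν v x p t G) ^ 2
      = (scale v p * pSpin G p z) * (scale v p * pSpin G p z)
        - 2 * gibbsSpin ν v x p t G * (scale v p * pSpin G p z)
        + gibbsSpin ν v x p t G ^ 2 := fun z => by ring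
  simp only [hexp]
  have h12 : Integrable (fun z => (scale v p * pSpin G p z) * (scale v p * pSpin G p z)
      - 2 * gibbsSpin ν v x p t G * (scale v p * pSpin G p z))
      (gibbs ν v (Function.update x p t) G) := hi2.sub (hi.const_mul _)
  rw [integral_add h12 (integrable_const _), integral_sub hi2 (hi.const_mul _), integral_const_mul]
  simp only [integral_const, probReal_univ, one_smul, gibbsVar]
  rw [show ∫ z, scale v p * pSpin G p z ∂(gibbs ν v (Function.update x p t) G)
    = gibbsSpin ν v x p t G from rfl]
  ring

lemma gibbsVar_nonneg (x : ℕ+ → ℝ) (G : CoeffIndex N → ℝ) (p : ℕ+) (t : ℝ) :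
    0 ≤ gibbsVar ν v x p t G := by
  rw [gibbsVar_eq]; exact integral_nonneg fun z => sq_nonneg _

/-- The thermal fluctuations of `v 2^{-p} g_p` are of order `v`: its Gibbs variance is the
derivative in the `p`-th parameter of a quantity of order `v ^ 2`. -/
lemma lintegral_thermal_le (hv : 1 ≤ v) (hx : ∀ q, |x q| ≤ 1) (p : ℕ+) :
    ∫⁻ t in Set.Icc (0 : ℝ) 1, ∫⁻ G, ∫⁻ z, ‖scale v p * pSpin G p z - gibbsSpin ν v x p t G‖ₑ
      ∂(gibbs ν v (Function.update x p t) G) ∂(gaussianLaw N) ≤ ENNReal.ofReal (2 * v) := by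
  have hv0 : 0 < v := by linarith
  have hpt : ∀ t G, ∫⁻ z, ‖scale v p * pSpin G p z - gibbsSpin ν v x p t G‖ₑ
      ∂(gibbs ν v (Function.update x p t) G)
      ≤ ENNReal.ofReal (1 / (2 * v)) * ENNReal.ofReal (gibbsVar ν v x p t G)
        + ENNReal.ofReal (v / 2) := by
    intro t G
    have hi : Integrable (fun z => scale v p * pSpin G p z - gibbsSpin ν v x p t G)
        (gibbs ν v (Function.update x p t) G) :=
      Integrable.sub (.of_bound ((measurable_pSpin_right G p).const_mul _).aestronglyMeasurable
        _ (ae_of_all _ (abs_scale_pSpin_le v G p))) (integrable_const _)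
    have hb : ∀ z, |scale v p * pSpin G p z - gibbsSpin ν v x p t G|
        ≤ |scale v p| * coeffSum G p + |gibbsSpin ν v x p t G| := fun z =>
      (abs_sub _ _).trans (by gcongr; exact abs_scale_pSpin_le v G p z)
    have hi2 : Integrable (fun z => (scale v p * pSpin G p z - gibbsSpin ν v x p t G) ^ 2)
        (gibbs ν v (Function.update x p t) G) := by
      simp only [sq]
      exact hi.mul_bdd hi.aestronglyMeasurable (ae_of_all _ hb)
    rw [← ofReal_integral_norm_eq_lintegral_enorm hi, ← ENNReal.ofReal_mul (by positivity),
      ← ENNReal.ofReal_add (mul_nonneg (by positivity) (gibbsVar_nonneg x G p t)) (by positivity),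
      gibbsVar_eq]
    refine ENNReal.ofReal_le_ofReal ?_
    -- `|y| ≤ y² / (2 v) + v / 2` turns the bound `v²` for the variance into the bound `v` for `|y|`.
    have hle : ∀ z, |scale v p * pSpin G p z - gibbsSpin ν v x p t G|
        ≤ 1 / (2 * v) * (scale v p * pSpin G p z - gibbsSpin ν v x p t G) ^ 2 + v / 2 := by
      intro z
      set y := scale v p * pSpin G p z - gibbsSpin ν v x p t G
      have h1 : 0 ≤ 1 / (2 * v) * (|y| - v) ^ 2 := by positivity
      have h2 : 1 / (2 * v) * (|y| - v) ^ 2 = 1 / (2 * v) * y ^ 2 + v / 2 - |y| := by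
        rw [← sq_abs y]; field_simp; ring
      linarith
    have h := integral_mono hi.abs ((hi2.const_mul _).add (integrable_const _)) hle
    simp only [Pi.add_apply] at h
    rw [integral_add (hi2.const_mul _) (integrable_const _), integral_const_mul] at h
    simpa using h
  have hVm : Measurable fun q : ℝ × (CoeffIndex N → ℝ) =>
      ENNReal.ofReal (gibbsVar ν v x p q.1 q.2) := (measurable_gibbsVar x p).ennreal_ofReal
  have hmean : ∀ t, ∫ G, gibbsSpin ν v x p t G ∂(gaussianLaw N)
      = meanSpin ν v p (Function.update x p t) := fun t => rfl
  have hV : ∫⁻ t in Set.Icc (0 : ℝ) 1, ∫⁻ G, ENNReal.ofReal (gibbsVar ν v x p t G) ∂(gaussianLaw N)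
      ≤ ENNReal.ofReal (2 * v ^ 2) := by
    rw [lintegral_lintegral_swap hVm.aemeasurable]
    have hae : ∀ᵐ G ∂(gaussianLaw N),
        ∫⁻ t in Set.Icc (0 : ℝ) 1, ENNReal.ofReal (gibbsVar ν v x p t G)
          = ENNReal.ofReal (gibbsSpin ν v x p 1 G - gibbsSpin ν v x p 0 G) ∧
        0 ≤ gibbsSpin ν v x p 1 G - gibbsSpin ν v x p 0 G := by
      filter_upwards [ae_good (ν := ν) v (fun q => (hx q).trans one_le_two)] with G hG
      have hcont := continuous_gibbsVar hG p
      have hftc := intervalIntegral.integral_eq_sub_of_hasDerivAt (a := 0) (b := 1)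
        (fun t _ => hasDerivAt_gibbsSpin hG p t) (hcont.intervalIntegrable 0 1)
      rw [intervalIntegral.integral_of_le zero_le_one, ← integral_Icc_eq_integral_Ioc] at hftc
      rw [← hftc]
      exact ⟨(ofReal_integral_eq_lintegral_ofReal hcont.integrableOn_Icc
        (ae_of_all _ fun t => gibbsVar_nonneg x G p t)).symm,
        integral_nonneg fun t => gibbsVar_nonneg x G p t⟩
    have hsub : Integrable (fun G => gibbsSpin ν v x p 1 G - gibbsSpin ν v x p 0 G)
        (gaussianLaw N) := (integrable_gibbsSpin x p 1).sub (integrable_gibbsSpin x p 0)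
    rw [lintegral_congr_ae (hae.mono fun _ h => h.1),
      ← ofReal_integral_eq_lintegral_ofReal hsub (hae.mono fun _ h => h.2),
      integral_sub (integrable_gibbsSpin x p 1) (integrable_gibbsSpin x p 0), hmean, hmean]
    refine ENNReal.ofReal_le_ofReal ?_
    have h1 := abs_meanSpin_le (ν := ν) (v := v)
      (abs_update_le hx p (t := 1) (by norm_num)) p
    have h0 := abs_meanSpin_le (ν := ν) (v := v)
      (abs_update_le hx p (t := 0) (by norm_num)) p
    linarith [(abs_le.1 h1).2, (abs_le.1 h0).1]
  calc _ ≤ ∫⁻ t in Set.Icc (0 : ℝ) 1, ∫⁻ G, (ENNReal.ofReal (1 / (2 * v))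
        * ENNReal.ofReal (gibbsVar ν v x p t G) + ENNReal.ofReal (v / 2)) ∂(gaussianLaw N) :=
        lintegral_mono fun t => lintegral_mono fun G => hpt t G
    _ = ENNReal.ofReal (1 / (2 * v)) * (∫⁻ t in Set.Icc (0 : ℝ) 1,
          ∫⁻ G, ENNReal.ofReal (gibbsVar ν v x p t G) ∂(gaussianLaw N))
        + ENNReal.ofReal (v / 2) := by
        simp only [lintegral_add_right _ measurable_const, lintegral_const,
          lintegral_const_mul' _ _ ENNReal.ofReal_ne_top, measure_univ, mul_one]
        simp
    _ ≤ ENNReal.ofReal (1 / (2 * v)) * ENNReal.ofReal (2 * v ^ 2) + ENNReal.ofReal (v / 2) := by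
        gcongr
    _ = ENNReal.ofReal (v + v / 2) := by
        rw [← ENNReal.ofReal_mul (by positivity), ← ENNReal.ofReal_add (by positivity)
          (by positivity)]
        congr 1
        field_simp
    _ ≤ ENNReal.ofReal (2 * v) := ENNReal.ofReal_le_ofReal (by linarith)

/-- For most values of the `p`-th parameter, `v 2^{-p} g_p` is close to its mean on the scale
`v ^ 2`, uniformly in the dimension and in the reference measure. -/
lemma exists_lintegral_pSpin_sub_le (p : ℕ+) {η : ℝ} (hη : 0 < η) :
    ∃ v₁ : ℝ, 1 ≤ v₁ ∧ ∀ v, v₁ ≤ v → ∀ (N : ℕ) (ν : Measure (UnitSphere N))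
      [IsProbabilityMeasure ν] (x : ℕ+ → ℝ), (∀ q, |x q| ≤ 1) →
      ∫⁻ t in Set.Icc (0 : ℝ) 1, ∫⁻ G, ∫⁻ z,
        ‖scale v p * pSpin G p z - meanSpin ν v p (Function.update x p t)‖ₑ
        ∂(gibbs ν v (Function.update x p t) G) ∂(gaussianLaw N) ≤ ENNReal.ofReal (η * v ^ 2) := by
  -- The convexity bound `3 A / δ + 4 δ v²` is at most `η v² / 2` for this `δ` and
  -- `A = η δ v² / 12`; the thermal part `2 v` is at most `η v² / 2` since `v ≥ 4 / η`.
  set δ : ℝ := min 1 (η / 16) with hδ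
  have hδ0 : 0 < δ := by positivity
  have hδη : δ ≤ η / 16 := min_le_right _ _
  obtain ⟨v₁, hv₁, hfluct⟩ := exists_integral_abs_logZ_sub_le (η := η * δ / 12) (by positivity)
  refine ⟨max v₁ (4 / η), hv₁.trans (le_max_left _ _), fun v hv N ν _ x hx => ?_⟩
  have hvv₁ : v₁ ≤ v := (le_max_left _ _).trans hv
  have hv1 : 1 ≤ v := hv₁.trans hvv₁
  have hv2 : 4 ≤ v * η := (div_le_iff₀ hη).1 ((le_max_right _ _).trans hv)
  have hdis := lintegral_subgradient_sub_le (P := gaussianLaw N)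
    (u := fun t G => logZ ν v (Function.update x p t) G) (u' := gibbsSpin ν v x p)
    (A := η * δ / 12 * v ^ 2) (L := v ^ 2) hδ0 (min_le_left _ _)
    (fun t ht => integrable_logZ (abs_update_le hx p ht))
    (fun t _ => integrable_gibbsSpin x p t)
    (fun s t _ _ => by
      filter_upwards [ae_good (ν := ν) v (fun q => (hx q).trans one_le_two)] with G hG
      exact gibbsSpin_mul_le hG p s t)
    (fun t ht => hfluct v hvv₁ N ν _ (abs_update_le hx p ht))
    (fun t ht => abs_meanSpin_le (abs_update_le hx p ht) p)
  have hth := lintegral_thermal_le (ν := ν) hv1 hx p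
  have hdm : Measurable fun t => ∫⁻ G, ‖gibbsSpin ν v x p t G
      - ∫ G', gibbsSpin ν v x p t G' ∂(gaussianLaw N)‖ₑ ∂(gaussianLaw N) := by
    have h1 : Measurable fun t => ∫ G', gibbsSpin ν v x p t G' ∂(gaussianLaw N) :=
      ((measurable_gibbsSpin x p).stronglyMeasurable.integral_prod_right').measurable
    exact Measurable.lintegral_prod_right' (f := fun q : ℝ × (CoeffIndex N → ℝ) =>
      ‖gibbsSpin ν v x p q.1 q.2 - ∫ G', gibbsSpin ν v x p q.1 G' ∂(gaussianLaw N)‖ₑ)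
      ((measurable_gibbsSpin x p).sub (h1.comp measurable_fst)).enorm
  calc _ ≤ ∫⁻ t in Set.Icc (0 : ℝ) 1, (∫⁻ G, ∫⁻ z,
          ‖scale v p * pSpin G p z - gibbsSpin ν v x p t G‖ₑ
            ∂(gibbs ν v (Function.update x p t) G) ∂(gaussianLaw N)
          + ∫⁻ G, ‖gibbsSpin ν v x p t G
            - ∫ G', gibbsSpin ν v x p t G' ∂(gaussianLaw N)‖ₑ ∂(gaussianLaw N)) := by
        refine lintegral_mono fun t => ?_
        rw [← lintegral_add_right]
        · refine lintegral_mono fun G => ?_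
          calc ∫⁻ z, ‖scale v p * pSpin G p z - meanSpin ν v p (Function.update x p t)‖ₑ
                ∂(gibbs ν v (Function.update x p t) G)
              ≤ ∫⁻ z, (‖scale v p * pSpin G p z - gibbsSpin ν v x p t G‖ₑ
                + ‖gibbsSpin ν v x p t G
                  - ∫ G', gibbsSpin ν v x p t G' ∂(gaussianLaw N)‖ₑ)
                ∂(gibbs ν v (Function.update x p t) G) := by
                refine lintegral_mono fun z => ?_
                refine le_trans (le_of_eq ?_) (enorm_add_le _ _)
                rw [sub_add_sub_cancel]
                rfl
            _ = _ := by
                rw [lintegral_add_right _ measurable_const]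
                simp
        · exact (((measurable_gibbsSpin x p).comp measurable_prodMk_left).sub
            measurable_const).enorm
    _ ≤ ENNReal.ofReal (2 * v)
        + ENNReal.ofReal (3 * (η * δ / 12 * v ^ 2) / δ + 4 * δ * v ^ 2) := by
        rw [lintegral_add_right _ hdm]
        exact add_le_add hth hdis
    _ = ENNReal.ofReal (2 * v + (η / 4 * v ^ 2 + 4 * δ * v ^ 2)) := by
        rw [← ENNReal.ofReal_add (by positivity) (by positivity)]
        congr 2
        field_simp
        ring
    _ ≤ ENNReal.ofReal (η * v ^ 2) := by
        refine ENNReal.ofReal_le_ofReal ?_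
        have h1 : 4 * δ * v ^ 2 ≤ η / 4 * v ^ 2 := by nlinarith [sq_nonneg v]
        nlinarith

end Concentration

/-! ### Averages over disorder and replicas -/

section Average

/-- Bounded measurable real functions. -/
structure BoundedMeasurable {α : Type*} [MeasurableSpace α] (f : α → ℝ) : Prop where
  measurable : Measurable f
  bounded : ∃ B, ∀ a, |f a| ≤ B

namespace BoundedMeasurable

variable {α β : Type*} [MeasurableSpace α] [MeasurableSpace β] {f g : α → ℝ}

lemma const (c : ℝ) : BoundedMeasurable fun _ : α => c := ⟨measurable_const, |c|, fun _ => le_rfl⟩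

lemma add (hf : BoundedMeasurable f) (hg : BoundedMeasurable g) :
    BoundedMeasurable fun a => f a + g a := by
  obtain ⟨B, hB⟩ := hf.bounded
  obtain ⟨C, hC⟩ := hg.bounded
  exact ⟨hf.measurable.add hg.measurable, B + C, fun a =>
    (abs_add_le _ _).trans (add_le_add (hB a) (hC a))⟩

lemma mul (hf : BoundedMeasurable f) (hg : BoundedMeasurable g) :
    BoundedMeasurable fun a => f a * g a := by
  obtain ⟨B, hB⟩ := hf.bounded
  obtain ⟨C, hC⟩ := hg.bounded
  refine ⟨hf.measurable.mul hg.measurable, B * C, fun a => ?_⟩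
  rw [abs_mul]
  exact mul_le_mul (hB a) (hC a) (abs_nonneg _) ((abs_nonneg _).trans (hB a))

lemma const_mul (c : ℝ) (hf : BoundedMeasurable f) : BoundedMeasurable fun a => c * f a :=
  (const c).mul hf

lemma comp (hf : BoundedMeasurable f) {φ : β → α} (hφ : Measurable φ) :
    BoundedMeasurable fun b => f (φ b) := by
  obtain ⟨B, hB⟩ := hf.bounded
  exact ⟨hf.measurable.comp hφ, B, fun b => hB _⟩

lemma integrable (hf : BoundedMeasurable f) (μ : Measure α) [IsFiniteMeasure μ] :
    Integrable f μ := by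
  obtain ⟨B, hB⟩ := hf.bounded
  exact .of_bound hf.measurable.aestronglyMeasurable B (ae_of_all _ hB)

lemma finsetSum {ι : Type*} (s : Finset ι) {f : ι → α → ℝ}
    (hf : ∀ i ∈ s, BoundedMeasurable (f i)) : BoundedMeasurable fun a => ∑ i ∈ s, f i a := by
  classical
  induction s using Finset.induction_on with
  | empty => simpa using const 0
  | insert i s hi ih =>
    simp only [Finset.sum_insert hi]
    exact (hf i (by simp)).add (ih fun j hj => hf j (by simp [hj]))

end BoundedMeasurable

variable {N : ℕ} {ν : Measure (UnitSphere N)} {v : ℝ} {x : ℕ+ → ℝ} {n : ℕ}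
  {f g : (Fin n → UnitSphere N) → ℝ}

lemma boundedMeasurable_overlap {h : ℝ → ℝ} (hh : Continuous h) :
    BoundedMeasurable fun q : UnitSphere N × UnitSphere N => h (overlap q.1 q.2) := by
  obtain ⟨B, hB⟩ := isCompact_Icc.exists_bound_of_continuousOn (s := Set.Icc (-1 : ℝ) 1)
    hh.continuousOn
  exact ⟨hh.measurable.comp measurable_overlap, B, fun q =>
    hB _ (abs_le.1 (abs_overlap_le_one q.1 q.2))⟩

lemma boundedMeasurable_overlap_apply {h : ℝ → ℝ} (hh : Continuous h) (i j : Fin n) :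
    BoundedMeasurable fun z : Fin n → UnitSphere N => h (overlap (z i) (z j)) :=
  (boundedMeasurable_overlap hh).comp (φ := fun z : Fin n → UnitSphere N => (z i, z j))
    (by fun_prop)

/-- The average `E⟨f(z¹, …, zⁿ)⟩` over the Gaussian disorder and `n` replicas, for fixed `x`. -/
noncomputable def avg (ν : Measure (UnitSphere N)) (v : ℝ) (x : ℕ+ → ℝ) {n : ℕ}
    (f : (Fin n → UnitSphere N) → ℝ) : ℝ :=
  ∫ G, ∫ z, f z ∂(replicas ν v x G n) ∂(gaussianLaw N)

lemma avg_const_mul (c : ℝ) (f : (Fin n → UnitSphere N) → ℝ) :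
    avg ν v x (fun z => c * f z) = c * avg ν v x f := by
  simp only [avg, integral_const_mul]

variable [IsProbabilityMeasure ν]

lemma abs_avg_le {B : ℝ} (hB : ∀ z, |f z| ≤ B) : |avg ν v x f| ≤ B :=
  abs_integral_le_of_bound fun _ => abs_integral_le_of_bound hB

lemma avg_const (c : ℝ) : avg ν v x (fun _ : Fin n → UnitSphere N => c) = c := by
  simp [avg]

lemma BoundedMeasurable.integrable_integral (hf : BoundedMeasurable f) :
    Integrable (fun G => ∫ z, f z ∂(replicas ν v x G n)) (gaussianLaw N) := by
  obtain ⟨B, hB⟩ := hf.bounded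
  exact .of_bound (measurable_integral_replicas_right hf.measurable v x).aestronglyMeasurable B
    (ae_of_all _ fun G => abs_integral_le_of_bound hB)

lemma avg_add (hf : BoundedMeasurable f) (hg : BoundedMeasurable g) :
    avg ν v x (fun z => f z + g z) = avg ν v x f + avg ν v x g := by
  simp only [avg]
  rw [← integral_add hf.integrable_integral hg.integrable_integral]
  exact integral_congr_ae (ae_of_all _ fun G => integral_add (hf.integrable _) (hg.integrable _))

lemma avg_finsetSum {ι : Type*} (s : Finset ι) {f : ι → (Fin n → UnitSphere N) → ℝ}
    (hf : ∀ i ∈ s, BoundedMeasurable (f i)) :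
    avg ν v x (fun z => ∑ i ∈ s, f i z) = ∑ i ∈ s, avg ν v x (f i) := by
  classical
  induction s using Finset.induction_on with
  | empty => simpa using avg_const (ν := ν) (v := v) (x := x) (n := n) 0
  | insert i s hi ih =>
    simp only [Finset.sum_insert hi]
    have hs : ∀ j ∈ s, BoundedMeasurable (f j) := fun j hj => hf j (by simp [hj])
    rw [avg_add (hf i (by simp)) (.finsetSum s hs), ih hs]

lemma avg_mono (hf : BoundedMeasurable f) (hg : BoundedMeasurable g) (hfg : ∀ z, f z ≤ g z) :
    avg ν v x f ≤ avg ν v x g :=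
  integral_mono hf.integrable_integral hg.integrable_integral fun _ =>
    integral_mono (hf.integrable _) (hg.integrable _) hfg

lemma measurable_avg (hf : Measurable f) : Measurable fun x => avg ν v x f :=
  ((measurable_integral_replicas (ν := ν) (v := v)
    (hf.comp measurable_snd)).stronglyMeasurable.integral_prod_right').measurable

/-- Averaging over the last of `n + 1` replicas. -/
lemma integral_replicas_succ (G : CoeffIndex N → ℝ) {F : (Fin n → UnitSphere N) × UnitSphere N → ℝ}
    (hF : BoundedMeasurable F) :
    ∫ z, F (fun i => z i.castSucc, z (Fin.last n)) ∂(replicas ν v x G (n + 1))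
      = ∫ z, ∫ w, F (z, w) ∂(gibbs ν v x G) ∂(replicas ν v x G n) := by
  have hmp := measurePreserving_piFinSuccAbove (fun _ : Fin (n + 1) => gibbs ν v x G) (Fin.last n)
  have hcomp : ∀ z : Fin (n + 1) → UnitSphere N, F (fun i => z i.castSucc, z (Fin.last n))
      = (fun q => F (q.2, q.1)) (MeasurableEquiv.piFinSuccAbove
        (fun _ : Fin (n + 1) => UnitSphere N) (Fin.last n) z) := by
    intro z
    simp only [MeasurableEquiv.piFinSuccAbove_apply, Fin.insertNthEquiv_symm_apply]
    congr 2
    ext1 i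
    rw [Fin.removeNth, Fin.succAbove_last]
  simp only [hcomp, replicas]
  rw [hmp.integral_comp' (g := fun q => F (q.2, q.1))]
  exact integral_prod_symm _ ((hF.comp measurable_swap).integrable _)

lemma avg_init (hf : BoundedMeasurable f) :
    avg ν v x (fun z : Fin (n + 1) → UnitSphere N => f fun i => z i.castSucc) = avg ν v x f := by
  refine integral_congr_ae (ae_of_all _ fun G => ?_)
  have h := integral_replicas_succ (ν := ν) (v := v) (x := x) G (hf.comp measurable_fst)
  simpa using h

end Average

/-! ### The Ghirlanda–Guerra identities -/

section GhirlandaGuerra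

variable {N : ℕ} {ν : Measure (UnitSphere N)} {v : ℝ} {x : ℕ+ → ℝ} {n : ℕ}
  {f : (Fin n → UnitSphere N) → ℝ}

instance : IsProbabilityMeasure (volume.restrict (Set.Icc (0 : ℝ) 1)) := ⟨by simp⟩

/-- The law of an i.i.d. sequence of uniform random variables on `[0, 1]`. -/
noncomputable abbrev unifLaw : Measure (ℕ+ → ℝ) :=
  Measure.infinitePi fun _ => volume.restrict (Set.Icc (0 : ℝ) 1)

lemma ae_unifLaw_mem (p : ℕ+) : ∀ᵐ x ∂unifLaw, x p ∈ Set.Icc (0 : ℝ) 1 := by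
  have h := measurePreserving_eval_infinitePi
    (fun _ : ℕ+ => volume.restrict (Set.Icc (0 : ℝ) 1)) p
  exact h.quasiMeasurePreserving.ae (ae_restrict_mem measurableSet_Icc)

lemma ae_unifLaw_abs_le : ∀ᵐ x ∂unifLaw, ∀ p, |x p| ≤ 1 := by
  refine ae_all_iff.2 fun p => (ae_unifLaw_mem p).mono fun x hx => ?_
  rw [abs_of_nonneg hx.1]
  exact hx.2

/-- The defect in the Ghirlanda–Guerra identity for the test function `h` of the overlap: the
identity says that `n E⟨f h(R_{l,n+1})⟩ = E⟨f⟩ E⟨h(R_{1,2})⟩ + ∑_{l' ≠ l} E⟨f h(R_{l,l'})⟩`. -/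
noncomputable def defect (ν : Measure (UnitSphere N)) (v : ℝ) (h : ℝ → ℝ) {n : ℕ} (l : Fin n)
    (f : (Fin n → UnitSphere N) → ℝ) (x : ℕ+ → ℝ) : ℝ :=
  n * avg ν v x (fun z : Fin (n + 1) → UnitSphere N =>
      f (fun i => z i.castSucc) * h (overlap (z l.castSucc) (z (Fin.last n))))
    - avg ν v x f * avg ν v x (fun z : Fin 2 → UnitSphere N => h (overlap (z 0) (z 1)))
    - ∑ l' ∈ Finset.univ.erase l, avg ν v x fun z => f z * h (overlap (z l) (z l'))

lemma boundedMeasurable_succ {h : ℝ → ℝ} (hh : Continuous h) (hf : BoundedMeasurable f)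
    (l : Fin n) : BoundedMeasurable fun z : Fin (n + 1) → UnitSphere N =>
      f (fun i => z i.castSucc) * h (overlap (z l.castSucc) (z (Fin.last n))) :=
  (hf.comp (by fun_prop)).mul (boundedMeasurable_overlap_apply hh _ _)

lemma defect_const_mul (c : ℝ) (h : ℝ → ℝ) (l : Fin n) :
    defect ν v (fun r => c * h r) l f x = c * defect ν v h l f x := by
  simp only [defect, mul_left_comm _ c, avg_const_mul, ← Finset.mul_sum]
  ring

variable [IsProbabilityMeasure ν]

lemma defect_add {h k : ℝ → ℝ} (hh : Continuous h) (hk : Continuous k) (hf : BoundedMeasurable f)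
    (l : Fin n) :
    defect ν v (fun r => h r + k r) l f x = defect ν v h l f x + defect ν v k l f x := by
  simp only [defect, mul_add]
  rw [avg_add (boundedMeasurable_succ hh hf l) (boundedMeasurable_succ hk hf l),
    avg_add (boundedMeasurable_overlap_apply hh _ _) (boundedMeasurable_overlap_apply hk _ _),
    Finset.sum_congr rfl fun l' _ => avg_add (hf.mul (boundedMeasurable_overlap_apply hh l l'))
      (hf.mul (boundedMeasurable_overlap_apply hk l l')), Finset.sum_add_distrib]
  ring

lemma abs_defect_le {h : ℝ → ℝ} {c : ℝ} (hc : ∀ r ∈ Set.Icc (-1 : ℝ) 1, |h r| ≤ c)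
    (hf : ∀ z, |f z| ≤ 1) (l : Fin n) : |defect ν v h l f x| ≤ 2 * n * c := by
  have hov : ∀ z w : UnitSphere N, |h (overlap z w)| ≤ c := fun z w =>
    hc _ (abs_le.1 (abs_overlap_le_one z w))
  have hmul : ∀ (z : Fin n → UnitSphere N) (y w : UnitSphere N),
      |f z * h (overlap y w)| ≤ c := by
    intro z y w
    rw [mul_comm]
    exact abs_mul_le_of_le_one (hov y w) (hf z)
  have hn : (0 : ℝ) < n := by exact_mod_cast l.pos
  have hcard : ((Finset.univ.erase l).card : ℝ) = n - 1 := by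
    rw [Finset.card_erase_of_mem (Finset.mem_univ l), Finset.card_univ, Fintype.card_fin,
      Nat.cast_sub l.pos, Nat.cast_one]
  have h1 : |n * avg ν v x (fun z : Fin (n + 1) → UnitSphere N =>
      f (fun i => z i.castSucc) * h (overlap (z l.castSucc) (z (Fin.last n))))| ≤ n * c := by
    rw [abs_mul, abs_of_pos hn]
    exact mul_le_mul_of_nonneg_left (abs_avg_le fun z => hmul _ _ _) hn.le
  have h2 : |avg ν v x f * avg ν v x (fun z : Fin 2 → UnitSphere N => h (overlap (z 0) (z 1)))|
      ≤ c := by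
    rw [mul_comm]
    exact abs_mul_le_of_le_one (abs_avg_le fun z => hov _ _) (abs_avg_le hf)
  have h3 : |∑ l' ∈ Finset.univ.erase l, avg ν v x fun z => f z * h (overlap (z l) (z l'))|
      ≤ (n - 1) * c := by
    refine (Finset.abs_sum_le_sum_abs _ _).trans ?_
    rw [← hcard, ← nsmul_eq_mul]
    exact Finset.sum_le_card_nsmul _ _ _ fun l' _ => abs_avg_le fun z => hmul _ _ _
  rw [defect]
  refine (abs_sub _ _).trans ((add_le_add ((abs_sub _ _).trans (add_le_add h1 h2)) h3).trans ?_)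
  linarith

lemma measurable_defect {h : ℝ → ℝ} (hh : Continuous h) (hf : BoundedMeasurable f) (l : Fin n) :
    Measurable fun x => defect ν v h l f x := by
  refine Measurable.sub (Measurable.sub ((measurable_avg
    (boundedMeasurable_succ hh hf l).measurable).const_mul _) ((measurable_avg hf.measurable).mul
    (measurable_avg (boundedMeasurable_overlap_apply hh _ _).measurable))) ?_
  exact Finset.measurable_sum _ fun l' _ => measurable_avg
    (hf.mul (boundedMeasurable_overlap_apply hh l l')).measurable

lemma defect_one (hf : BoundedMeasurable f) (l : Fin n) :
    defect ν v (fun _ => 1) l f x = 0 := by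
  simp only [defect, mul_one, avg_init hf, avg_const, Finset.sum_const,
    Finset.card_erase_of_mem (Finset.mem_univ l), Finset.card_univ, Fintype.card_fin, nsmul_eq_mul]
  rw [Nat.cast_sub l.pos]
  push_cast
  ring

/-- The total deviation of `v 2^{-p} g_p` from its mean, under the Gibbs measure and the Gaussian
disorder. -/
noncomputable def deviation (ν : Measure (UnitSphere N)) (v : ℝ) (p : ℕ+) (x : ℕ+ → ℝ) : ℝ≥0∞ :=
  ∫⁻ G, ∫⁻ z, ‖scale v p * pSpin G p z - meanSpin ν v p x‖ₑ ∂(gibbs ν v x G) ∂(gaussianLaw N)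

lemma measurable_deviation (p : ℕ+) : Measurable fun x => deviation ν v p x := by
  have hs : Measurable fun q : ((ℕ+ → ℝ) × (CoeffIndex N → ℝ)) × UnitSphere N =>
      scale v p * pSpin q.1.2 p q.2 := by
    simp only [pSpin_eq]; fun_prop
  have hm : Measurable fun x => meanSpin ν v p x :=
    (measurable_integral_gibbs (ν := ν) (v := v)
      hs).stronglyMeasurable.integral_prod_right'.measurable
  exact (measurable_lintegral_gibbs (ν := ν) (v := v)
    (hs.sub (hm.comp (measurable_fst.comp measurable_fst))).enorm).lintegral_prod_right'

lemma avg_mul_pow_overlap_succ (hf : BoundedMeasurable f) (l : Fin n) (p : ℕ) :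
    avg ν v x (fun z : Fin (n + 1) → UnitSphere N =>
      f (fun i => z i.castSucc) * overlap (z l.castSucc) (z (Fin.last n)) ^ p)
      = ∫ G, ∫ z, f z * ∫ w, overlap (z l) w ^ p ∂(gibbs ν v x G)
            ∂(replicas ν v x G n) ∂(gaussianLaw N) := by
  refine integral_congr_ae (ae_of_all _ fun G => ?_)
  have hF : BoundedMeasurable fun q : (Fin n → UnitSphere N) × UnitSphere N =>
      f q.1 * overlap (q.1 l) q.2 ^ p :=
    (hf.comp measurable_fst).mul ((boundedMeasurable_overlap (continuous_pow p)).comp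
      (φ := fun q : (Fin n → UnitSphere N) × UnitSphere N => (q.1 l, q.2)) (by fun_prop))
  have h := integral_replicas_succ (ν := ν) (v := v) (x := x) G hF
  simpa only [integral_const_mul] using h

lemma avg_pow_overlap (p : ℕ) :
    avg ν v x (fun z : Fin 2 → UnitSphere N => overlap (z 0) (z 1) ^ p)
      = ∫ G, ∫ z, ∫ w, overlap z w ^ p ∂(gibbs ν v x G) ∂(gibbs ν v x G) ∂(gaussianLaw N) := by
  have h := avg_mul_pow_overlap_succ (ν := ν) (v := v) (x := x) (n := 1) (f := fun _ => 1)
    (.const 1) 0 p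
  simp only [one_mul] at h
  refine h.trans (integral_congr_ae (ae_of_all _ fun G => ?_))
  exact integral_replicas_apply 0 (f := fun z => ∫ w, overlap z w ^ p ∂(gibbs ν v x G))
    (StronglyMeasurable.integral_prod_right' (ν := gibbs ν v x G)
      (measurable_overlap.pow_const p).stronglyMeasurable).measurable

/-- Integration by parts expresses the defect for a monomial through the correlation of `f` with
the deviation of the `p`-spin form from its mean. -/
lemma integral_mul_pSpin_sub_meanSpin (hx : ∀ q, |x q| ≤ 2) (p : ℕ+) (hf : BoundedMeasurable f)
    (l : Fin n) :
    ∫ G, ∫ z, f z * (scale v p * pSpin G p (z l) - meanSpin ν v p x)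
        ∂(replicas ν v x G n) ∂(gaussianLaw N)
      = -(scale v p ^ 2 * x p * defect ν v (fun r => r ^ (p : ℕ)) l f x) := by
  obtain ⟨B, hB⟩ := hf.bounded
  have hlm : ∀ G, Measurable fun z : Fin n → UnitSphere N => pSpin G p (z l) := fun G =>
    (measurable_pSpin_right G p).comp (measurable_pi_apply l)
  have hYb : ∀ G, BoundedMeasurable fun z : Fin n → UnitSphere N => pSpin G p (z l) := fun G =>
    ⟨hlm G, _, fun z => abs_pSpin_le G p (z l)⟩
  have hjoint : Measurable fun q : ((ℕ+ → ℝ) × (CoeffIndex N → ℝ)) × (Fin n → UnitSphere N) =>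
      f q.2 * pSpin q.1.2 p (q.2 l) := by
    have := hf.measurable
    simp only [pSpin_eq]; fun_prop
  have hGm : Measurable fun G => ∫ z, f z * pSpin G p (z l) ∂(replicas ν v x G n) := by
    have h := (measurable_integral_replicas (ν := ν) (v := v) hjoint).comp
      (measurable_prodMk_left (x := x))
    exact h
  have hGi : Integrable (fun G => ∫ z, f z * pSpin G p (z l) ∂(replicas ν v x G n))
      (gaussianLaw N) := by
    refine ((integrable_coeffSum p).const_mul B).mono' hGm.aestronglyMeasurable
      (ae_of_all _ fun G => abs_integral_le_of_bound fun z => ?_)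
    rw [abs_mul]
    exact mul_le_mul (hB z) (abs_pSpin_le G p _) (abs_nonneg _) ((abs_nonneg _).trans (hB z))
  have hinner : ∀ G, ∫ z, f z * (scale v p * pSpin G p (z l) - meanSpin ν v p x)
        ∂(replicas ν v x G n)
      = scale v p * ∫ z, f z * pSpin G p (z l) ∂(replicas ν v x G n)
        - meanSpin ν v p x * ∫ z, f z ∂(replicas ν v x G n) := by
    intro G
    rw [← integral_const_mul, ← integral_const_mul, ← integral_sub
      (((hf.mul (hYb G)).const_mul _).integrable _) ((hf.const_mul _).integrable _)]
    exact integral_congr_ae (ae_of_all _ fun z => by simp only; ring)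
  simp only [hinner]
  rw [integral_sub (hGi.const_mul _) (hf.integrable_integral.const_mul _), integral_const_mul,
    -- The term `l' = l` of the sum is `E⟨f⟩`, which cancels against the `1` in `meanSpin_eq`.
    integral_const_mul, integral_replicas_pSpin hx p l hf.measurable hB, meanSpin_eq hx, defect,
    avg_mul_pow_overlap_succ hf, avg_pow_overlap, ← Finset.add_sum_erase _ _ (Finset.mem_univ l)]
  simp only [overlap_self, one_pow, mul_one, avg, scale]
  ring

/-- The deviation of the `p`-spin form controls the defect for the monomial `r ^ p`. -/
lemma enorm_defect_pow_le (hx : ∀ q, |x q| ≤ 1) (p : ℕ+) (hfm : Measurable f) (hf : ∀ z, |f z| ≤ 1)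
    (l : Fin n) {κ : ℝ} (hκ : 0 < κ) (hκx : κ < x p) (hv : 1 ≤ v) :
    ‖defect ν v (fun r => r ^ (p : ℕ)) l f x‖ₑ
      ≤ ENNReal.ofReal (1 / (scale v p ^ 2 * κ)) * deviation ν v p x := by
  have hs := scale_pos hv p
  have hbm : BoundedMeasurable f := ⟨hfm, 1, hf⟩
  have key := integral_mul_pSpin_sub_meanSpin (ν := ν) (v := v)
    (fun q => (hx q).trans one_le_two) p hbm l
  have h1 : ‖scale v p ^ 2 * x p * defect ν v (fun r => r ^ (p : ℕ)) l f x‖ₑ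
      ≤ deviation ν v p x := by
    rw [← enorm_neg, ← key]
    refine (enorm_integral_le_lintegral_enorm _).trans (lintegral_mono fun G => ?_)
    refine (enorm_integral_le_lintegral_enorm _).trans ?_
    have hm : Measurable fun z : UnitSphere N => ‖scale v p * pSpin G p z - meanSpin ν v p x‖ₑ :=
      (((measurable_pSpin_right G p).const_mul _).sub_const _).enorm
    have hmp := measurePreserving_eval (fun _ : Fin n => gibbs ν v x G) l
    rw [← hmp.lintegral_comp hm]
    refine lintegral_mono fun z => ?_
    rw [enorm_mul]
    refine mul_le_of_le_one_left zero_le ?_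
    rw [Real.enorm_eq_ofReal_abs]
    exact ENNReal.ofReal_le_one.2 (hf z)
  have h2 : (1 : ℝ≥0∞) ≤ ENNReal.ofReal (1 / (scale v p ^ 2 * κ)) * ‖scale v p ^ 2 * x p‖ₑ := by
    have hxp : 0 < x p := hκ.trans hκx
    rw [Real.enorm_eq_ofReal_abs, abs_of_pos (by positivity), ← ENNReal.ofReal_mul (by positivity),
      ENNReal.one_le_ofReal, one_div_mul_eq_div, one_le_div (by positivity)]
    gcongr
  calc ‖defect ν v (fun r => r ^ (p : ℕ)) l f x‖ₑ
      ≤ ENNReal.ofReal (1 / (scale v p ^ 2 * κ)) * ‖scale v p ^ 2 * x p‖ₑ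
        * ‖defect ν v (fun r => r ^ (p : ℕ)) l f x‖ₑ := le_mul_of_one_le_left zero_le h2
    _ = ENNReal.ofReal (1 / (scale v p ^ 2 * κ))
        * ‖scale v p ^ 2 * x p * defect ν v (fun r => r ^ (p : ℕ)) l f x‖ₑ := by
        rw [mul_assoc, ← enorm_mul]
    _ ≤ _ := by gcongr

lemma exists_lintegral_deviation_le (p : ℕ+) {η : ℝ} (hη : 0 < η) :
    ∃ v₁ : ℝ, 1 ≤ v₁ ∧ ∀ v, v₁ ≤ v → ∀ (N : ℕ) (ν : Measure (UnitSphere N))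
      [IsProbabilityMeasure ν], ∫⁻ x, deviation ν v p x ∂unifLaw ≤ ENNReal.ofReal (η * v ^ 2) := by
  obtain ⟨v₁, hv₁, h⟩ := exists_lintegral_pSpin_sub_le p hη
  refine ⟨v₁, hv₁, fun v hv N ν _ => ?_⟩
  have hmap := map_update_infinitePi (fun _ : ℕ+ => volume.restrict (Set.Icc (0 : ℝ) 1)) p
  have hm := measurable_deviation (ν := ν) (v := v) p
  calc ∫⁻ x, deviation ν v p x ∂unifLaw
      = ∫⁻ q, deviation ν v p (Function.update q.1 p q.2)
          ∂(unifLaw.prod (volume.restrict (Set.Icc (0 : ℝ) 1))) := by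
        rw [← lintegral_map hm (measurable_update_prod p), hmap]
    _ = ∫⁻ x, (∫⁻ t in Set.Icc (0 : ℝ) 1, deviation ν v p (Function.update x p t)) ∂unifLaw :=
        lintegral_prod _ (hm.comp (measurable_update_prod p)).aemeasurable
    _ ≤ ∫⁻ _, ENNReal.ofReal (η * v ^ 2) ∂unifLaw :=
        lintegral_mono_ae (ae_unifLaw_abs_le.mono fun x hx => h v hv N ν x hx)
    _ = _ := by simp

/-- The Ghirlanda–Guerra identities for the test function `h` hold asymptotically: on average over
`x`, the defect tends to `0` as `v → ∞`, uniformly in the dimension, the reference measure and the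
function of the replicas. -/
def AsymptoticIdentity (h : ℝ → ℝ) : Prop :=
  ∀ n : ℕ, ∀ η > 0, ∃ v₁ : ℝ, 1 ≤ v₁ ∧ ∀ v, v₁ ≤ v → ∀ (N : ℕ) (ν : Measure (UnitSphere N))
    [IsProbabilityMeasure ν] (f : (Fin n → UnitSphere N) → ℝ) (l : Fin n), Measurable f →
    (∀ z, |f z| ≤ 1) → ∫⁻ x, ‖defect ν v h l f x‖ₑ ∂unifLaw ≤ ENNReal.ofReal η

lemma asymptoticIdentity_pow (p : ℕ+) : AsymptoticIdentity fun r => r ^ (p : ℕ) := by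
  intro n η hη
  -- The deviation controls the defect only when `x p` is bounded below. The event `x p ≤ κ` has
  -- probability `κ`, and there the trivial bound `2 n` for the defect suffices.
  set κ : ℝ := η / (2 * (2 * n + 1)) with hκ
  have hκ0 : 0 < κ := by positivity
  set c : ℝ := (2 : ℝ)⁻¹ ^ (p : ℕ) with hc
  have hc0 : 0 < c := by positivity
  obtain ⟨v₁, hv₁, hdev⟩ := exists_lintegral_deviation_le p (η := η / 2 * (c ^ 2 * κ))
    (by positivity)
  refine ⟨v₁, hv₁, fun v hv N ν _ f l hfm hf => ?_⟩
  have hv1 : 1 ≤ v := hv₁.trans hv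
  have hset : MeasurableSet {x : ℕ+ → ℝ | x p ≤ κ} :=
    measurableSet_le (measurable_pi_apply p) measurable_const
  have hpt : ∀ᵐ x ∂unifLaw, ‖defect ν v (fun r => r ^ (p : ℕ)) l f x‖ₑ
      ≤ {x : ℕ+ → ℝ | x p ≤ κ}.indicator (fun _ => ENNReal.ofReal (2 * n)) x
        + ENNReal.ofReal (1 / (scale v p ^ 2 * κ)) * deviation ν v p x := by
    filter_upwards [ae_unifLaw_abs_le] with x hx
    by_cases hxp : x p ≤ κ
    · rw [Set.indicator_of_mem (by exact hxp)]
      refine le_add_right ?_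
      rw [Real.enorm_eq_ofReal_abs]
      refine ENNReal.ofReal_le_ofReal ?_
      have h := abs_defect_le (ν := ν) (v := v) (x := x) (f := f) (h := fun r => r ^ (p : ℕ))
        (c := 1) (fun r hr => by
          rw [abs_pow]; exact pow_le_one₀ (abs_nonneg _) (abs_le.2 hr)) hf l
      simpa using h
    · exact le_add_left (enorm_defect_pow_le hx p hfm hf l hκ0 (not_le.1 hxp) hv1)
  have hmeas : unifLaw {x : ℕ+ → ℝ | x p ≤ κ} ≤ ENNReal.ofReal κ := by
    have h := (measurePreserving_eval_infinitePi
      (fun _ : ℕ+ => volume.restrict (Set.Icc (0 : ℝ) 1)) p).measure_preimage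
      measurableSet_Iic.nullMeasurableSet (s := Set.Iic κ)
    refine (le_of_eq h).trans ?_
    rw [Measure.restrict_apply measurableSet_Iic]
    refine (measure_mono (t := Set.Icc 0 κ) fun t ht => ⟨ht.2.1, ht.1⟩).trans ?_
    simp
  calc ∫⁻ x, ‖defect ν v (fun r => r ^ (p : ℕ)) l f x‖ₑ ∂unifLaw
      ≤ ENNReal.ofReal (2 * n) * unifLaw {x : ℕ+ → ℝ | x p ≤ κ}
        + ENNReal.ofReal (1 / (scale v p ^ 2 * κ)) * ∫⁻ x, deviation ν v p x ∂unifLaw := by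
        refine (lintegral_mono_ae hpt).trans (le_of_eq ?_)
        rw [lintegral_add_left (measurable_const.indicator hset), lintegral_indicator_const hset,
          lintegral_const_mul _ (measurable_deviation p)]
    _ ≤ ENNReal.ofReal (2 * n) * ENNReal.ofReal κ + ENNReal.ofReal (1 / (scale v p ^ 2 * κ))
          * ENNReal.ofReal (η / 2 * (c ^ 2 * κ) * v ^ 2) := by
        gcongr
        exact hdev v hv N ν
    _ = ENNReal.ofReal (2 * n * κ + η / 2) := by
        have hs := scale_pos hv1 p
        rw [← ENNReal.ofReal_mul (by positivity), ← ENNReal.ofReal_mul (by positivity),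
          ← ENNReal.ofReal_add (by positivity) (by positivity)]
        congr 2
        rw [scale, ← hc]
        field_simp
    _ ≤ ENNReal.ofReal η := by
        refine ENNReal.ofReal_le_ofReal ?_
        have : 2 * n * κ ≤ η / 2 := by
          rw [hκ, ← mul_div_assoc, div_le_iff₀ (by positivity)]
          nlinarith
        linarith

lemma AsymptoticIdentity.const_mul {h : ℝ → ℝ} (hA : AsymptoticIdentity h) (c : ℝ) :
    AsymptoticIdentity fun r => c * h r := by
  intro n η hη
  obtain ⟨v₁, hv₁, H⟩ := hA n (η / (|c| + 1)) (by positivity)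
  refine ⟨v₁, hv₁, fun v hv N ν _ f l hfm hf => ?_⟩
  simp only [defect_const_mul, enorm_mul]
  rw [lintegral_const_mul' _ _ enorm_ne_top]
  refine (mul_le_mul_right (H v hv N ν f l hfm hf) _).trans ?_
  rw [Real.enorm_eq_ofReal_abs, ← ENNReal.ofReal_mul (abs_nonneg _)]
  refine ENNReal.ofReal_le_ofReal ?_
  rw [← mul_div_assoc, div_le_iff₀ (by positivity)]
  nlinarith

lemma AsymptoticIdentity.add {h k : ℝ → ℝ} (hA : AsymptoticIdentity h) (kA : AsymptoticIdentity k)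
    (hh : Continuous h) (hk : Continuous k) : AsymptoticIdentity fun r => h r + k r := by
  intro n η hη
  obtain ⟨v₁, hv₁, H⟩ := hA n (η / 2) (by positivity)
  obtain ⟨v₂, hv₂, K⟩ := kA n (η / 2) (by positivity)
  refine ⟨max v₁ v₂, hv₁.trans (le_max_left _ _), fun v hv N ν _ f l hfm hf => ?_⟩
  have hbm : BoundedMeasurable f := ⟨hfm, 1, hf⟩
  calc ∫⁻ x, ‖defect ν v (fun r => h r + k r) l f x‖ₑ ∂unifLaw
      ≤ ∫⁻ x, (‖defect ν v h l f x‖ₑ + ‖defect ν v k l f x‖ₑ) ∂unifLaw := by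
        refine lintegral_mono fun x => ?_
        rw [defect_add hh hk hbm]
        exact enorm_add_le _ _
    _ ≤ ENNReal.ofReal (η / 2) + ENNReal.ofReal (η / 2) := by
        rw [lintegral_add_left (measurable_defect hh hbm l).enorm]
        exact add_le_add (H v ((le_max_left _ _).trans hv) N ν f l hfm hf)
          (K v ((le_max_right _ _).trans hv) N ν f l hfm hf)
    _ = ENNReal.ofReal η := by
        rw [← ENNReal.ofReal_add (by positivity) (by positivity), add_halves]

lemma asymptoticIdentity_one : AsymptoticIdentity fun _ => 1 := by
  intro n η hη
  refine ⟨1, le_rfl, fun v hv N ν _ f l hfm hf => ?_⟩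
  simp [defect_one ⟨hfm, 1, hf⟩]

lemma asymptoticIdentity_polynomial (q : Polynomial ℝ) : AsymptoticIdentity fun r => q.eval r := by
  induction q using Polynomial.induction_on' with
  | add q₁ q₂ h₁ h₂ =>
    simp only [Polynomial.eval_add]
    exact h₁.add h₂ q₁.continuous q₂.continuous
  | monomial p c =>
    simp only [Polynomial.eval_monomial]
    refine AsymptoticIdentity.const_mul ?_ c
    rcases Nat.eq_zero_or_pos p with rfl | hp
    · simpa using asymptoticIdentity_one
    · exact asymptoticIdentity_pow ⟨p, hp⟩

/-- The Ghirlanda–Guerra identities hold asymptotically for every continuous test function. -/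
lemma asymptoticIdentity_of_continuous {h : ℝ → ℝ} (hh : Continuous h) : AsymptoticIdentity h := by
  intro n η hη
  obtain ⟨q, hq⟩ := exists_polynomial_near_of_continuousOn (-1) 1 h hh.continuousOn
    (η / (2 * (2 * n + 1))) (by positivity)
  obtain ⟨v₁, hv₁, H⟩ := asymptoticIdentity_polynomial q n (η / 2) (by positivity)
  refine ⟨v₁, hv₁, fun v hv N ν _ f l hfm hf => ?_⟩
  have hbm : BoundedMeasurable f := ⟨hfm, 1, hf⟩
  have hdec : h = fun r => q.eval r + (h r - q.eval r) := by ext; ring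
  calc ∫⁻ x, ‖defect ν v h l f x‖ₑ ∂unifLaw
      ≤ ∫⁻ x, (‖defect ν v (fun r => q.eval r) l f x‖ₑ + ENNReal.ofReal (η / 2)) ∂unifLaw := by
        refine lintegral_mono fun x => ?_
        rw [hdec, defect_add (k := fun r => h r - q.eval r) q.continuous (by fun_prop) hbm]
        refine (enorm_add_le _ _).trans (add_le_add le_rfl ?_)
        rw [Real.enorm_eq_ofReal_abs]
        refine ENNReal.ofReal_le_ofReal ((abs_defect_le (c := η / (2 * (2 * n + 1)))
          (fun r hr => ?_) hf l).trans ?_)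
        · rw [abs_sub_comm]
          exact (hq r hr).le
        · rw [← mul_div_assoc, div_le_div_iff₀ (by positivity) (by positivity)]
          nlinarith
    _ ≤ ENNReal.ofReal (η / 2) + ENNReal.ofReal (η / 2) := by
        rw [lintegral_add_right _ measurable_const]
        simpa using H v hv N ν f l hfm hf
    _ = ENNReal.ofReal η := by
        rw [← ENNReal.ofReal_add (by positivity) (by positivity), add_halves]

end GhirlandaGuerra

/-! ### Replicas with negative overlaps -/

section Negative

variable {N : ℕ} {ν : Measure (UnitSphere N)} {v : ℝ} {x : ℕ+ → ℝ} {n : ℕ} {ε : ℝ}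

/-- Thresholds increasing from `-ε` towards `-ε / 2`. -/
noncomputable def threshold (ε : ℝ) (n : ℕ) : ℝ := -(ε / 2) - ε / 2 / (n + 1)

/-- A continuous function of the overlap equal to `1` below the `n`-th threshold and to `0` above
the next one. -/
noncomputable def cutoff (ε : ℝ) (n : ℕ) (r : ℝ) : ℝ :=
  max 0 (min 1 ((threshold ε (n + 1) - r) / (threshold ε (n + 1) - threshold ε n)))

lemma threshold_lt_succ (hε : 0 < ε) (n : ℕ) : threshold ε n < threshold ε (n + 1) := by
  unfold threshold
  have : ε / 2 / ((n + 1 : ℕ) + 1 : ℝ) < ε / 2 / (n + 1) := by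
    push_cast
    exact div_lt_div_of_pos_left (by positivity) (by positivity) (by linarith)
  linarith

lemma neg_le_threshold (hε : 0 < ε) (n : ℕ) : -ε ≤ threshold ε n := by
  unfold threshold
  have : ε / 2 / ((n : ℝ) + 1) ≤ ε / 2 :=
    div_le_self (by positivity) (by linarith [n.cast_nonneg (α := ℝ)])
  linarith

lemma threshold_le (hε : 0 < ε) (n : ℕ) : threshold ε n ≤ -(ε / 2) := by
  unfold threshold
  have : 0 ≤ ε / 2 / ((n : ℝ) + 1) := by positivity
  linarith

lemma continuous_cutoff (ε : ℝ) (n : ℕ) : Continuous (cutoff ε n) := by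
  unfold cutoff; fun_prop

lemma cutoff_nonneg (ε : ℝ) (n : ℕ) (r : ℝ) : 0 ≤ cutoff ε n r := le_max_left _ _

lemma cutoff_le_one (ε : ℝ) (n : ℕ) (r : ℝ) : cutoff ε n r ≤ 1 :=
  max_le zero_le_one (min_le_left _ _)

lemma cutoff_eq_one (hε : 0 < ε) {r : ℝ} (hr : r ≤ threshold ε n) : cutoff ε n r = 1 := by
  have h := threshold_lt_succ hε n
  have h1 : 1 ≤ (threshold ε (n + 1) - r) / (threshold ε (n + 1) - threshold ε n) := by
    rw [one_le_div (by linarith)]; linarith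
  rw [cutoff, min_eq_left h1, max_eq_right zero_le_one]

lemma le_threshold_of_cutoff_ne_zero (hε : 0 < ε) {r : ℝ} (hr : cutoff ε n r ≠ 0) :
    r ≤ threshold ε (n + 1) := by
  by_contra! hcon
  refine hr (max_eq_left ((min_le_right _ _).trans ?_))
  exact div_nonpos_of_nonpos_of_nonneg (by linarith) (by linarith [threshold_lt_succ hε n])

/-- A weight on `n`-tuples that vanishes unless all overlaps lie below the `n`-th threshold. It is
built one replica at a time. -/
noncomputable def weight (N : ℕ) (ε : ℝ) : (n : ℕ) → (Fin n → UnitSphere N) → ℝ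
  | 0, _ => 1
  | n + 1, z => weight N ε n (fun i => z i.castSucc)
      * ∏ l : Fin n, cutoff ε n (overlap (z l.castSucc) (z (Fin.last n)))

lemma weight_mem_Icc (n : ℕ) (z : Fin n → UnitSphere N) : weight N ε n z ∈ Set.Icc 0 1 := by
  induction n with
  | zero => simp [weight]
  | succ n ih =>
    have h := ih fun i => z i.castSucc
    have h0 : 0 ≤ ∏ l : Fin n, cutoff ε n (overlap (z l.castSucc) (z (Fin.last n))) :=
      Finset.prod_nonneg fun l _ => cutoff_nonneg _ _ _
    have h1 : ∏ l : Fin n, cutoff ε n (overlap (z l.castSucc) (z (Fin.last n))) ≤ 1 :=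
      Finset.prod_le_one (fun l _ => cutoff_nonneg _ _ _) fun l _ => cutoff_le_one _ _ _
    exact ⟨mul_nonneg h.1 h0, mul_le_one₀ h.2 h0 h1⟩

lemma abs_weight_le_one (n : ℕ) (z : Fin n → UnitSphere N) : |weight N ε n z| ≤ 1 := by
  rw [abs_of_nonneg (weight_mem_Icc n z).1]
  exact (weight_mem_Icc n z).2

lemma boundedMeasurable_weight (n : ℕ) : BoundedMeasurable (weight N ε n) := by
  refine ⟨?_, 1, abs_weight_le_one n⟩
  induction n with
  | zero => exact measurable_const
  | succ n ih =>
    exact (ih.comp (by fun_prop)).mul (Finset.measurable_prod _ fun l _ =>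
      (boundedMeasurable_overlap_apply (continuous_cutoff ε n) _ _).measurable)

lemma overlap_comm (z w : UnitSphere N) : overlap z w = overlap w z := real_inner_comm _ _

lemma overlap_le_of_weight_ne_zero (hε : 0 < ε) {z : Fin n → UnitSphere N}
    (hz : weight N ε n z ≠ 0) {i j : Fin n} (hij : i ≠ j) :
    overlap (z i) (z j) ≤ threshold ε n := by
  induction n with
  | zero => exact i.elim0
  | succ n ih =>
    obtain ⟨h1, h2⟩ := mul_ne_zero_iff.1 hz
    have hlast : ∀ l : Fin n, overlap (z l.castSucc) (z (Fin.last n)) ≤ threshold ε (n + 1) :=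
      fun l => le_threshold_of_cutoff_ne_zero hε (Finset.prod_ne_zero_iff.1 h2 l (Finset.mem_univ l))
    induction i using Fin.lastCases with
    | last =>
      induction j using Fin.lastCases with
      | last => exact absurd rfl hij
      | cast j => rw [overlap_comm]; exact hlast j
    | cast i =>
      induction j using Fin.lastCases with
      | last => exact hlast i
      | cast j =>
        exact (ih h1 fun h => hij (congrArg _ h)).trans (threshold_lt_succ hε n).le

lemma weight_mul_cutoff (hε : 0 < ε) (z : Fin n → UnitSphere N) {i j : Fin n} (hij : i ≠ j) :
    weight N ε n z * cutoff ε n (overlap (z i) (z j)) = weight N ε n z := by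
  by_cases hz : weight N ε n z = 0
  · simp [hz]
  · rw [cutoff_eq_one hε (overlap_le_of_weight_ne_zero hε hz hij), mul_one]

/-- There is no large family of unit vectors with pairwise overlaps below a negative constant. -/
lemma weight_eq_zero (hε : 0 < ε) (hn : 1 < n * (ε / 2)) (z : Fin (n + 1) → UnitSphere N) :
    weight N ε (n + 1) z = 0 := by
  by_contra hz
  have hij : ∀ i j, i ≠ j → overlap (z i) (z j) ≤ -(ε / 2) := fun i j h =>
    (overlap_le_of_weight_ne_zero hε hz h).trans (threshold_le hε _)
  have hnonneg : 0 ≤ ∑ i, ∑ j, overlap (z i) (z j) := by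
    have h := real_inner_self_nonneg (x := ∑ i, (z i : EuclideanSpace ℝ (Fin N)))
    simp only [sum_inner, inner_sum] at h
    rw [Finset.sum_comm] at h
    exact h
  have hrow : ∀ i, ∑ j, overlap (z i) (z j) ≤ 1 - n * (ε / 2) := by
    intro i
    rw [← Finset.add_sum_erase _ _ (Finset.mem_univ i), overlap_self]
    have h := Finset.sum_le_card_nsmul (Finset.univ.erase i) (fun j => overlap (z i) (z j))
      (-(ε / 2)) fun j hj => hij i j (Finset.ne_of_mem_erase hj).symm
    rw [Finset.card_erase_of_mem (Finset.mem_univ i), Finset.card_univ, Fintype.card_fin,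
      Nat.add_sub_cancel, nsmul_eq_mul] at h
    linarith
  have hsum := Finset.sum_lt_sum_of_nonempty (s := Finset.univ) Finset.univ_nonempty
    fun i _ => (hrow i).trans_lt (sub_neg.2 hn)
  simp only [Finset.sum_const_zero] at hsum
  linarith

/-- The probability `E⟨1(R_{1,2} ≤ -ε)⟩` of a negative overlap, for fixed `x`. -/
noncomputable def negProb (ν : Measure (UnitSphere N)) (v ε : ℝ) (x : ℕ+ → ℝ) : ℝ :=
  avg ν v x fun z : Fin 2 → UnitSphere N => (Set.Iic (-ε)).indicator 1 (overlap (z 0) (z 1))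

lemma boundedMeasurable_indicator_overlap (ε : ℝ) :
    BoundedMeasurable fun z : Fin 2 → UnitSphere N =>
      (Set.Iic (-ε)).indicator (1 : ℝ → ℝ) (overlap (z 0) (z 1)) := by
  refine ⟨?_, 1, fun z => ?_⟩
  · have hs : Measurable fun z : Fin 2 → UnitSphere N => (z 0, z 1) := by fun_prop
    have h1 : Measurable ((Set.Iic (-ε)).indicator (1 : ℝ → ℝ)) :=
      measurable_one.indicator measurableSet_Iic
    have h := h1.comp (measurable_overlap.comp hs)
    exact h
  · by_cases h : overlap (z 0) (z 1) ∈ Set.Iic (-ε) <;> simp [h]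

variable [IsProbabilityMeasure ν]

lemma negProb_mem_Icc (ε : ℝ) (x : ℕ+ → ℝ) : negProb ν v ε x ∈ Set.Icc 0 1 := by
  refine ⟨integral_nonneg fun G => integral_nonneg fun z =>
    Set.indicator_nonneg (fun _ _ => zero_le_one) _, (le_abs_self _).trans (abs_avg_le fun z => ?_)⟩
  by_cases h : overlap (z 0) (z 1) ∈ Set.Iic (-ε) <;> simp [h]

lemma measurable_negProb (ε : ℝ) : Measurable fun x => negProb ν v ε x :=
  measurable_avg (boundedMeasurable_indicator_overlap ε).measurable

lemma negProb_le_avg_cutoff (hε : 0 < ε) (n : ℕ) : negProb ν v ε x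
    ≤ avg ν v x fun z : Fin 2 → UnitSphere N => cutoff ε n (overlap (z 0) (z 1)) := by
  refine avg_mono (boundedMeasurable_indicator_overlap ε)
    (boundedMeasurable_overlap_apply (continuous_cutoff ε n) _ _) fun z => ?_
  by_cases h : overlap (z 0) (z 1) ∈ Set.Iic (-ε)
  · rw [cutoff_eq_one hε (le_trans h (neg_le_threshold hε n))]
    simp [h]
  · simpa [h] using cutoff_nonneg _ _ _

lemma measurable_avg_weight (n : ℕ) : Measurable fun x => avg ν v x (weight N ε n) :=
  measurable_avg (boundedMeasurable_weight n).measurable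

/-- A union bound for a product of numbers in `[0, 1]`. -/
lemma sum_sub_le_prod {ι : Type*} (s : Finset ι) {a : ι → ℝ} (h0 : ∀ i, 0 ≤ a i)
    (h1 : ∀ i, a i ≤ 1) : ∑ i ∈ s, a i - (s.card - 1) ≤ ∏ i ∈ s, a i := by
  classical
  induction s using Finset.induction_on with
  | empty => simp
  | insert i s hi ih =>
    rw [Finset.sum_insert hi, Finset.prod_insert hi, Finset.card_insert_of_notMem hi]
    push_cast
    have hp : ∏ j ∈ s, a j ≤ 1 := Finset.prod_le_one (fun j _ => h0 j) fun j _ => h1 j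
    nlinarith [mul_nonneg (sub_nonneg.2 (h1 i)) (sub_nonneg.2 hp)]

/-- The Ghirlanda–Guerra identities allow adding a replica: given replicas whose overlaps are all
negative, a further one has negative overlaps with all of them with probability at least that of a
negative overlap, up to the defects. -/
lemma avg_weight_succ_ge (hε : 0 < ε) {n : ℕ} (hn : n ≠ 0) :
    negProb ν v ε x * avg ν v x (weight N ε n)
      - ∑ l, |defect ν v (cutoff ε n) l (weight N ε n) x|
      ≤ avg ν v x (weight N ε (n + 1)) := by
  have hn1 : (1 : ℝ) ≤ n := by exact_mod_cast Nat.one_le_iff_ne_zero.2 hn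
  set w := avg ν v x (weight N ε n) with hw
  have hw0 : 0 ≤ w := integral_nonneg fun G => integral_nonneg fun z => (weight_mem_Icc n z).1
  set c := avg ν v x fun z : Fin 2 → UnitSphere N => cutoff ε n (overlap (z 0) (z 1)) with hc
  have hψ := continuous_cutoff ε n
  have hW := boundedMeasurable_weight (N := N) (ε := ε) n
  set T : Fin n → ℝ := fun l => avg ν v x fun z : Fin (n + 1) → UnitSphere N =>
    weight N ε n (fun i => z i.castSucc) * cutoff ε n (overlap (z l.castSucc) (z (Fin.last n)))
    with hT
  have hdef : ∀ l, n * T l = defect ν v (cutoff ε n) l (weight N ε n) x + w * c + (n - 1) * w := by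
    intro l
    have hcard : ((Finset.univ.erase l).card : ℝ) = n - 1 := by
      rw [Finset.card_erase_of_mem (Finset.mem_univ l), Finset.card_univ, Fintype.card_fin,
        Nat.cast_sub l.pos, Nat.cast_one]
    have hsum : ∑ l' ∈ Finset.univ.erase l, avg ν v x (fun z =>
        weight N ε n z * cutoff ε n (overlap (z l) (z l'))) = (n - 1) * w := by
      rw [← hcard, ← nsmul_eq_mul, ← Finset.sum_const]
      refine Finset.sum_congr rfl fun l' hl' => ?_
      simp only [weight_mul_cutoff hε _ (Finset.ne_of_mem_erase hl').symm]
      rfl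
    rw [defect, hsum]
    ring
  have hlow : ∑ l, T l - (n - 1) * w ≤ avg ν v x (weight N ε (n + 1)) := by
    have hb : ∀ l ∈ (Finset.univ : Finset (Fin n)), BoundedMeasurable
        fun z : Fin (n + 1) → UnitSphere N => weight N ε n (fun i => z i.castSucc)
          * cutoff ε n (overlap (z l.castSucc) (z (Fin.last n))) := fun l _ =>
      boundedMeasurable_succ hψ hW l
    have hb0 : BoundedMeasurable fun z : Fin (n + 1) → UnitSphere N =>
        weight N ε n (fun i => z i.castSucc) := hW.comp (by fun_prop)
    have h := avg_mono (ν := ν) (v := v) (x := x)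
      ((BoundedMeasurable.finsetSum Finset.univ hb).add (hb0.const_mul (-((n : ℝ) - 1))))
      (boundedMeasurable_weight (n + 1)) fun z => by
        have h1 := sum_sub_le_prod Finset.univ
          (a := fun l : Fin n => cutoff ε n (overlap (z l.castSucc) (z (Fin.last n))))
          (fun l => cutoff_nonneg _ _ _) (fun l => cutoff_le_one _ _ _)
        rw [Finset.card_univ, Fintype.card_fin] at h1
        have h2 := mul_le_mul_of_nonneg_left h1 (weight_mem_Icc (ε := ε) n fun i => z i.castSucc).1
        rw [mul_sub, Finset.mul_sum] at h2
        rw [weight]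
        linarith
    rw [avg_add (.finsetSum _ hb) (hb0.const_mul _), avg_finsetSum _ hb, avg_const_mul,
      avg_init hW] at h
    linarith
  have hsum : n * ∑ l, T l = ∑ l, defect ν v (cutoff ε n) l (weight N ε n) x
      + n * (w * c) + n * ((n - 1) * w) := by
    rw [Finset.mul_sum, Finset.sum_congr rfl fun l _ => hdef l, Finset.sum_add_distrib,
      Finset.sum_add_distrib]
    simp
  have habs := neg_abs_le (∑ l, defect ν v (cutoff ε n) l (weight N ε n) x)
  have habs' := Finset.abs_sum_le_sum_abs
    (fun l => defect ν v (cutoff ε n) l (weight N ε n) x) Finset.univ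
  have hD0 : 0 ≤ ∑ l, |defect ν v (cutoff ε n) l (weight N ε n) x| :=
    Finset.sum_nonneg fun l _ => abs_nonneg _
  have hac : negProb ν v ε x * w ≤ w * c := by
    rw [mul_comm]; exact mul_le_mul_of_nonneg_left (negProb_le_avg_cutoff hε n) hw0
  have h3 : w * c - ∑ l, |defect ν v (cutoff ε n) l (weight N ε n) x|
      ≤ ∑ l, T l - (n - 1) * w := by
    nlinarith
  linarith

/-- On average over `x`, the probability that `k + 1` replicas have negative overlaps is
asymptotically at least the `k`-th power of the probability of a negative overlap. -/
lemma exists_lintegral_negProb_pow_sub_le (hε : 0 < ε) (k : ℕ) {η : ℝ} (hη : 0 < η) :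
    ∃ v₁ : ℝ, 1 ≤ v₁ ∧ ∀ v, v₁ ≤ v → ∀ (N : ℕ) (ν : Measure (UnitSphere N))
      [IsProbabilityMeasure ν], ∫⁻ x, ENNReal.ofReal
        (negProb ν v ε x ^ k - avg ν v x (weight N ε (k + 1))) ∂unifLaw ≤ ENNReal.ofReal η := by
  induction k generalizing η with
  | zero =>
    refine ⟨1, le_rfl, fun v _ N ν _ => ?_⟩
    have h : weight N ε 1 = fun _ => 1 := by ext z; simp [weight]
    simp [h, avg_const]
  | succ k ih =>
    obtain ⟨v₁, hv₁, H⟩ := ih (η := η / 2) (by positivity)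
    obtain ⟨v₂, hv₂, K⟩ := asymptoticIdentity_of_continuous (continuous_cutoff ε (k + 1)) (k + 1)
      (η / 2 / (k + 1)) (by positivity)
    refine ⟨max v₁ v₂, hv₁.trans (le_max_left _ _), fun v hv N ν _ => ?_⟩
    have hpt : ∀ x, ENNReal.ofReal (negProb ν v ε x ^ (k + 1) - avg ν v x (weight N ε (k + 1 + 1)))
        ≤ ENNReal.ofReal (negProb ν v ε x ^ k - avg ν v x (weight N ε (k + 1)))
          + ∑ l, ‖defect ν v (cutoff ε (k + 1)) l (weight N ε (k + 1)) x‖ₑ := by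
      intro x
      have h := avg_weight_succ_ge (ν := ν) (v := v) (x := x) hε (n := k + 1) k.succ_ne_zero
      obtain ⟨ha0, ha1⟩ := negProb_mem_Icc (ν := ν) (v := v) ε x
      set a := negProb ν v ε x
      set w := avg ν v x (weight N ε (k + 1))
      have hpos : ENNReal.ofReal (a ^ k - w) = ENNReal.ofReal (max (a ^ k - w) 0) := by simp
      simp only [Real.enorm_eq_ofReal_abs]
      rw [← ENNReal.ofReal_sum_of_nonneg fun l _ => abs_nonneg _, hpos,
        ← ENNReal.ofReal_add (le_max_right _ _) (Finset.sum_nonneg fun l _ => abs_nonneg _)]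
      refine ENNReal.ofReal_le_ofReal ?_
      -- The positive part is needed because `a ^ k - w` may be negative.
      have h1 : a * (a ^ k - w) ≤ max (a ^ k - w) 0 :=
        (mul_le_mul_of_nonneg_left (le_max_left _ 0) ha0).trans
          (mul_le_of_le_one_left (le_max_right _ _) ha1)
      rw [pow_succ']
      linarith
    calc _ ≤ ∫⁻ x, (ENNReal.ofReal (negProb ν v ε x ^ k - avg ν v x (weight N ε (k + 1)))
          + ∑ l, ‖defect ν v (cutoff ε (k + 1)) l (weight N ε (k + 1)) x‖ₑ) ∂unifLaw :=
          lintegral_mono hpt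
      _ = ∫⁻ x, ENNReal.ofReal (negProb ν v ε x ^ k - avg ν v x (weight N ε (k + 1))) ∂unifLaw
          + ∑ l, ∫⁻ x, ‖defect ν v (cutoff ε (k + 1)) l (weight N ε (k + 1)) x‖ₑ ∂unifLaw := by
          have hm : Measurable fun x => ENNReal.ofReal
              (negProb ν v ε x ^ k - avg ν v x (weight N ε (k + 1))) :=
            (((measurable_negProb ε).pow_const k).sub (measurable_avg_weight (k + 1))).ennreal_ofReal
          rw [lintegral_add_left hm, lintegral_finsetSum _ fun l _ =>
            (measurable_defect (continuous_cutoff ε _) (boundedMeasurable_weight _) l).enorm]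
      _ ≤ ENNReal.ofReal (η / 2) + ∑ _l : Fin (k + 1), ENNReal.ofReal (η / 2 / (k + 1)) := by
          refine add_le_add (H v ((le_max_left _ _).trans hv) N ν) (Finset.sum_le_sum fun l _ => ?_)
          exact K v ((le_max_right _ _).trans hv) N ν _ l (boundedMeasurable_weight _).measurable
            (abs_weight_le_one _)
      _ = ENNReal.ofReal η := by
          rw [← ENNReal.ofReal_sum_of_nonneg fun _ _ => by positivity, ← ENNReal.ofReal_add
            (by positivity) (Finset.sum_nonneg fun _ _ => by positivity), Finset.sum_const,
            Finset.card_univ, Fintype.card_fin, nsmul_eq_mul]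
          congr 1
          push_cast
          field_simp
          ring

/-- Positivity of the overlap, for the law of the parameters: on average, the probability of a
negative overlap is small. -/
lemma exists_lintegral_negProb_le (hε : 0 < ε) :
    ∃ v₁ : ℝ, 1 ≤ v₁ ∧ ∀ v, v₁ ≤ v → ∀ (N : ℕ) (ν : Measure (UnitSphere N))
      [IsProbabilityMeasure ν],
      ∫⁻ x, ENNReal.ofReal (negProb ν v ε x) ∂unifLaw ≤ ENNReal.ofReal ε := by
  -- For this `k` the weight on `k + 1` replicas vanishes, so that the `k`-th moment is small.
  obtain ⟨k, hk⟩ := exists_nat_gt (1 / (ε / 2))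
  rw [div_lt_iff₀ (by positivity)] at hk
  have hk0 : k ≠ 0 := by rintro rfl; norm_num at hk
  obtain ⟨m, rfl⟩ := Nat.exists_eq_succ_of_ne_zero hk0
  obtain ⟨v₁, hv₁, H⟩ := exists_lintegral_negProb_pow_sub_le hε (m + 1) (η := (ε / 2) ^ (m + 1))
    (by positivity)
  refine ⟨v₁, hv₁, fun v hv N ν _ => ?_⟩
  have hH := H v hv N ν
  have hzero : weight N ε (m + 1 + 1) = fun _ => 0 := funext fun z => weight_eq_zero hε hk z
  simp only [hzero, avg_const, sub_zero] at hH
  have hpt : ∀ x, ENNReal.ofReal (negProb ν v ε x) ≤ ENNReal.ofReal (ε / 2)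
      + ENNReal.ofReal (1 / (ε / 2) ^ m) * ENNReal.ofReal (negProb ν v ε x ^ (m + 1)) := by
    intro x
    obtain ⟨ha0, -⟩ := negProb_mem_Icc (ν := ν) (v := v) ε x
    rw [← ENNReal.ofReal_mul (by positivity), ← ENNReal.ofReal_add (by positivity) (by positivity)]
    refine ENNReal.ofReal_le_ofReal ?_
    set a := negProb ν v ε x
    have h0 : 0 ≤ 1 / (ε / 2) ^ m * a ^ (m + 1) := by positivity
    rcases le_total a (ε / 2) with h | h
    · linarith
    · have h1 : a ≤ 1 / (ε / 2) ^ m * a ^ (m + 1) := by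
        rw [one_div_mul_eq_div, le_div_iff₀ (by positivity), pow_succ']
        gcongr
      linarith
  calc ∫⁻ x, ENNReal.ofReal (negProb ν v ε x) ∂unifLaw
      ≤ ENNReal.ofReal (ε / 2) + ENNReal.ofReal (1 / (ε / 2) ^ m)
        * ∫⁻ x, ENNReal.ofReal (negProb ν v ε x ^ (m + 1)) ∂unifLaw := by
        refine (lintegral_mono hpt).trans (le_of_eq ?_)
        rw [lintegral_add_left measurable_const, lintegral_const_mul' _ _ ENNReal.ofReal_ne_top]
        simp
    _ ≤ ENNReal.ofReal (ε / 2) + ENNReal.ofReal (1 / (ε / 2) ^ m)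
        * ENNReal.ofReal ((ε / 2) ^ (m + 1)) := by gcongr
    _ = ENNReal.ofReal ε := by
        rw [← ENNReal.ofReal_mul (by positivity), ← ENNReal.ofReal_add (by positivity)
          (by positivity), one_div_mul_eq_div, pow_succ', mul_div_assoc,
          div_self (by positivity), mul_one, add_halves]

end Negative

/-! ### The joint law of the parameters and the disorder -/

section Transfer

variable {N : ℕ} {ν : Measure (UnitSphere N)} {v ε : ℝ}

lemma map_eq_unifLaw_prod_gaussianLaw {Ω : Type*} [MeasurableSpace Ω] {P : Measure Ω}
    {x : ℕ+ → Ω → ℝ} {G : CoeffIndex N → Ω → ℝ}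
    (hx : ∀ p, HasLaw (x p) (volume.restrict (Set.Icc (0 : ℝ) 1)) P)
    (hG : ∀ i, HasLaw (G i) (gaussianReal 0 1) P) (hind : iIndepFun (Sum.elim x G) P) :
    P.map (fun ω => ((fun p => x p ω, fun i => G i ω) : (ℕ+ → ℝ) × (CoeffIndex N → ℝ)))
      = unifLaw.prod (gaussianLaw N) := by
  set μ : ℕ+ → Measure ℝ := fun _ => volume.restrict (Set.Icc (0 : ℝ) 1) with hμ
  set μ' : CoeffIndex N → Measure ℝ := fun _ => gaussianReal 0 1 with hμ'
  have hinst : ∀ i, IsProbabilityMeasure (Sum.elim μ μ' i) := by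
    rintro (i | i) <;> simp only [Sum.elim_inl, Sum.elim_inr] <;> infer_instance
  have hlaw : ∀ j, HasLaw (Sum.elim x G j) (Sum.elim μ μ' j) P := by
    rintro (p | i)
    · exact hx p
    · exact hG i
  have h1 := hind.map_fun_eq_infinitePi_map₀' fun j => (hlaw j).aemeasurable
  simp only [fun j => (hlaw j).map_eq] at h1
  have h2 := map_sumElim_infinitePi μ μ'
  rw [← h1] at h2
  have hm : Measurable fun r : ℕ+ ⊕ CoeffIndex N → ℝ =>
      ((fun p => r (.inl p), fun i => r (.inr i)) : (ℕ+ → ℝ) × (CoeffIndex N → ℝ)) := by fun_prop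
  have h3 := congrArg (Measure.map fun r : ℕ+ ⊕ CoeffIndex N → ℝ =>
    ((fun p => r (.inl p), fun i => r (.inr i)) : (ℕ+ → ℝ) × (CoeffIndex N → ℝ))) h2
  rw [Measure.map_map hm measurable_sumElim_prod,
    AEMeasurable.map_map_of_aemeasurable hm.aemeasurable
      (aemeasurable_pi_iff.2 fun j => (hlaw j).aemeasurable)] at h3
  exact h3.symm.trans Measure.map_id

variable [IsProbabilityMeasure ν]

lemma ae_good_prod (v : ℝ) : ∀ᵐ q ∂(unifLaw.prod (gaussianLaw N)), Good ν v q.1 q.2 := by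
  refine (Measure.ae_prod_mem_iff_ae_ae_mem (measurableSet_good (ν := ν) v)).2 ?_
  filter_upwards [ae_unifLaw_abs_le] with x hx
  exact ae_good v fun p => (hx p).trans one_le_two

lemma measurableSet_overlap_le (ε : ℝ) :
    MeasurableSet {q : UnitSphere N × UnitSphere N | overlap q.1 q.2 ≤ -ε} :=
  measurable_overlap measurableSet_Iic

lemma measurable_prod_gibbs_overlap_le (v ε : ℝ) :
    Measurable fun q : (ℕ+ → ℝ) × (CoeffIndex N → ℝ) =>
      ((gibbs ν v q.1 q.2).prod (gibbs ν v q.1 q.2)) {r | overlap r.1 r.2 ≤ -ε} := by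
  have h : ∀ q : (ℕ+ → ℝ) × (CoeffIndex N → ℝ),
      ((gibbs ν v q.1 q.2).prod (gibbs ν v q.1 q.2)) {r | overlap r.1 r.2 ≤ -ε}
        = replicas ν v q.1 q.2 2 (MeasurableEquiv.finTwoArrow ⁻¹' {r | overlap r.1 r.2 ≤ -ε}) :=
    fun q => ((measurePreserving_finTwoArrow (gibbs ν v q.1 q.2)).measure_preimage
      (measurableSet_overlap_le ε).nullMeasurableSet).symm
  simp only [h]
  exact (Measure.measurable_coe (MeasurableEquiv.finTwoArrow.measurable
    (measurableSet_overlap_le ε))).comp (measurable_replicas v 2)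

lemma lintegral_prod_gibbs_overlap_le (v ε : ℝ) (x : ℕ+ → ℝ) :
    ∫⁻ G, ((gibbs ν v x G).prod (gibbs ν v x G)) {r | overlap r.1 r.2 ≤ -ε} ∂(gaussianLaw N)
      = ENNReal.ofReal (negProb ν v ε x) := by
  have hbm := boundedMeasurable_indicator_overlap (N := N) ε
  have hnn : ∀ z : Fin 2 → UnitSphere N,
      0 ≤ (Set.Iic (-ε)).indicator (1 : ℝ → ℝ) (overlap (z 0) (z 1)) := fun z =>
    Set.indicator_nonneg (fun _ _ => zero_le_one) _
  rw [negProb, avg, ofReal_integral_eq_lintegral_ofReal hbm.integrable_integral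
    (ae_of_all _ fun G => integral_nonneg hnn)]
  refine lintegral_congr fun G => ?_
  rw [ofReal_integral_eq_lintegral_ofReal (hbm.integrable _) (ae_of_all _ hnn)]
  have h := (measurePreserving_finTwoArrow (gibbs ν v x G)).measure_preimage
    (measurableSet_overlap_le (N := N) ε).nullMeasurableSet
  rw [← h, ← lintegral_indicator_one (MeasurableEquiv.finTwoArrow.measurable
    (measurableSet_overlap_le ε))]
  refine lintegral_congr fun z => ?_
  by_cases hz : overlap (z 0) (z 1) ≤ -ε
  · rw [Set.indicator_of_mem (by exact hz), Set.indicator_of_mem (by exact hz)]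
    simp
  · rw [Set.indicator_of_notMem (by exact hz), Set.indicator_of_notMem (by exact hz)]
    simp

end Transfer

end Positivity

theorem theorem1 (ε : ℝ) (hε : 0 < ε) :
    ∃ v₀ : ℝ, 1 ≤ v₀ ∧ ∀ v : ℝ, v₀ ≤ v →
      ∀ (N : ℕ) (ν : Measure (UnitSphere N)) [IsProbabilityMeasure ν]
        {Ω : Type*} [MeasurableSpace Ω] (P : Measure Ω) [IsProbabilityMeasure P]
        (x : ℕ+ → Ω → ℝ) (G : CoeffIndex N → Ω → ℝ),
        (∀ p, HasLaw (x p) (volume.restrict (Set.Icc (0 : ℝ) 1)) P) →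
        (∀ i, HasLaw (G i) (gaussianReal 0 1) P) →
        iIndepFun (Sum.elim x G) P →
        (∀ᵐ ω ∂P,
          (∀ᵐ z ∂ν, Summable (mixedTerm (fun p => x p ω) (fun i => G i ω) z)) ∧
          Integrable (fun z => Real.exp (mixedField v (fun p => x p ω) (fun i => G i ω) z)) ν) ∧
        AEMeasurable (fun ω => negOverlapProb ε ν v (fun p => x p ω) (fun i => G i ω)) P ∧
        ∫⁻ ω, negOverlapProb ε ν v (fun p => x p ω) (fun i => G i ω) ∂P ≤ ENNReal.ofReal ε := by
  obtain ⟨v₀, hv₀, H⟩ := Positivity.exists_lintegral_negProb_le hε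
  refine ⟨v₀, hv₀, fun v hv N ν _ Ω _ P _ x G hx hG hind => ?_⟩
  have hlaw := Positivity.map_eq_unifLaw_prod_gaussianLaw hx hG hind
  have hX : AEMeasurable (fun ω => ((fun p => x p ω, fun i => G i ω) :
      (ℕ+ → ℝ) × (CoeffIndex N → ℝ))) P :=
    (aemeasurable_pi_iff.2 fun p => (hx p).aemeasurable).prodMk
      (aemeasurable_pi_iff.2 fun i => (hG i).aemeasurable)
  have hgood : ∀ᵐ ω ∂P, Positivity.Good ν v (fun p => x p ω) (fun i => G i ω) := by
    have h := Positivity.ae_good_prod (ν := ν) v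
    rw [← hlaw] at h
    exact ae_of_ae_map hX h
  set Φ : (ℕ+ → ℝ) × (CoeffIndex N → ℝ) → ENNReal := fun q =>
    ((Positivity.gibbs ν v q.1 q.2).prod (Positivity.gibbs ν v q.1 q.2))
      {r | Positivity.overlap r.1 r.2 ≤ -ε} with hΦ
  have hΦm : Measurable Φ := Positivity.measurable_prod_gibbs_overlap_le v ε
  have heq : (fun ω => negOverlapProb ε ν v (fun p => x p ω) (fun i => G i ω))
      =ᵐ[P] fun ω => Φ (fun p => x p ω, fun i => G i ω) := by
    filter_upwards [hgood] with ω hω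
    simp only [hΦ, Positivity.gibbs_eq_perturbed hω]
    rfl
  refine ⟨hgood, (hΦm.comp_aemeasurable hX).congr heq.symm, ?_⟩
  rw [lintegral_congr_ae heq, ← lintegral_map' hΦm.aemeasurable hX, hlaw,
    lintegral_prod _ hΦm.aemeasurable]
  simp only [hΦ, Positivity.lintegral_prod_gibbs_overlap_le]
  exact H v hv N ν
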